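/- Let $p$ be a prime with $5\le p\le 19$ and put $\delta_p=(p^2-1)/24$. For integers $t\ge 1$ and $m\ge 0$ let $c_t(m)$ be the number of $t$-core partitions of $m$, that is, of partitions of $m$ whose Young diagram has no hook number divisible by $t$ (the hook of a square consists of that square, all squares to its right in the same row, and all squares below it in the same column; its hook number is the number of squares in it). Let $(a_{k,p})_{1\le k\le (p-1)/2}$ be $$(a_{k,5})=(1,2),\quad (a_{k,7})=(1,2,3),\quad (a_{k,11})=(1,2,3,5,7),\quad (a_{k,13})=(1,2,3,4,5,7),$$ $$(a_{k,17})=(1,2,3,5,7,8,11,13),\quad (a_{k,19})=(1,2,3,4,5,7,9,11,13).$$ For $d\in\mathbb Z$ define $$\ell_p(d)=2\sum_{\chi}\frac{\chi(d)}{L(0,\chi)},$$ where $\chi$ runs over the primitive Dirichlet characters modulo $p$ with $\chi(-1)=-1$ and $L(s,\chi)$ is the analytic continuation of the Dirichlet $L$-series of $\chi$. Then for every integer $n\ge\delta_p$, $$c_p(n-\delta_p)=\Bigl(\frac{2}{p-1}\Bigr)^{\frac{p-3}{2}}\sum_{r_1+\cdots+r_{(p-3)/2}=n}\ \prod_{k=1}^{(p-3)/2}\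 \sum_{d\mid r_k}\ell_p(a_{k+1,p}\,d)\;+\;\Bigl(\frac{2}{p-1}\Bigr)^{\frac{p-1}{2}}\sum_{r_1+\cdots+r_{(p-1)/2}=n}\ \prod_{k=1}^{(p-1)/2}\ \sum_{d\mid r_k}\ell_p(a_{k,p}\,d),$$ where the outer sums run over tuples of integers $r_i\ge 1$ and the inner sums over positive divisors $d$ of $r_k$. -/

import Mathlib

namespace CoreConv

/-- The Young diagram of a partition of `n`: its rows are the parts in weakly decreasing order. -/
def youngDiagram {n : ℕ} (lam : n.Partition) : YoungDiagram :=
  YoungDiagram.ofRowLens (lam.parts.sort (· ≥ ·)) (lam.parts.pairwise_sort (· ≥ ·)).sortedGE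

/-- The hook of the square `c` of a Young diagram: the square itself, all the squares to its right
(in the same row) and all the squares below it (in the same column). -/
def hook (μ : YoungDiagram) (c : ℕ × ℕ) : Finset (ℕ × ℕ) :=
  μ.cells.filter fun x => (x.1 = c.1 ∧ c.2 ≤ x.2) ∨ (x.2 = c.2 ∧ c.1 ≤ x.1)

/-- The hook number of the square `c`. -/
def hookNumber (μ : YoungDiagram) (c : ℕ × ℕ) : ℕ := (hook μ c).card

/-- A partition is a `t`-core if none of its hook numbers is a multiple of `t`. -/
def IsCore (t : ℕ) {n : ℕ} (lam : n.Partition) : Prop :=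
  ∀ c ∈ (youngDiagram lam).cells, ¬ t ∣ hookNumber (youngDiagram lam) c

open Classical in
/-- `c_t(n)`, the number of `t`-core partitions of `n`. -/
noncomputable def coreCount (t n : ℕ) : ℕ :=
  (Finset.univ.filter fun lam : n.Partition => IsCore t lam).card

/-- `δ_p = (p ^ 2 - 1) / 24`; the division is exact for every prime `p ≥ 5`. -/
def delta (p : ℕ) : ℕ := (p ^ 2 - 1) / 24

/-- The list `a_{1,p}, …, a_{(p-1)/2,p}` for the primes `5 ≤ p ≤ 19`. -/
def repList : ℕ → List ℕ
  | 5 => [1, 2]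
  | 7 => [1, 2, 3]
  | 11 => [1, 2, 3, 5, 7]
  | 13 => [1, 2, 3, 4, 5, 7]
  | 17 => [1, 2, 3, 5, 7, 8, 11, 13]
  | 19 => [1, 2, 3, 4, 5, 7, 9, 11, 13]
  | _ => []

/-- `a_{k,p}`, for `1 ≤ k ≤ (p - 1) / 2`. -/
def rep (p k : ℕ) : ℤ := ((repList p).getD (k - 1) 0 : ℕ)

open Classical in
/-- `ℓ_p(d) = 2 ∑ χ(d) / L(0, χ)`, over the odd primitive Dirichlet characters `χ` mod `p`; here
`L(s, χ)` is the analytic continuation of the Dirichlet `L`-series. -/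
noncomputable def ell (p : ℕ) [NeZero p] (d : ℤ) : ℂ :=
  2 * ∑ χ : DirichletCharacter ℂ p with χ.Odd ∧ χ.IsPrimitive,
    χ (d : ZMod p) / DirichletCharacter.LFunction χ 0

open Classical in
/-- The tuples `(r_1, …, r_m)` of integers `r_k ≥ 1` with `r_1 + ⋯ + r_m = n` (as functions on `ℕ`
that vanish outside `{1, …, m}`). -/
noncomputable def compositions (m n : ℕ) : Finset (ℕ → ℕ) :=
  {r ∈ (Finset.Icc 1 m).piAntidiag n | ∀ k ∈ Finset.Icc 1 m, 1 ≤ r k}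

end CoreConv

/-! Let w = 2ℓ_p/(p-1). Orthogonality of characters and the formula L(0,χ) = ∑ (1/2 - c/p) χ(c)
identify w as the odd function on ℤ/p with ∑_c (1/2 - c/p) w(cd) = 2([d = 1] - [d = -1])
(`LFunction_zero_of_odd`, `ell_eq`); for the primes in question it is a short table of integers.

For a residue a, the series E_a = [a = 1] - [a = -1] + ∑_n (∑_{d∣n} w(ad)) q^n is an Eisenstein
series of weight one, namely a combination of the values at b/p of the Weierstrass zeta function
corrected by G₂ (`weightOne_eq_evalAt`). Up to the automorphy factor Γ₀(p) permutes the E_a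
(`weightOne_smul`), so the product over all units a has weight p-1 on Γ₀(p). The low coefficients
show that it vanishes at ∞ to order (p²-1)/12, which is the total number of zeros of such a form.
Hence its 12th power times Δ(τ)/Δ(pτ)^p is holomorphic, invariant and bounded at both cusps, so
constant (`pow_mul_pow_pentagonalSeries_eq`). Since E_{-a} = -E_a, taking 24th roots gives ∏_k
E_{a_k} = q^δ ∏_n (1 - q^{pn})^p/(1 - q^n).

The right side is q^δ ∑ c_p(n) q^n (`mk_coreCount_mul_pentagonalSeries`): by beta-numbers, p-cores
are finite sets of naturals closed under subtraction of p, that is, vectors counting elements in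
each class mod p, and Euler's expansion of ∏ (1 + z q^j), split by j mod p, counts these.

Among the E_{a_k} only E_1 has a nonzero constant term, and writing E_1 = 1 + (E_1 - 1) produces the
two sums of the theorem. -/

namespace CoreConv

/-! ### Power series on the open unit disc, and the Euler product. -/

open PowerSeries Filter Topology

/-- A complex power series converges absolutely in the open unit disc. -/
def ConvDisc (P : ℂ⟦X⟧) : Prop := ∀ q : ℂ, ‖q‖ < 1 → Summable fun n => ‖coeff n P * q ^ n‖

/-- The value of a complex power series at a point of the unit disc. -/
noncomputable def evalAt (P : ℂ⟦X⟧) (q : ℂ) : ℂ := ∑' n, coeff n P * q ^ n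

lemma ConvDisc.hasSum {P : ℂ⟦X⟧} (hP : ConvDisc P) {q : ℂ} (hq : ‖q‖ < 1) :
    HasSum (fun n => coeff n P * q ^ n) (evalAt P q) :=
  (hP q hq).of_norm.hasSum

lemma coeff_mul_mul_pow (P Q : ℂ⟦X⟧) (q : ℂ) (n : ℕ) :
    ∑ kl ∈ Finset.HasAntidiagonal.antidiagonal n, coeff kl.1 P * q ^ kl.1 * (coeff kl.2 Q * q ^ kl.2) =
      coeff n (P * Q) * q ^ n := by
  rw [coeff_mul, Finset.sum_mul]
  refine Finset.sum_congr rfl fun kl hkl => ?_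
  rw [← Finset.HasAntidiagonal.mem_antidiagonal.mp hkl, pow_add]
  ring

lemma ConvDisc.mul {P Q : ℂ⟦X⟧} (hP : ConvDisc P) (hQ : ConvDisc Q) : ConvDisc (P * Q) := by
  intro q hq
  refine (summable_norm_sum_mul_antidiagonal_of_summable_norm (hP q hq) (hQ q hq)).congr fun n => ?_
  rw [coeff_mul_mul_pow]

lemma evalAt_mul {P Q : ℂ⟦X⟧} (hP : ConvDisc P) (hQ : ConvDisc Q) {q : ℂ} (hq : ‖q‖ < 1) :
    evalAt (P * Q) q = evalAt P q * evalAt Q q := by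
  rw [evalAt, evalAt, evalAt,
    tsum_mul_tsum_eq_tsum_sum_antidiagonal_of_summable_norm (hP q hq) (hQ q hq)]
  exact tsum_congr fun n => (coeff_mul_mul_pow P Q q n).symm

lemma convDisc_X_pow (k : ℕ) : ConvDisc (X ^ k) := by
  intro q _
  refine summable_of_ne_finset_zero (s := {k}) fun n hn => ?_
  rw [coeff_X_pow, if_neg (by simpa using hn), zero_mul, norm_zero]

@[simp] lemma evalAt_X_pow (k : ℕ) (q : ℂ) : evalAt (X ^ k) q = q ^ k := by
  rw [evalAt, tsum_eq_single k fun n hn => by rw [coeff_X_pow, if_neg hn, zero_mul]]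
  simp

lemma convDisc_one : ConvDisc 1 := by simpa using convDisc_X_pow 0

@[simp] lemma evalAt_one (q : ℂ) : evalAt 1 q = 1 := by simpa using evalAt_X_pow 0 q

lemma ConvDisc.prod {ι : Type*} (s : Finset ι) {P : ι → ℂ⟦X⟧} (hP : ∀ i ∈ s, ConvDisc (P i)) :
    ConvDisc (∏ i ∈ s, P i) :=
  Finset.prod_induction _ _ (fun _ _ => ConvDisc.mul) convDisc_one hP

lemma evalAt_prod {ι : Type*} (s : Finset ι) {P : ι → ℂ⟦X⟧} (hP : ∀ i ∈ s, ConvDisc (P i))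
    {q : ℂ} (hq : ‖q‖ < 1) : evalAt (∏ i ∈ s, P i) q = ∏ i ∈ s, evalAt (P i) q := by
  classical
  induction s using Finset.induction_on with
  | empty => simp
  | insert a s ha ih =>
    rw [Finset.prod_insert ha, Finset.prod_insert ha, evalAt_mul (hP a (by simp))
      (ConvDisc.prod s fun i hi => hP i (by simp [hi])) hq, ih fun i hi => hP i (by simp [hi])]

lemma ConvDisc.pow {P : ℂ⟦X⟧} (hP : ConvDisc P) (k : ℕ) : ConvDisc (P ^ k) := by
  simpa using ConvDisc.prod (Finset.range k) (P := fun _ => P) fun _ _ => hP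

lemma evalAt_pow {P : ℂ⟦X⟧} (hP : ConvDisc P) (k : ℕ) {q : ℂ} (hq : ‖q‖ < 1) :
    evalAt (P ^ k) q = evalAt P q ^ k := by
  simpa using evalAt_prod (Finset.range k) (P := fun _ => P) (fun _ _ => hP) hq

lemma coeff_expand_mul_pow (t : ℕ) (ht : t ≠ 0) (P : ℂ⟦X⟧) (q : ℂ) (m : ℕ) :
    coeff (t * m) (expand t ht P) * q ^ (t * m) = coeff m P * (q ^ t) ^ m := by
  rw [coeff_expand_mul, pow_mul]

lemma ConvDisc.expand {P : ℂ⟦X⟧} (hP : ConvDisc P) (t : ℕ) (ht : t ≠ 0) :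
    ConvDisc (expand t ht P) := by
  intro q hq
  have hinj : Function.Injective fun m : ℕ => t * m := fun a b h =>
    Nat.eq_of_mul_eq_mul_left (Nat.pos_of_ne_zero ht) h
  rw [← hinj.summable_iff]
  · refine (hP (q ^ t) (by rw [norm_pow]; exact pow_lt_one₀ (norm_nonneg _) hq ht)).congr
      fun m => ?_
    simp only [Function.comp_apply]
    rw [coeff_expand_mul_pow]
  · intro n hn
    rw [coeff_expand_of_not_dvd, zero_mul, norm_zero]
    rintro ⟨m, rfl⟩
    exact hn ⟨m, rfl⟩

lemma evalAt_expand (P : ℂ⟦X⟧) (t : ℕ) (ht : t ≠ 0) (q : ℂ) :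
    evalAt (expand t ht P) q = evalAt P (q ^ t) := by
  have hinj : Function.Injective fun m : ℕ => t * m := fun a b h =>
    Nat.eq_of_mul_eq_mul_left (Nat.pos_of_ne_zero ht) h
  rw [evalAt, ← hinj.tsum_eq]
  · exact tsum_congr fun m => coeff_expand_mul_pow t ht P q m
  · intro n hn
    by_contra h
    refine hn ?_
    beta_reduce
    rw [coeff_expand_of_not_dvd, zero_mul]
    rintro ⟨m, rfl⟩
    exact h ⟨m, rfl⟩

lemma tendsto_evalAt_zero {P : ℂ⟦X⟧} (hP : ConvDisc P) :
    Tendsto (evalAt P) (𝓝 0) (𝓝 (coeff 0 P)) := by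
  have h := tendsto_tsum_of_dominated_convergence (𝓕 := 𝓝 (0 : ℂ))
    (f := fun q n => coeff n P * q ^ n) (g := fun n => coeff n P * 0 ^ n)
    (hP (1 / 2 : ℂ) (by norm_num))
    (fun n => (continuous_const.mul (continuous_pow n)).tendsto 0) ?_
  · convert! h using 2
    rw [tsum_eq_single 0 fun n hn => by simp [hn]]
    simp
  · filter_upwards [Metric.ball_mem_nhds (0 : ℂ) (by norm_num : (0 : ℝ) < 1 / 2)] with q hq n
    rw [norm_mul, norm_mul, norm_pow, norm_pow]
    gcongr
    rw [mem_ball_zero_iff] at hq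
    exact hq.le.trans (by norm_num)

lemma ConvDisc.of_X_pow_mul {P : ℂ⟦X⟧} {k : ℕ} (h : ConvDisc (X ^ k * P)) : ConvDisc P := by
  intro q hq
  rcases eq_or_ne q 0 with rfl | hq0
  · refine summable_of_ne_finset_zero (s := {0}) fun n hn => ?_
    simp [show n ≠ 0 by simpa using hn]
  have h1 := ((summable_nat_add_iff k).mpr (h q hq)).mul_left (‖q ^ k‖⁻¹)
  refine h1.congr fun n => ?_
  rw [coeff_X_pow_mul, pow_add, ← norm_inv, ← norm_mul]
  congr 1
  field_simp

/-- The point 0 is left out because a nome is never 0. If the difference were nonzero, removing its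
leading power of `X` would leave a series with nonzero constant term vanishing at all small q ≠ 0,
against continuity at 0. -/
lemma eq_of_evalAt_eq {P Q : ℂ⟦X⟧} (hP : ConvDisc P) (hQ : ConvDisc Q)
    (h : ∀ q : ℂ, q ≠ 0 → ‖q‖ < 1 → evalAt P q = evalAt Q q) : P = Q := by
  have hD : ConvDisc (P - Q) := fun q hq =>
    ((hP q hq).add (hQ q hq)).of_nonneg_of_le (fun _ => norm_nonneg _) fun n => by
      rw [map_sub, sub_mul]; exact norm_sub_le _ _
  have hev : ∀ q : ℂ, q ≠ 0 → ‖q‖ < 1 → evalAt (P - Q) q = 0 := fun q hq0 hq => by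
    have := (hP.hasSum hq).sub (hQ.hasSum hq)
    rw [h q hq0 hq, sub_self] at this
    rw [evalAt, ← this.tsum_eq]
    exact tsum_congr fun n => by rw [map_sub, sub_mul]
  by_contra hne
  have hne' : P - Q ≠ 0 := sub_ne_zero.mpr hne
  obtain ⟨E, hE⟩ := X_pow_order_dvd (φ := P - Q)
  set k := (P - Q).order.toNat with hk
  have hEc : coeff 0 E ≠ 0 := by
    have := coeff_order hne'
    rw [hE] at this
    rwa [← hE, ← hk, ← zero_add k, hE, coeff_X_pow_mul] at this
  have hEconv : ConvDisc E := ConvDisc.of_X_pow_mul (k := k) (hE ▸ hD)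
  have hE0 : ∀ q : ℂ, q ≠ 0 → ‖q‖ < 1 → evalAt E q = 0 := fun q hq0 hq => by
    have := hev q hq0 hq
    rw [hE, evalAt_mul (convDisc_X_pow k) hEconv hq, evalAt_X_pow] at this
    exact (mul_eq_zero.mp this).resolve_left (pow_ne_zero _ hq0)
  refine hEc (tendsto_nhds_unique ((tendsto_evalAt_zero hEconv).mono_left
    (nhdsWithin_le_nhds (s := {0}ᶜ))) (tendsto_const_nhds.congr' ?_))
  filter_upwards [self_mem_nhdsWithin,
    nhdsWithin_le_nhds (Metric.ball_mem_nhds (0 : ℂ) one_pos)] with q hq0 hq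
  exact (hE0 q hq0 (by simpa using hq)).symm

lemma differentiableOn_evalAt {P : ℂ⟦X⟧} (hP : ConvDisc P) :
    DifferentiableOn ℂ (evalAt P) (Metric.ball 0 1) := by
  intro q hq
  obtain ⟨r, hr1, hr2⟩ := exists_between (mem_ball_zero_iff.mp hq)
  have hr0 : 0 < r := (norm_nonneg q).trans_lt hr1
  have h := Complex.differentiableOn_tsum_of_summable_norm (U := Metric.ball (0 : ℂ) r)
    (F := fun n q => coeff n P * q ^ n)
    (hP (r : ℂ) (by rw [Complex.norm_real, Real.norm_of_nonneg hr0.le]; exact hr2))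
    (fun n => by fun_prop) Metric.isOpen_ball (fun n w hw => by
      rw [norm_mul, norm_mul, norm_pow, norm_pow, Complex.norm_real, Real.norm_of_nonneg hr0.le]
      gcongr
      exact (mem_ball_zero_iff.mp hw).le)
  exact ((h q (mem_ball_zero_iff.mpr hr1)).differentiableAt
    (Metric.isOpen_ball.mem_nhds (mem_ball_zero_iff.mpr hr1))).differentiableWithinAt

lemma convDisc_pentagonalSeries : ConvDisc (pentagonalSeries ℂ) := by
  intro q hq
  refine (summable_geometric_of_lt_one (norm_nonneg q) hq).of_nonneg_of_le
    (fun _ => norm_nonneg _) fun n => ?_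
  rw [norm_mul, norm_pow]
  refine mul_le_of_le_one_left (by positivity) ?_
  rw [pentagonalSeries, coeff_mk]
  split_ifs with h
  · rcases Int.even_or_odd h.choose with h' | h'
    · simp [Int.negOnePow_even _ h']
    · simp [Int.negOnePow_odd _ h']
  · simp

/-- Each factor is at most 1 + |q|^i ≤ exp(|q|^i). The bound does not depend on `s` or `f`, which
gives the uniform domination needed to apply the pentagonal number theorem. -/
lemma norm_prod_one_sub_pow_le {q : ℂ} (hq : ‖q‖ < 1) (s : Finset ℕ) (f : ℕ → ℕ)
    (hf : ∀ i, i ≤ f i) :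
    ‖∏ i ∈ s, (1 - q ^ f i)‖ ≤ Real.exp (1 - ‖q‖)⁻¹ := by
  rw [norm_prod]
  calc ∏ i ∈ s, ‖1 - q ^ f i‖ ≤ ∏ i ∈ s, Real.exp (‖q‖ ^ i) := by
        refine Finset.prod_le_prod (fun _ _ => norm_nonneg _) fun i _ => ?_
        calc ‖1 - q ^ f i‖ ≤ 1 + ‖q‖ ^ f i := by
              simpa using norm_sub_le (1 : ℂ) (q ^ f i)
          _ ≤ ‖q‖ ^ i + 1 := by
              rw [add_comm]; gcongr 1
              exact pow_le_pow_of_le_one (norm_nonneg q) hq.le (hf i)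
          _ ≤ _ := Real.add_one_le_exp _
    _ = Real.exp (∑ i ∈ s, ‖q‖ ^ i) := (Real.exp_sum s _).symm
    _ ≤ _ := by
        rw [← tsum_geometric_of_lt_one (norm_nonneg q) hq]
        exact Real.exp_le_exp.mpr
          ((summable_geometric_of_lt_one (norm_nonneg q) hq).sum_le_tsum s
            fun i _ => by positivity)

lemma norm_pow_mul_prod_le {q : ℂ} (hq : ‖q‖ < 1) (k n : ℕ) :
    ‖q ^ ((k + 1) * n) * ∏ i ∈ Finset.range (n + 1), (1 - q ^ (k + i + 1))‖ ≤
      Real.exp (1 - ‖q‖)⁻¹ * ‖q‖ ^ n := by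
  rw [norm_mul, mul_comm, norm_pow]
  refine mul_le_mul (norm_prod_one_sub_pow_le hq _ _ fun i => by omega)
    (pow_le_pow_of_le_one (norm_nonneg q) hq.le (Nat.le_mul_of_pos_left _ k.succ_pos))
    (by positivity) (Real.exp_nonneg _)

lemma evalAt_pentagonalSeries {q : ℂ} (hq : ‖q‖ < 1) :
    evalAt (pentagonalSeries ℂ) q = ∏' n : ℕ, (1 - q ^ (n + 1)) := by
  have hnn := norm_nonneg q
  have hg := (summable_geometric_of_lt_one hnn hq).mul_left (Real.exp (1 - ‖q‖)⁻¹)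
  have hS : HasSum (fun k : ℤ => ((Int.negOnePow k : ℤ) : ℂ) * q ^ pentagonal k)
      (evalAt (pentagonalSeries ℂ) q) := by
    have h := convDisc_pentagonalSeries.hasSum hq
    rw [← pentagonal_injective.hasSum_iff] at h
    · simpa [Function.comp_def] using h
    · intro n hn
      rw [coeff_pentagonalSeries_eq_zero ℂ hn, zero_mul]
  -- The bilateral pentagonal sum is folded into pairs of indices -k and k + 1, which have opposite
  -- signs.
  have hS' : HasSum (fun k : ℕ => (-1 : ℂ) ^ k * (q ^ pentagonal (-k) - q ^ pentagonal (k + 1)))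
      (evalAt (pentagonalSeries ℂ) q) := by
    rw [← neg_injective.hasSum_iff (fun x hx ↦ by absurd hx; use -x; simp)] at hS
    convert hS.nat_add_neg_add_one using 2 with k
    simp_rw [Function.comp_apply, neg_neg, Int.negOnePow_add]
    simp [Int.negOnePow_neg, Int.coe_negOnePow]
    ring
  rw [Pentagonal.tprod_one_sub_pow]
  · exact hS'.tsum_eq.symm
  · exact tendsto_pow_atTop_nhds_zero_of_norm_lt_one hq
  · intro k
    exact Summable.of_norm_bounded hg fun n => norm_pow_mul_prod_le hq k n
  · intro k
    simp_rw [sub_eq_add_neg]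
    refine multipliable_one_add_of_summable ?_
    simp_rw [norm_neg, norm_pow]
    exact (summable_geometric_of_lt_one hnn hq).comp_injective (i := fun n : ℕ => n + k + 1)
      fun a b h => by simpa using h
  · exact hS'.summable
  · refine squeeze_zero_norm (a := fun k : ℕ => ‖q‖ ^ k *
      ∑' n, Real.exp (1 - ‖q‖)⁻¹ * ‖q‖ ^ n) (fun k => ?_) ?_
    · rw [norm_mul]
      refine mul_le_mul ?_ (tsum_of_norm_bounded hg.hasSum fun n => norm_pow_mul_prod_le hq k n)
        (norm_nonneg _) (by positivity)
      rw [norm_mul, norm_pow, norm_neg, norm_one, one_pow, one_mul, norm_pow]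
      refine pow_le_pow_of_le_one hnn hq.le ?_
      rw [Nat.le_div_iff_mul_le two_pos]
      nlinarith
    · simpa using (tendsto_pow_atTop_nhds_zero_of_lt_one hnn hq).mul_const
        (∑' n, Real.exp (1 - ‖q‖)⁻¹ * ‖q‖ ^ n)

end CoreConv

/-! ### Euler's q-series and the formal generating function. -/

namespace CoreConv

open PowerSeries

/-- The `q`-Pochhammer product `(1 - q) (1 - q ^ 2) ⋯ (1 - q ^ N)`. -/
def qFactor {R : Type*} [CommRing R] (q : R) (N : ℕ) : R := ∏ j ∈ Finset.range N, (1 - q ^ (j + 1))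

/-- Comparing coefficients in the functional equation gives (1 - q^{N+1}) h_{N+1} = q^N h_N, and the
exponents N add up to binomial coefficients. -/
lemma coeff_mul_qFactor {R : Type*} [CommRing R] {q : R} {h : R⟦X⟧} (h0 : coeff 0 h = 1)
    (hh : h = (1 + X) * rescale q h) (N : ℕ) : coeff N h * qFactor q N = q ^ N.choose 2 := by
  induction N with
  | zero => simpa [qFactor] using h0
  | succ N ih =>
    have h1 : coeff (N + 1) h = q ^ (N + 1) * coeff (N + 1) h + q ^ N * coeff N h := by
      conv_lhs => rw [hh]
      rw [add_mul, one_mul, map_add, coeff_succ_X_mul, coeff_rescale, coeff_rescale]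
    rw [qFactor, Finset.prod_range_succ, ← qFactor, Nat.choose_succ_succ' N 1, Nat.choose_one_right,
      show (1 + 1) = 2 from rfl, pow_add q N (N.choose 2), ← ih]
    linear_combination qFactor q N * h1

lemma constantCoeff_qFactor (s : ℕ) (hs : s ≠ 0) (N : ℕ) :
    constantCoeff (qFactor ((X : ℂ⟦X⟧) ^ s) N) = 1 := by
  simp [qFactor, hs]

/-- Euler's series `∑ z ^ k q ^ (k choose 2) / (q; q)_k`. -/
noncomputable def eulerSeries (q : ℂ⟦X⟧) : ℂ⟦X⟧⟦X⟧ :=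
  mk fun k => q ^ k.choose 2 * (qFactor q k)⁻¹

/-- This is the functional equation of ∏_j (1 + z q^j). On coefficients it only says that
consecutive Pochhammer products differ by the factor 1 - q^{k+1}. -/
lemma eulerSeries_eq (s : ℕ) (hs : s ≠ 0) :
    eulerSeries (X ^ s) = (1 + X) * rescale ((X : ℂ⟦X⟧) ^ s) (eulerSeries (X ^ s)) := by
  have hc : ∀ k, constantCoeff (qFactor ((X : ℂ⟦X⟧) ^ s) k) ≠ 0 := fun k => by
    rw [constantCoeff_qFactor s hs]; exact one_ne_zero
  ext1 k
  rcases k with _ | k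
  · rw [add_mul, one_mul, map_add, coeff_zero_X_mul, coeff_rescale, pow_zero, one_mul, add_zero]
  rw [add_mul, one_mul, map_add, coeff_succ_X_mul, coeff_rescale, coeff_rescale]
  simp only [eulerSeries, coeff_mk]
  set q : ℂ⟦X⟧ := X ^ s
  have h1 : qFactor q (k + 1) = qFactor q k * (1 - q ^ (k + 1)) := Finset.prod_range_succ _ _
  have h2 : (qFactor q k)⁻¹ = (qFactor q (k + 1))⁻¹ * (1 - q ^ (k + 1)) := by
    rw [PowerSeries.inv_eq_iff_mul_eq_one (hc k), mul_assoc, mul_comm (1 - q ^ (k + 1)), ← h1,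
      PowerSeries.inv_mul_cancel _ (hc (k + 1))]
  rw [h2, Nat.choose_succ_succ' k 1, Nat.choose_one_right, pow_add]
  ring

/-- The factors 1 + z X^j are split by j mod t: the product of the t rescaled series in base X^t
satisfies the functional equation in base X, which determines its coefficients. -/
lemma coeff_prod_rescale_eulerSeries (t : ℕ) (ht : t ≠ 0) (N : ℕ) :
    coeff N (∏ i ∈ Finset.range t, rescale ((X : ℂ⟦X⟧) ^ i) (eulerSeries (X ^ t))) *
      qFactor X N = X ^ N.choose 2 := by
  have h0 : coeff 0 (eulerSeries (X ^ t)) = 1 := by simp [eulerSeries, qFactor]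
  refine coeff_mul_qFactor ?_ ?_ N
  · rw [coeff_zero_eq_constantCoeff_apply, map_prod]
    refine Finset.prod_eq_one fun i _ => ?_
    rw [← coeff_zero_eq_constantCoeff_apply, coeff_rescale, h0, pow_zero, one_mul]
  · have hne : rescale ((X : ℂ⟦X⟧) ^ t) (eulerSeries (X ^ t)) ≠ 0 := fun h => by
      have := congrArg (coeff 0) h
      rw [coeff_rescale, h0] at this
      simp at this
    -- Rescaling by `X` shifts the factors 0, …, t-1 to 1, …, t. After multiplication by the factor
    -- t, only the end factors 0 and t differ, and the equation in base X^t relates these.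
    refine mul_right_cancel₀ hne ?_
    rw [← Finset.prod_range_succ, Finset.prod_range_succ', pow_zero, rescale_one, map_prod,
      RingHom.id_apply]
    simp_rw [rescale_rescale, ← pow_succ]
    rw [mul_right_comm, ← eulerSeries_eq t ht, mul_comm]

/-- The total of the set of integers with `l i` elements `i, i + t, i + 2 t, …` in each class. -/
def runnerSum (t : ℕ) (l : ℕ → ℕ) : ℕ := ∑ i ∈ Finset.range t, (i * l i + t * (l i).choose 2)

/-- Both sides count the N-element sets of naturals by their total; the sum sorts them by the number
l_i of elements in each class i mod t. -/
lemma sum_runnerSum (t : ℕ) (ht : t ≠ 0) (N : ℕ) :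
    (∑ l ∈ (Finset.range t).finsuppAntidiag N, (X : ℂ⟦X⟧) ^ runnerSum t l *
      ∏ i ∈ Finset.range t, (qFactor (X ^ t) (l i))⁻¹) * qFactor X N = X ^ N.choose 2 := by
  rw [← coeff_prod_rescale_eulerSeries t ht N, coeff_prod]
  congr 1
  refine Finset.sum_congr rfl fun l _ => ?_
  rw [runnerSum, ← Finset.prod_pow_eq_pow_sum, ← Finset.prod_mul_distrib]
  refine Finset.prod_congr rfl fun i _ => ?_
  rw [coeff_rescale, eulerSeries, coeff_mk, pow_add, pow_mul, pow_mul]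
  ring

/-- Factors 1 - X^j with j > N ≥ n do not affect the coefficient of X^n, so it already has its
limiting value. -/
lemma coeff_qFactor (n N : ℕ) (h : n ≤ N) :
    coeff n (qFactor (X : ℂ⟦X⟧) N) = coeff n (pentagonalSeries ℂ) := by
  obtain ⟨s, hs⟩ := (coeff_prod_one_sub_X_pow_eventually_eq ℂ n).exists_forall_of_atTop
  obtain ⟨M, hM⟩ := Finset.exists_nat_subset_range s
  have key : ∀ k, coeff n (qFactor (X : ℂ⟦X⟧) (N + k)) = coeff n (qFactor (X : ℂ⟦X⟧) N) := by
    intro k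
    induction k with
    | zero => rfl
    | succ k ih =>
      rw [← ih, ← add_assoc, qFactor, Finset.prod_range_succ, ← qFactor, mul_sub, mul_one, map_sub,
        coeff_mul_X_pow', if_neg (by omega), sub_zero]
  rw [← key M, ← hs (Finset.range (N + M)) (hM.trans (Finset.range_mono (by omega)))]
  rfl

lemma X_pow_dvd_pentagonalSeries_sub (N : ℕ) :
    (X : ℂ⟦X⟧) ^ (N + 1) ∣ pentagonalSeries ℂ - qFactor X N := by
  rw [X_pow_dvd_iff]
  intro m hm
  rw [map_sub, coeff_qFactor m N (by omega), sub_self]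

lemma X_pow_dvd_expand_sub (t : ℕ) (ht : t ≠ 0) {n N : ℕ} (h : n ≤ N) :
    (X : ℂ⟦X⟧) ^ (n + 1) ∣ expand t ht (pentagonalSeries ℂ) - qFactor (X ^ t) N := by
  obtain ⟨d, hd⟩ := X_pow_dvd_pentagonalSeries_sub N
  have h1 : expand t ht (pentagonalSeries ℂ) - qFactor (X ^ t) N =
      X ^ (t * (N + 1)) * expand t ht d := by
    have h2 : expand t ht (qFactor X N) = qFactor ((X : ℂ⟦X⟧) ^ t) N := by
      simp only [qFactor, map_prod, map_sub, map_one, map_pow, expand_X]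
    rw [← h2, ← map_sub, hd, map_mul, map_pow, expand_X, pow_mul]
  rw [h1]
  exact (pow_dvd_pow _ ((Nat.le_mul_of_pos_left _ (Nat.pos_of_ne_zero ht)).trans'
    (by omega))).mul_right _

/-- If for each `n` and all large `N` the vectors `l` with total `N` of small `runnerSum` are
counted by `c`, then `c` has the generating function `∏ (1 - X ^ (t n)) ^ t / (1 - X ^ n)`. -/
lemma mk_mul_pentagonalSeries_of_card (t : ℕ) (ht : t ≠ 0) (c : ℕ → ℕ)
    (hle : ∀ N, ∀ l ∈ (Finset.range t).finsuppAntidiag N, N.choose 2 ≤ runnerSum t l)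
    (hN : ∀ n, ∃ N, n ≤ N ∧
      (∀ l ∈ (Finset.range t).finsuppAntidiag N, runnerSum t l ≤ N.choose 2 + n →
        ∀ i ∈ Finset.range t, n ≤ l i) ∧
      ∀ m ≤ n, (((Finset.range t).finsuppAntidiag N).filter
        fun l : ℕ →₀ ℕ => runnerSum t l = N.choose 2 + m).card = c m) :
    (mk fun n => (c n : ℂ)) * pentagonalSeries ℂ = expand t ht (pentagonalSeries ℂ) ^ t := by
  set A := pentagonalSeries ℂ
  set B := expand t ht A
  suffices H : ∀ n, (X : ℂ⟦X⟧) ^ (n + 1) ∣ B ^ t - A * mk fun n => (c n : ℂ) by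
    rw [mul_comm, eq_comm, ← sub_eq_zero]
    ext n
    exact X_pow_dvd_iff.mp (H n) n n.lt_succ_self
  intro n
  obtain ⟨N, hnN, hbig, hcard⟩ := hN n
  set K := N.choose 2
  have hc : ∀ k, constantCoeff (qFactor ((X : ℂ⟦X⟧) ^ t) k) ≠ 0 := fun k => by
    rw [constantCoeff_qFactor t ht]; exact one_ne_zero
  set L := (Finset.range t).finsuppAntidiag N
  -- Through degree K + n the sum over vectors is X^K times the generating series of `c`: no vector
  -- has total below K, and `hcard` counts the others.
  have e1 : (X : ℂ⟦X⟧) ^ (K + (n + 1)) ∣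
      (∑ l ∈ L, (X : ℂ⟦X⟧) ^ runnerSum t l) - X ^ K * mk fun n => (c n : ℂ) := by
    rw [X_pow_dvd_iff]
    intro m hm
    rw [map_sub, map_sum, coeff_X_pow_mul', sub_eq_zero]
    simp_rw [coeff_X_pow]
    split_ifs with hKm
    · rw [coeff_mk, ← hcard (m - K) (by omega), Finset.card_filter]
      push_cast
      refine Finset.sum_congr rfl fun l _ => if_congr ?_ rfl rfl
      rw [Nat.add_sub_cancel' hKm, eq_comm]
    · refine Finset.sum_eq_zero fun l hl => if_neg ?_
      have := hle N l hl
      omega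
  -- `sum_runnerSum` multiplied by B^t becomes this congruence once (X;X)_N is replaced by A and
  -- each quotient B/(X^t;X^t)_{l_i} by 1.
  have e2 : (X : ℂ⟦X⟧) ^ (K + (n + 1)) ∣
      (∑ l ∈ L, (X : ℂ⟦X⟧) ^ runnerSum t l) * A - X ^ K * B ^ t := by
    have h1 : X ^ K * B ^ t = (∑ l ∈ L, (X : ℂ⟦X⟧) ^ runnerSum t l *
        ∏ i ∈ Finset.range t, (B * (qFactor (X ^ t) (l i))⁻¹)) * qFactor X N := by
      rw [← sum_runnerSum t ht N, mul_right_comm, Finset.sum_mul]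
      congr 1
      refine Finset.sum_congr rfl fun l _ => ?_
      rw [Finset.prod_mul_distrib, Finset.prod_const, Finset.card_range]
      ring
    have h2 : (∑ l ∈ L, (X : ℂ⟦X⟧) ^ runnerSum t l) * A - X ^ K * B ^ t =
        (∑ l ∈ L, (X : ℂ⟦X⟧) ^ runnerSum t l) * (A - qFactor X N) +
        (∑ l ∈ L, (X : ℂ⟦X⟧) ^ runnerSum t l *
          (1 - ∏ i ∈ Finset.range t, (B * (qFactor (X ^ t) (l i))⁻¹))) * qFactor X N := by
      rw [h1]
      simp_rw [mul_sub, mul_one, Finset.sum_sub_distrib]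
      ring
    rw [h2]
    refine dvd_add ?_ (Dvd.dvd.mul_right (Finset.dvd_sum fun l hl => ?_) _)
    · rw [pow_add]
      exact mul_dvd_mul (Finset.dvd_sum fun l hl => pow_dvd_pow _ (hle N l hl))
        ((pow_dvd_pow _ (by omega)).trans (X_pow_dvd_pentagonalSeries_sub N))
    -- Vectors of large total are negligible through their power of `X`; for the others every l_i is
    -- at least n, so each quotient B/(X^t;X^t)_{l_i} is 1 modulo X^{n+1}.
    · by_cases hl' : runnerSum t l ≤ K + n
      · rw [pow_add]
        refine mul_dvd_mul (pow_dvd_pow _ (hle N l hl)) ?_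
        rw [← Ideal.mem_span_singleton, ← Ideal.Quotient.eq, map_prod, map_one, eq_comm]
        refine Finset.prod_eq_one fun i hi => ?_
        rw [← map_one (Ideal.Quotient.mk _), Ideal.Quotient.eq, Ideal.mem_span_singleton,
          ← PowerSeries.mul_inv_cancel _ (hc (l i)), ← sub_mul]
        exact (X_pow_dvd_expand_sub t ht (hbig l hl hl' i hi)).mul_right _
      · exact (pow_dvd_pow _ (by omega)).mul_right _
  have e3 := (dvd_sub (e1.mul_right A) e2)
  have e4 : ((∑ l ∈ L, (X : ℂ⟦X⟧) ^ runnerSum t l) - X ^ K * mk fun n => (c n : ℂ)) * A -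
      ((∑ l ∈ L, (X : ℂ⟦X⟧) ^ runnerSum t l) * A - X ^ K * B ^ t) =
      X ^ K * (B ^ t - A * mk fun n => (c n : ℂ)) := by ring
  rw [e4, pow_add] at e3
  exact (mul_dvd_mul_iff_left (pow_ne_zero _ X_ne_zero)).mp e3

end CoreConv

namespace CoreConv

/-! ### Sets closed under subtraction of t, as vectors of runner lengths (the abacus). -/

section Runners

/-- The set of the `i + t * j` with `i < t` and `j < l i`. -/
def runnerSet (t : ℕ) (l : ℕ → ℕ) : Finset ℕ :=
  ((Finset.range t).sigma fun i => Finset.range (l i)).image fun x => x.1 + t * x.2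

lemma mem_runnerSet {t : ℕ} (ht : 0 < t) {l : ℕ → ℕ} {x : ℕ} :
    x ∈ runnerSet t l ↔ x / t < l (x % t) := by
  simp only [runnerSet, Finset.mem_image, Finset.mem_sigma, Finset.mem_range, Sigma.exists]
  constructor
  · rintro ⟨i, j, ⟨hi, hj⟩, rfl⟩
    rwa [Nat.add_mul_div_left _ _ ht, Nat.div_eq_of_lt hi, zero_add, Nat.add_mul_mod_self_left,
      Nat.mod_eq_of_lt hi]
  · exact fun h => ⟨x % t, x / t, ⟨Nat.mod_lt _ ht, h⟩, Nat.mod_add_div x t⟩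

lemma injOn_runner {t : ℕ} (l : ℕ → ℕ) :
    Set.InjOn (fun x : Σ _ : ℕ, ℕ => x.1 + t * x.2)
      ((Finset.range t).sigma fun i => Finset.range (l i)) := by
  rintro ⟨i, j⟩ h ⟨i', j'⟩ h' he
  simp only [Finset.coe_sigma, Set.mem_sigma_iff, Finset.coe_range, Set.mem_Iio] at h h' he
  have ht : 0 < t := by omega
  have h1 : i = i' := by
    have := congrArg (· % t) he
    simpa [Nat.mod_eq_of_lt h.1, Nat.mod_eq_of_lt h'.1] using this
  subst h1
  have h2 : j = j' := Nat.eq_of_mul_eq_mul_left ht (by omega)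
  rw [h2]

lemma card_runnerSet (t : ℕ) (l : ℕ → ℕ) :
    (runnerSet t l).card = ∑ i ∈ Finset.range t, l i := by
  rw [runnerSet, Finset.card_image_of_injOn (injOn_runner l), Finset.card_sigma]
  simp

lemma sum_range_id_eq_choose (n : ℕ) : ∑ i ∈ Finset.range n, i = n.choose 2 := by
  rw [Finset.sum_range_id, Nat.choose_two_right]

lemma sum_runnerSet (t : ℕ) (l : ℕ → ℕ) : ∑ x ∈ runnerSet t l, x = runnerSum t l := by
  rw [runnerSet, Finset.sum_image (injOn_runner l), Finset.sum_sigma, runnerSum]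
  refine Finset.sum_congr rfl fun i _ => ?_
  rw [Finset.sum_add_distrib, ← Finset.mul_sum, sum_range_id_eq_choose]
  simp [mul_comm]

lemma sum_sdiff_range_balance (S : Finset ℕ) :
    ∑ x ∈ S, x + ∑ x ∈ Finset.range S.card \ S, x =
      S.card.choose 2 + ∑ x ∈ S \ Finset.range S.card, x := by
  rw [← sum_range_id_eq_choose, ← Finset.sum_inter_add_sum_sdiff S (Finset.range S.card),
    ← Finset.sum_inter_add_sum_sdiff (Finset.range S.card) S, Finset.inter_comm]
  ring

lemma card_sdiff_range_comm (S : Finset ℕ) :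
    (Finset.range S.card \ S).card = (S \ Finset.range S.card).card := by
  have h1 := Finset.card_inter_add_card_sdiff S (Finset.range S.card)
  have h2 := Finset.card_inter_add_card_sdiff (Finset.range S.card) S
  rw [Finset.inter_comm, Finset.card_range] at h2
  omega

lemma card_mul_le_sum_sdiff (S : Finset ℕ) :
    (S \ Finset.range S.card).card * S.card ≤ ∑ x ∈ S \ Finset.range S.card, x := by
  rw [← smul_eq_mul]
  refine Finset.card_nsmul_le_sum _ _ _ fun x hx => ?_
  simpa using (Finset.mem_sdiff.mp hx).2

lemma choose_le_sum (S : Finset ℕ) : S.card.choose 2 ≤ ∑ x ∈ S, x := by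
  have h1 := sum_sdiff_range_balance S
  have h2 := card_mul_le_sum_sdiff S
  have h3 : ∑ x ∈ Finset.range S.card \ S, x ≤ (Finset.range S.card \ S).card * S.card := by
    rw [← smul_eq_mul]
    refine Finset.sum_le_card_nsmul _ _ _ fun x hx => ?_
    exact (Finset.mem_range.mp (Finset.mem_sdiff.mp hx).1).le
  rw [card_sdiff_range_comm] at h3
  omega

/-- Compared with {0, …, N-1}, where N is its size, the set trades elements below N for as many
elements that are at least N. Giving up x alone raises the total by at least N - x > n. -/
lemma mem_of_sum_le {S : Finset ℕ} {n x : ℕ} (hx : x + n < S.card)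
    (hS : ∑ x ∈ S, x ≤ S.card.choose 2 + n) : x ∈ S := by
  by_contra hxS
  have h1 := sum_sdiff_range_balance S
  have h2 := card_mul_le_sum_sdiff S
  have hmem : x ∈ Finset.range S.card \ S := by simp [hxS]; omega
  have h3 : ∑ y ∈ Finset.range S.card \ S, y + (n + 1) ≤
      (Finset.range S.card \ S).card * S.card := by
    rw [← Finset.add_sum_erase _ _ hmem, ← Finset.card_erase_add_one hmem, add_mul, one_mul,
      ← smul_eq_mul]
    have : ∑ y ∈ (Finset.range S.card \ S).erase x, y ≤
        ((Finset.range S.card \ S).erase x).card • S.card :=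
      Finset.sum_le_card_nsmul _ _ _ fun y hy =>
        (Finset.mem_range.mp (Finset.mem_sdiff.mp (Finset.mem_of_mem_erase hy)).1).le
    omega
  rw [card_sdiff_range_comm] at h3
  omega

/-- A set of naturals is closed under subtraction of `t`. -/
def SubClosed (t : ℕ) (S : Finset ℕ) : Prop := ∀ x, x + t ∈ S → x ∈ S

lemma SubClosed.mul {t : ℕ} {S : Finset ℕ} (h : SubClosed t S) (k : ℕ) :
    SubClosed (t * k) S := by
  induction k with
  | zero => exact fun x hx => by simpa using hx
  | succ k ih =>
    intro x hx
    refine ih _ (h _ ?_)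
    convert hx using 1
    ring

lemma subClosed_runnerSet {t : ℕ} (ht : 0 < t) (l : ℕ → ℕ) : SubClosed t (runnerSet t l) := by
  intro x hx
  rw [mem_runnerSet ht, Nat.add_div_right _ ht, Nat.add_mod_right] at hx
  rw [mem_runnerSet ht]
  omega

lemma eq_range_of_lower {T : Finset ℕ} (h : ∀ x, x + 1 ∈ T → x ∈ T) :
    T = Finset.range T.card := by
  have h' : ∀ x k, x + k ∈ T → x ∈ T := fun x k => by
    induction k with
    | zero => exact id
    | succ k ih => exact fun hk => ih (h _ hk)
  have key : ∀ x ∈ T, Finset.range (x + 1) ⊆ T := fun x hx y hy =>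
    h' y (x - y) (by rwa [Nat.add_sub_cancel' (by simpa [Nat.lt_succ_iff] using hy)])
  refine Finset.eq_of_subset_of_card_le (fun x hx => ?_) (by simp)
  have := Finset.card_le_card (key x hx)
  rw [Finset.card_range] at this
  simpa using this

/-- In each residue class the quotients by t form an initial segment of the naturals; its length is
the entry of the vector. -/
lemma exists_runnerSet {t : ℕ} (ht : 0 < t) {S : Finset ℕ} (hS : SubClosed t S) :
    ∃ l : ℕ →₀ ℕ, l.support ⊆ Finset.range t ∧ runnerSet t l = S := by
  classical
  set T : ℕ → Finset ℕ := fun i => (S.filter fun x => x % t = i).image (· / t)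
  have hT : ∀ i j, i < t → (j ∈ T i ↔ i + t * j ∈ S) := by
    intro i j hi
    simp only [T, Finset.mem_image, Finset.mem_filter]
    constructor
    · rintro ⟨x, ⟨hx, rfl⟩, rfl⟩
      rwa [Nat.mod_add_div]
    · intro h
      refine ⟨_, ⟨h, ?_⟩, ?_⟩
      · rw [Nat.add_mul_mod_self_left, Nat.mod_eq_of_lt hi]
      · rw [Nat.add_mul_div_left _ _ ht, Nat.div_eq_of_lt hi, zero_add]
  refine ⟨Finsupp.onFinset (Finset.range t) (fun i => (T i).card) fun i hi => ?_,
    Finsupp.support_onFinset_subset, ?_⟩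
  · rw [Finset.mem_range]
    obtain ⟨j, hj⟩ := Finset.card_ne_zero.mp hi
    simp only [T, Finset.mem_image, Finset.mem_filter] at hj
    obtain ⟨x, ⟨_, rfl⟩, _⟩ := hj
    exact Nat.mod_lt _ ht
  · ext x
    rw [mem_runnerSet ht, Finsupp.onFinset_apply, ← Finset.mem_range, ← eq_range_of_lower,
      hT _ _ (Nat.mod_lt _ ht), Nat.mod_add_div]
    intro j hj
    rw [hT _ _ (Nat.mod_lt _ ht)] at hj ⊢
    refine hS _ ?_
    convert hj using 1
    ring

lemma runnerSet_injective {t : ℕ} (ht : 0 < t) {l l' : ℕ →₀ ℕ} (hl : l.support ⊆ Finset.range t)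
    (hl' : l'.support ⊆ Finset.range t) (h : runnerSet t l = runnerSet t l') : l = l' := by
  ext i
  by_cases hi : i < t
  · have : ∀ j, j < l i ↔ j < l' i := fun j => by
      have := Finset.ext_iff.mp h (i + t * j)
      rwa [mem_runnerSet ht, mem_runnerSet ht, Nat.add_mul_mod_self_left, Nat.mod_eq_of_lt hi,
        Nat.add_mul_div_left _ _ ht, Nat.div_eq_of_lt hi, zero_add] at this
    have h1 := this (l i)
    have h2 := this (l' i)
    omega
  · have hn : ∀ f : ℕ →₀ ℕ, f.support ⊆ Finset.range t → f i = 0 := fun f hf => by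
      by_contra h0
      exact hi (Finset.mem_range.mp (hf (Finsupp.mem_support_iff.mpr h0)))
    rw [hn l hl, hn l' hl']

/-- The closed sets of `N` naturals with total `N.choose 2 + m`. -/
abbrev ClosedSets (t N m : ℕ) : Type :=
  {S : Finset ℕ // SubClosed t S ∧ S.card = N ∧ ∑ x ∈ S, x = N.choose 2 + m}

lemma card_filter_runnerSum {t : ℕ} (ht : 0 < t) (N m : ℕ) :
    (((Finset.range t).finsuppAntidiag N).filter
      fun l : ℕ →₀ ℕ => runnerSum t l = N.choose 2 + m).card = Nat.card (ClosedSets t N m) := by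
  have hmem : ∀ {l : ℕ →₀ ℕ}, l ∈ ((Finset.range t).finsuppAntidiag N).filter
      (fun l : ℕ →₀ ℕ => runnerSum t l = N.choose 2 + m) ↔
      ((∑ i ∈ Finset.range t, l i = N ∧ l.support ⊆ Finset.range t) ∧
        runnerSum t l = N.choose 2 + m) := by
    intro l
    rw [Finset.mem_filter, Finset.mem_finsuppAntidiag]
  rw [← Fintype.card_coe, ← Nat.card_eq_fintype_card]
  refine Nat.card_eq_of_bijective (fun l => ⟨runnerSet t l.1, subClosed_runnerSet ht _, ?_, ?_⟩)
    ⟨fun l l' h => ?_, fun S => ?_⟩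
  · rw [card_runnerSet, (hmem.mp l.2).1.1]
  · rw [sum_runnerSet, (hmem.mp l.2).2]
  · exact Subtype.ext (runnerSet_injective ht (hmem.mp l.2).1.2 (hmem.mp l'.2).1.2
      (congrArg Subtype.val h))
  · obtain ⟨S, hS, hc, hs⟩ := S
    obtain ⟨l, hl, rfl⟩ := exists_runnerSet ht hS
    exact ⟨⟨l, hmem.mpr ⟨⟨by rw [← hc, card_runnerSet], hl⟩, by rw [← hs, sum_runnerSet]⟩⟩, rfl⟩

end Runners

/-! ### Beta-numbers, hooks and cores. -/

section Beta

/-- The first `N` beta-numbers of a Young diagram, enumerated from the bottom row upwards. -/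
def beta (N : ℕ) (μ : YoungDiagram) (k : ℕ) : ℕ := μ.rowLen (N - 1 - k) + k

lemma beta_strictMono (N : ℕ) (μ : YoungDiagram) : StrictMono (beta N μ) := by
  intro a b hab
  have := μ.rowLen_anti (N - 1 - b) (N - 1 - a) (by omega)
  simp only [beta]
  omega

/-- The set of the first `N` beta-numbers of a Young diagram. -/
def betaSet (N : ℕ) (μ : YoungDiagram) : Finset ℕ := (Finset.range N).image (beta N μ)

lemma card_betaSet (N : ℕ) (μ : YoungDiagram) : (betaSet N μ).card = N := by
  rw [betaSet, Finset.card_image_of_injective _ (beta_strictMono N μ).injective, Finset.card_range]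

lemma colLen_le_card (μ : YoungDiagram) (j : ℕ) : μ.colLen j ≤ μ.card := by
  rw [YoungDiagram.colLen_eq_card]
  exact Finset.card_le_card (Finset.filter_subset _ _)

lemma sum_rowLen {N : ℕ} {μ : YoungDiagram} (h : μ.colLen 0 ≤ N) :
    ∑ i ∈ Finset.range N, μ.rowLen i = μ.card := by
  rw [YoungDiagram.card, Finset.card_eq_sum_card_fiberwise (f := Prod.fst) (t := Finset.range N)]
  · exact Finset.sum_congr rfl fun i _ => μ.rowLen_eq_card
  · rintro ⟨i, j⟩ hc
    have h1 : (i, 0) ∈ μ := μ.up_left_mem le_rfl (Nat.zero_le j) ((YoungDiagram.mem_cells _).mp hc)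
    have h2 := YoungDiagram.mem_iff_lt_colLen.mp h1
    simp only [Finset.coe_range, Set.mem_Iio]
    omega

lemma sum_betaSet {N : ℕ} {μ : YoungDiagram} (h : μ.colLen 0 ≤ N) :
    ∑ x ∈ betaSet N μ, x = N.choose 2 + μ.card := by
  rw [betaSet, Finset.sum_image (beta_strictMono N μ).injective.injOn]
  simp only [beta]
  rw [Finset.sum_add_distrib, Finset.sum_range_reflect, sum_range_id_eq_choose, sum_rowLen h,
    add_comm]

lemma mem_betaSet {N : ℕ} {μ : YoungDiagram} {x : ℕ} :
    x ∈ betaSet N μ ↔ ∃ i < N, μ.rowLen i + (N - 1 - i) = x := by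
  simp only [betaSet, Finset.mem_image, Finset.mem_range, beta]
  constructor
  · rintro ⟨k, hk, rfl⟩
    exact ⟨N - 1 - k, by omega, by rw [show N - 1 - (N - 1 - k) = k by omega]⟩
  · rintro ⟨k, hk, rfl⟩
    exact ⟨N - 1 - k, by omega, by rw [show N - 1 - (N - 1 - k) = k by omega]⟩

lemma betaSet_injective {N : ℕ} {μ ν : YoungDiagram} (hμ : μ.colLen 0 ≤ N) (hν : ν.colLen 0 ≤ N)
    (h : betaSet N μ = betaSet N ν) : μ = ν := by
  have hm : ∀ ρ, StrictMono fun k : Fin N => beta N ρ k := fun ρ a b hab => beta_strictMono N ρ hab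
  have hr : ∀ ρ, Set.range (fun k : Fin N => beta N ρ k) = betaSet N ρ := fun ρ => by
    ext x
    simp only [Set.mem_range, betaSet, Finset.coe_image, Finset.coe_range, Set.mem_image,
      Set.mem_Iio]
    exact ⟨fun ⟨k, hk⟩ => ⟨k, k.2, hk⟩, fun ⟨k, hk, hk'⟩ => ⟨⟨k, hk⟩, hk'⟩⟩
  have hf := ((hm μ).range_inj (hm ν)).mp (by rw [hr, hr, h])
  have hrow : ∀ i, μ.rowLen i = ν.rowLen i := fun i => by
    by_cases hi : i < N
    · have := congrFun hf ⟨N - 1 - i, by omega⟩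
      simpa [beta, show N - 1 - (N - 1 - i) = i by omega] using this
    · have hz : ∀ ρ : YoungDiagram, ρ.colLen 0 ≤ N → ρ.rowLen i = 0 := fun ρ hρ => by
        by_contra h0
        have h1 : (i, 0) ∈ ρ := YoungDiagram.mem_iff_lt_rowLen.mpr (by omega)
        have := YoungDiagram.mem_iff_lt_colLen.mp h1
        omega
      rw [hz μ hμ, hz ν hν]
  ext ⟨i, j⟩
  rw [YoungDiagram.mem_cells, YoungDiagram.mem_cells, YoungDiagram.mem_iff_lt_rowLen,
    YoungDiagram.mem_iff_lt_rowLen, hrow]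

lemma exists_betaSet (S : Finset ℕ) :
    ∃ μ : YoungDiagram, μ.colLen 0 ≤ S.card ∧ betaSet S.card μ = S := by
  set N := S.card with hN
  set e := S.orderEmbOfFin hN.symm with he
  -- A strictly increasing sequence of integers gains at least 1 per step, so e(k) - k is
  -- nondecreasing; these differences are the row lengths read from the bottom.
  have hgap : ∀ a b : Fin N, a ≤ b → e a + b ≤ e b + a := by
    intro a b hab
    have key : ∀ d : ℕ, ∀ hd : a + d < N, e a + d ≤ e ⟨a + d, hd⟩ := by
      intro d
      induction d with
      | zero => intro hd; simp
      | succ d ih =>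
        intro hd
        have h1 := ih (by omega)
        have h2 : e ⟨a + d, by omega⟩ < e ⟨a + (d + 1), hd⟩ :=
          e.strictMono (by rw [Fin.mk_lt_mk]; omega)
        omega
    have := key (b - a) (by have := b.2; omega)
    have h3 : (⟨a + (b - a), by have := b.2; omega⟩ : Fin N) = b := by
      ext; simp only; have : (a : ℕ) ≤ b := hab; omega
    rw [h3] at this
    have : (a : ℕ) ≤ b := hab
    omega
  let μ : YoungDiagram :=
    { cells := (Finset.univ : Finset (Fin N)).biUnion fun k =>
        (Finset.range (e k - k)).image fun j => (N - 1 - (k : ℕ), j)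
      isLowerSet := by
        rintro ⟨i2, j2⟩ ⟨i1, j1⟩ ⟨hi : i1 ≤ i2, hj : j1 ≤ j2⟩ hc
        simp only [Finset.coe_biUnion, Finset.coe_univ, Set.mem_univ, Finset.coe_image,
          Finset.coe_range, Set.iUnion_true, Set.mem_iUnion, Set.mem_image, Set.mem_Iio,
          Prod.mk.injEq] at hc ⊢
        obtain ⟨k, j, hj', rfl, rfl⟩ := hc
        have hk := k.2
        have := hgap k ⟨N - 1 - i1, by omega⟩ (by rw [Fin.le_def]; simp only; omega)
        exact ⟨⟨N - 1 - i1, by omega⟩, j1, by simp only at this ⊢; omega, by simp only; omega, rfl⟩ }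
  have hmem : ∀ i j, (i, j) ∈ μ ↔ ∃ h : i < N, j < e ⟨N - 1 - i, by omega⟩ - (N - 1 - i) := by
    intro i j
    rw [← YoungDiagram.mem_cells]
    simp only [μ, Finset.mem_biUnion, Finset.mem_univ, true_and, Finset.mem_image,
      Finset.mem_range, Prod.mk.injEq]
    constructor
    · rintro ⟨k, j, hj', rfl, rfl⟩
      have hk := k.2
      refine ⟨by omega, ?_⟩
      have : (⟨N - 1 - (N - 1 - k), by omega⟩ : Fin N) = k := by ext; simp only; omega
      rw [this]
      omega
    · rintro ⟨h, hj⟩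
      exact ⟨⟨N - 1 - i, by omega⟩, j, hj, by simp only; omega, rfl⟩
  have hrow : ∀ (i : ℕ) (h : i < N), μ.rowLen i = e ⟨N - 1 - i, by omega⟩ - (N - 1 - i) := by
    intro i h
    have h1 : ∀ j, j < μ.rowLen i ↔ j < e ⟨N - 1 - i, by omega⟩ - (N - 1 - i) := fun j => by
      rw [← YoungDiagram.mem_iff_lt_rowLen, hmem]
      exact ⟨fun ⟨_, h⟩ => h, fun h' => ⟨h, h'⟩⟩
    have h2 := h1 (μ.rowLen i)
    have h3 := h1 (e ⟨N - 1 - i, by omega⟩ - (N - 1 - i))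
    omega
  have hle : ∀ k : Fin N, (k : ℕ) ≤ e k := fun k => by
    have := hgap ⟨0, by have := k.2; omega⟩ k (by rw [Fin.le_def]; simp)
    simp only at this
    omega
  refine ⟨μ, ?_, ?_⟩
  · by_contra hlt
    have h1 : (N, 0) ∈ μ := YoungDiagram.mem_iff_lt_colLen.mpr (by omega)
    exact absurd ((hmem _ _).mp h1).1 (lt_irrefl _)
  · refine Finset.eq_of_subset_of_card_le (fun x hx => ?_) (by rw [card_betaSet])
    obtain ⟨i, hi, rfl⟩ := mem_betaSet.mp hx
    have h1 := hle ⟨N - 1 - i, by omega⟩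
    rw [hrow i hi, Nat.sub_add_cancel h1]
    exact Finset.orderEmbOfFin_mem _ _ _

/-- The hook is split into the part of row i from column j onwards and the part of column j strictly
below row i. The additive form avoids truncated subtraction. -/
lemma hookNumber_add (μ : YoungDiagram) {i j : ℕ} (h : (i, j) ∈ μ) :
    hookNumber μ (i, j) + i + j + 1 = μ.rowLen i + μ.colLen j := by
  have hj := YoungDiagram.mem_iff_lt_rowLen.mp h
  have hi := YoungDiagram.mem_iff_lt_colLen.mp h
  have e1 : hook μ (i, j) = (Finset.Ico j (μ.rowLen i)).image (fun b => (i, b)) ∪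
      (Finset.Ico (i + 1) (μ.colLen j)).image (fun a => (a, j)) := by
    ext ⟨a, b⟩
    simp only [hook, Finset.mem_filter, YoungDiagram.mem_cells, Finset.mem_union, Finset.mem_image,
      Finset.mem_Ico, Prod.mk.injEq]
    constructor
    · rintro ⟨hm, ⟨rfl, hb⟩ | ⟨rfl, ha⟩⟩
      · exact .inl ⟨b, ⟨hb, YoungDiagram.mem_iff_lt_rowLen.mp hm⟩, rfl, rfl⟩
      · rcases ha.eq_or_lt with rfl | ha
        · exact .inl ⟨b, ⟨le_rfl, hj⟩, rfl, rfl⟩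
        · exact .inr ⟨a, ⟨ha, YoungDiagram.mem_iff_lt_colLen.mp hm⟩, rfl, rfl⟩
    · rintro (⟨b, ⟨hb, hb'⟩, rfl, rfl⟩ | ⟨a, ⟨ha, ha'⟩, rfl, rfl⟩)
      · exact ⟨YoungDiagram.mem_iff_lt_rowLen.mpr hb', .inl ⟨rfl, hb⟩⟩
      · exact ⟨YoungDiagram.mem_iff_lt_colLen.mpr ha', .inr ⟨rfl, by omega⟩⟩
  rw [hookNumber, e1, Finset.card_union_of_disjoint, Finset.card_image_of_injective,
    Finset.card_image_of_injective, Nat.card_Ico, Nat.card_Ico]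
  · omega
  · exact fun a b hab => (Prod.mk.inj hab).1
  · exact fun a b hab => (Prod.mk.inj hab).2
  · rw [Finset.disjoint_left]
    simp only [Finset.mem_image, Finset.mem_Ico]
    rintro _ ⟨b, _, rfl⟩ ⟨a, ha, hab⟩
    have := (Prod.mk.inj hab).1
    omega

/-- Hook numbers in row i are the differences between the beta-number of that row and the smaller
naturals that are not beta-numbers, column j giving the gap N + j - `colLen j`. A hook divisible by
t is a beta-number that reaches a gap in steps of t, and then some single step already does. -/
lemma core_iff_subClosed {N t : ℕ} (ht : 0 < t) {μ : YoungDiagram} (hμ : μ.colLen 0 ≤ N) :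
    (∀ c ∈ μ.cells, ¬ t ∣ hookNumber μ c) ↔ SubClosed t (betaSet N μ) := by
  have hcol : ∀ j, μ.colLen j ≤ N := fun j => (μ.colLen_anti 0 j (Nat.zero_le j)).trans hμ
  constructor
  · intro hcore y hy
    by_contra hyS
    obtain ⟨i, hi, hiy⟩ := mem_betaSet.mp hy
    -- The least such s is the number r of beta-numbers exceeding y; the alternative s = N covers
    -- the case in which all of them do.
    have hex : ∃ s, s = N ∨ μ.rowLen s + (N - 1 - s) < y := ⟨N, .inl rfl⟩
    classical
    set r := Nat.find hex with hr
    have hrN : r ≤ N := Nat.find_min' hex (.inl rfl)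
    have hlt : ∀ s < r, y < μ.rowLen s + (N - 1 - s) := fun s hs => by
      have h1 := Nat.find_min hex hs
      push Not at h1
      refine lt_of_le_of_ne h1.2 fun h2 => hyS (mem_betaSet.mpr ⟨s, by omega, h2.symm⟩)
    have hir : i < r := by
      by_contra hle
      push Not at hle
      rcases Nat.find_spec hex with h1 | h1
      · omega
      · have := μ.rowLen_anti r i hle
        rw [← hr] at h1
        omega
    have hyr : N - r ≤ y := by
      rcases Nat.find_spec hex with h1 | h1
      · omega
      · rw [← hr] at h1
        omega
    -- Exactly N - r beta-numbers lie below y, so j is the index of y among the gaps, hence its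
    -- column.
    set j := y - (N - r) with hj
    have hc : μ.colLen j = r := by
      apply le_antisymm
      · by_contra hlt'
        push Not at hlt'
        have h1 := YoungDiagram.mem_iff_lt_rowLen.mp (YoungDiagram.mem_iff_lt_colLen.mpr hlt')
        rcases Nat.find_spec hex with h2 | h2
        · have := hcol j
          omega
        · rw [← hr] at h2
          omega
      · rcases Nat.eq_zero_or_pos r with h0 | h0
        · omega
        · have h1 := hlt (r - 1) (by omega)
          have h2 : (r - 1, j) ∈ μ := YoungDiagram.mem_iff_lt_rowLen.mpr (by omega)
          have := YoungDiagram.mem_iff_lt_colLen.mp h2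
          omega
    have hmem : (i, j) ∈ μ := YoungDiagram.mem_iff_lt_colLen.mpr (by omega)
    have hh := hookNumber_add μ hmem
    refine hcore (i, j) ((YoungDiagram.mem_cells _).mpr hmem) ?_
    rw [show hookNumber μ (i, j) = t by omega]
  · rintro hS ⟨i, j⟩ hc ⟨k, hk⟩
    have hmem := (YoungDiagram.mem_cells _).mp hc
    have hh := hookNumber_add μ hmem
    have h1 := YoungDiagram.mem_iff_lt_colLen.mp hmem
    have h2 := hcol j
    have h3 : N + j - μ.colLen j + t * k ∈ betaSet N μ :=
      mem_betaSet.mpr ⟨i, by omega, by omega⟩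
    obtain ⟨s, hs, hs'⟩ := mem_betaSet.mp (hS.mul k _ h3)
    by_cases hsj : (s, j) ∈ μ
    · have := YoungDiagram.mem_iff_lt_colLen.mp hsj
      have := YoungDiagram.mem_iff_lt_rowLen.mp hsj
      omega
    · have := mt YoungDiagram.mem_iff_lt_colLen.mpr hsj
      have := mt YoungDiagram.mem_iff_lt_rowLen.mpr hsj
      omega

lemma rowLens_youngDiagram {n : ℕ} (lam : n.Partition) :
    (youngDiagram lam).rowLens = lam.parts.sort (· ≥ ·) :=
  YoungDiagram.rowLens_ofRowLens_eq_self fun _ hx =>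
    lam.parts_pos ((Multiset.mem_sort (· ≥ ·)).mp hx)

lemma sum_rowLens (μ : YoungDiagram) : μ.rowLens.sum = μ.card := by
  rw [← sum_rowLen (le_refl (μ.colLen 0))]
  rfl

lemma card_youngDiagram {n : ℕ} (lam : n.Partition) : (youngDiagram lam).card = n := by
  rw [← sum_rowLens, rowLens_youngDiagram, ← Multiset.sum_coe, Multiset.sort_eq, lam.parts_sum]

lemma youngDiagram_injective {n : ℕ} :
    Function.Injective (youngDiagram : n.Partition → YoungDiagram) := by
  intro a b h
  have h1 := congrArg YoungDiagram.rowLens h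
  rw [rowLens_youngDiagram, rowLens_youngDiagram] at h1
  have h2 := congrArg (fun l : List ℕ => (l : Multiset ℕ)) h1
  simp only [Multiset.sort_eq] at h2
  exact Nat.Partition.ext h2

lemma exists_youngDiagram (μ : YoungDiagram) :
    ∃ lam : μ.card.Partition, youngDiagram lam = μ := by
  refine ⟨⟨μ.rowLens, fun {i} hi => μ.pos_of_mem_rowLens i (by simpa using hi), ?_⟩, ?_⟩
  · rw [Multiset.sum_coe, sum_rowLens]
  · apply YoungDiagram.equivListRowLens.injective
    refine Subtype.ext ?_
    simp only [YoungDiagram.equivListRowLens_apply_coe]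
    rw [rowLens_youngDiagram]
    exact List.mergeSort_eq_self _ μ.rowLens_sorted.pairwise

lemma coreCount_eq_card_closedSets {t : ℕ} (ht : 0 < t) {N m : ℕ} (hm : m ≤ N) :
    coreCount t m = Nat.card (ClosedSets t N m) := by
  classical
  have hcol : ∀ lam : m.Partition, (youngDiagram lam).colLen 0 ≤ N := fun lam =>
    (colLen_le_card _ 0).trans ((card_youngDiagram lam).le.trans hm)
  rw [coreCount, ← Fintype.card_subtype, ← Nat.card_eq_fintype_card]
  refine Nat.card_eq_of_bijective (fun lam => ⟨betaSet N (youngDiagram lam.1),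
    (core_iff_subClosed ht (hcol lam.1)).mp lam.2, card_betaSet _ _, ?_⟩)
    ⟨fun a b h => ?_, fun S => ?_⟩
  · rw [sum_betaSet (hcol lam.1), card_youngDiagram]
  · exact Subtype.ext (youngDiagram_injective
      (betaSet_injective (hcol a.1) (hcol b.1) (congrArg Subtype.val h)))
  · obtain ⟨S, hS, rfl, hs⟩ := S
    obtain ⟨μ, hμ, hμS⟩ := exists_betaSet S
    have hcard : μ.card = m := by
      have := sum_betaSet hμ
      rw [hμS, hs] at this
      omega
    subst hcard
    obtain ⟨lam, hlam⟩ := exists_youngDiagram μ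
    refine ⟨⟨lam, (core_iff_subClosed ht (hcol lam)).mpr (by rwa [hlam, hμS])⟩, Subtype.ext ?_⟩
    simp only
    rw [hlam, hμS]

end Beta

open PowerSeries in
/-- The generating function of the numbers of `t`-cores. -/
theorem mk_coreCount_mul_pentagonalSeries (t : ℕ) (ht : t ≠ 0) :
    (mk fun n => (coreCount t n : ℂ)) * pentagonalSeries ℂ =
      expand t ht (pentagonalSeries ℂ) ^ t := by
  have ht' : 0 < t := Nat.pos_of_ne_zero ht
  have hcard : ∀ {N : ℕ} {l : ℕ →₀ ℕ}, l ∈ (Finset.range t).finsuppAntidiag N →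
      (runnerSet t l).card = N := fun {N l} hl => by
    rw [card_runnerSet, (Finset.mem_finsuppAntidiag.mp hl).1]
  -- N = 2nt is large enough: a set of excess at most n contains every x with x + n < N, in
  -- particular i + t(n-1), and this forces l_i ≥ n.
  refine mk_mul_pentagonalSeries_of_card t ht _ (fun N l hl => ?_) fun n =>
    ⟨t * (2 * n), ?_, fun l hl hle i hi => ?_, fun m hm => ?_⟩
  · have := choose_le_sum (runnerSet t l)
    rwa [hcard hl, sum_runnerSet] at this
  · nlinarith
  · rcases Nat.eq_zero_or_pos n with rfl | hn
    · exact Nat.zero_le _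
    have hit := Finset.mem_range.mp hi
    have h1 : i + t * (n - 1) ∈ runnerSet t l := by
      refine mem_of_sum_le (n := n) ?_ (by rwa [hcard hl, sum_runnerSet])
      rw [hcard hl]
      obtain ⟨k, rfl⟩ : ∃ k, n = k + 1 := ⟨n - 1, by omega⟩
      rw [Nat.add_sub_cancel]
      nlinarith
    rw [mem_runnerSet ht', Nat.add_mul_mod_self_left, Nat.mod_eq_of_lt hit,
      Nat.add_mul_div_left _ _ ht', Nat.div_eq_of_lt hit, zero_add] at h1
    omega
  · rw [card_filter_runnerSum ht', coreCount_eq_card_closedSets ht']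
    nlinarith

end CoreConv

/-! ### The Weierstrass zeta function in Eisenstein summation. -/

namespace CoreConv

open UpperHalfPlane hiding I
open Complex Filter Topology EisensteinSeries Real
open scoped MatrixGroups

/-- The function `π cot (π w)`. -/
noncomputable def piCot (w : ℂ) : ℂ := π * Complex.cot (π * w)

lemma piCot_neg (w : ℂ) : piCot (-w) = -piCot w := by
  simp only [piCot, Complex.cot, mul_neg, Complex.cos_neg, Complex.sin_neg, div_neg]

lemma piCot_zero : piCot 0 = 0 := by simp [piCot, Complex.cot]

lemma piCot_eq (w : ℂ) :
    piCot w = π * ((cexp (2 * π * I * w) + 1) / (I * (1 - cexp (2 * π * I * w)))) := by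
  rw [piCot, Complex.cot_pi_eq_exp_ratio]

lemma piCot_add_one (w : ℂ) : piCot (w + 1) = piCot w := by
  rw [piCot_eq, piCot_eq, mul_add, mul_one, Complex.exp_periodic]

/-- The value y = 0 is admitted for the row m = 0 of the lattice: with 1/0 = 0 and cot 0 = 0 both
sides vanish. -/
lemma hasSum_piCot {y : ℂ} (hy : y ∈ Complex.integerComplement ∨ y = 0) :
    HasSum (fun n : ℕ => 1 / (y - ((n : ℂ) + 1)) + 1 / (y + ((n : ℂ) + 1))) (piCot y - 1 / y) := by
  rcases hy with hy | rfl
  · rw [piCot, cot_series_rep' hy]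
    exact (summable_cotTerm hy).hasSum
  · convert hasSum_zero using 1
    · ext n
      rw [zero_sub, zero_add, one_div, one_div, inv_neg, neg_add_cancel]
    · simp [piCot_zero]

/-- The summand of the Weierstrass zeta function (with `1 / 0 = 0` it equals `1 / z` at `w = 0`). -/
noncomputable def zetaTerm (z w : ℂ) : ℂ := 1 / (z - w) + 1 / w + z / w ^ 2

lemma zetaTerm_div (z w j : ℂ) (hj : j ≠ 0) : zetaTerm (z / j) (w / j) = j * zetaTerm z w := by
  rw [zetaTerm, zetaTerm, ← sub_div, one_div_div, one_div_div, div_pow]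
  field_simp

/-- The point of the lattice `ℤ τ + ℤ` with coordinates `v`. -/
noncomputable def latPt (τ : ℍ) (v : Fin 2 → ℤ) : ℂ := v 0 * (τ : ℂ) + v 1

/-- The three terms combine to z²/(w²(z - w)), which decays like |w|⁻³ and makes the lattice sum
absolutely convergent. -/
lemma norm_zetaTerm_le {z w : ℂ} (h : 2 * ‖z‖ + 1 ≤ ‖w‖) :
    ‖zetaTerm z w‖ ≤ 2 * ‖z‖ ^ 2 * (‖w‖ ^ 3)⁻¹ := by
  have hz := norm_nonneg z
  have hw : 0 < ‖w‖ := by linarith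
  have hw0 : w ≠ 0 := norm_pos_iff.mp hw
  have h1 : ‖w‖ / 2 ≤ ‖z - w‖ := by
    have := norm_sub_norm_le w z
    rw [norm_sub_rev] at this
    linarith
  have hzw : z - w ≠ 0 := norm_pos_iff.mp (by linarith)
  have h2 : zetaTerm z w = z ^ 2 / (w ^ 2 * (z - w)) := by
    rw [zetaTerm]
    field_simp
    ring
  rw [h2, norm_div, norm_mul, norm_pow, norm_pow, div_eq_mul_inv, mul_comm 2, mul_assoc]
  refine mul_le_mul_of_nonneg_left ?_ (by positivity)
  rw [inv_le_comm₀ (by positivity) (by positivity), mul_inv, inv_inv]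
  nlinarith [sq_nonneg ‖w‖]

lemma summable_zetaTerm (τ : ℍ) (z : ℂ) : Summable fun v : Fin 2 → ℤ => zetaTerm z (latPt τ v) := by
  have hr := r_pos τ
  refine summable_of_isBigO_rpow_norm (a := 3) (by norm_num) ?_
  refine Asymptotics.IsBigO.of_bound (2 * ‖z‖ ^ 2 * (r τ ^ 3)⁻¹) ?_
  have h1 : Tendsto (fun v : Fin 2 → ℤ => r τ * ‖v‖) cofinite atTop :=
    (tendsto_norm_comp_cofinite_atTop_of_isClosedEmbedding
      Topology.IsClosedEmbedding.id).const_mul_atTop hr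
  filter_upwards [h1.eventually_ge_atTop (2 * ‖z‖ + 1)] with v hv
  have hv0 : v ≠ 0 := by
    rintro rfl
    rw [norm_zero, mul_zero] at hv
    linarith [norm_nonneg z]
  have h2 : r τ * ‖v‖ ≤ ‖latPt τ v‖ := r_mul_max_le τ hv0
  refine (norm_zetaTerm_le (hv.trans h2)).trans ?_
  have hpos : 0 < r τ * ‖v‖ := by linarith [norm_nonneg z]
  have h3 : (3 : ℝ) = ((3 : ℕ) : ℝ) := by norm_num
  rw [mul_assoc _ ((r τ ^ 3)⁻¹), norm_inv, h3, Real.rpow_natCast, norm_pow, norm_norm, ← mul_inv,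
    ← mul_pow]
  gcongr

/-- The Weierstrass zeta function of `ℤ τ + ℤ`. -/
noncomputable def weierstrassZeta (τ : ℍ) (z : ℂ) : ℂ := ∑' v : Fin 2 → ℤ, zetaTerm z (latPt τ v)

/-- The Eisenstein-summed zeta function `ζ(z) - G₂(τ) z`. -/
noncomputable def eisZeta (τ : ℍ) (z : ℂ) : ℂ := weierstrassZeta τ z - G2 τ * z

/-- `z` does not lie in the lattice `ℤ τ + ℤ`. -/
def NotLattice (τ : ℍ) (z : ℂ) : Prop := ∀ m n : ℤ, z ≠ m * (τ : ℂ) + n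

lemma NotLattice.sub_mem {τ : ℍ} {z : ℂ} (hz : NotLattice τ z) (m : ℤ) :
    z - m * (τ : ℂ) ∈ Complex.integerComplement := by
  rw [Complex.mem_integerComplement_iff]
  rintro ⟨n, hn⟩
  exact hz m n (by rw [hn]; ring)

lemma mul_mem_integerComplement_or (τ : ℍ) (m : ℤ) :
    (m * (τ : ℂ)) ∈ Complex.integerComplement ∨ m * (τ : ℂ) = 0 := by
  rcases eq_or_ne m 0 with rfl | hm
  · right; simp
  · left
    rw [Complex.mem_integerComplement_iff]
    rintro ⟨n, hn⟩
    have := congrArg Complex.im hn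
    simp only [intCast_im, Complex.mul_im, intCast_re, zero_mul, add_zero] at this
    rcases mul_eq_zero.mp this.symm with h | h
    · exact hm (by exact_mod_cast h)
    · exact τ.im_ne_zero h

/-- Along a row, pairing n with -n turns 1/(z - w) and 1/w into partial fractions of the cotangent,
while z/w² yields the row of G₂. This explains the correction term in `eisZeta`. -/
lemma hasSum_zetaTerm_row {τ : ℍ} {z : ℂ} (hz : NotLattice τ z) (m : ℤ) :
    HasSum (fun n : ℤ => zetaTerm z (m * (τ : ℂ) + n))
      (piCot (z - m * τ) + piCot (m * τ) + z * e2Summand m τ) := by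
  have hs : Summable fun n : ℤ => zetaTerm z (m * (τ : ℂ) + n) := by
    have := (finTwoArrowEquiv ℤ).symm.summable_iff.mpr (summable_zetaTerm τ z)
    exact (this.prod_factor m).congr fun n => by simp [latPt]
  have he : HasSum (fun n : ℤ => z / (m * (τ : ℂ) + n) ^ 2) (z * e2Summand m τ) := by
    convert! (e2Summand_summable m τ).hasSum.mul_left z using 1
  set x := z - m * (τ : ℂ) with hx
  set y := m * (τ : ℂ) with hy
  have hg := (hs.hasSum.sub he).nat_add_neg
  rw [← hasSum_nat_add_iff' 1] at hg
  have hc := (hasSum_piCot (.inl (hz.sub_mem m))).add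
    (hasSum_piCot (mul_mem_integerComplement_or τ m))
  rw [← hx, ← hy] at hc
  have hterm : ∀ n : ℂ, zetaTerm z (y + n) - z / (y + n) ^ 2 = 1 / (x - n) + 1 / (y + n) := by
    intro n
    rw [zetaTerm, add_sub_cancel_right, ← sub_sub]
  have hfun : (fun n : ℕ => zetaTerm z (y + (((n + 1 : ℕ) : ℤ) : ℂ)) -
      z / (y + (((n + 1 : ℕ) : ℤ) : ℂ)) ^ 2 + (zetaTerm z (y + ((-((n + 1 : ℕ) : ℤ) : ℤ) : ℂ)) -
      z / (y + ((-((n + 1 : ℕ) : ℤ) : ℤ) : ℂ)) ^ 2)) =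
      fun n : ℕ => 1 / (x - ((n : ℂ) + 1)) + 1 / (x + ((n : ℂ) + 1)) +
        (1 / (y - ((n : ℂ) + 1)) + 1 / (y + ((n : ℂ) + 1))) := by
    ext n
    rw [hterm, hterm]
    push_cast
    ring
  rw [hfun] at hg
  have h1 := hg.unique hc
  have h0 := hterm 0
  simp only [Finset.range_one, Finset.sum_singleton, Nat.cast_zero, Int.cast_zero, neg_zero,
    add_zero, sub_zero] at h1 h0
  rw [h0] at h1
  convert hs.hasSum using 1
  linear_combination -h1

lemma sum_Icc_odd (f : ℤ → ℂ) (hf : ∀ m, f (-m) = -f m) (N : ℕ) :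
    ∑ m ∈ Finset.Icc (-(N : ℤ)) N, f m = 0 := by
  have : ∑ m ∈ Finset.Icc (-(N : ℤ)) N, f m = ∑ m ∈ Finset.Icc (-(N : ℤ)) N, -f m := by
    refine Finset.sum_nbij' (fun m => -m) (fun m => -m) ?_ ?_ ?_ ?_ ?_
    · intro m hm; rw [Finset.mem_Icc] at hm ⊢; omega
    · intro m hm; rw [Finset.mem_Icc] at hm ⊢; omega
    · simp
    · simp
    · intro m _; rw [hf, neg_neg]
  rw [Finset.sum_neg_distrib] at this
  exact self_eq_neg.mp this

lemma tendsto_sum_Icc_of_hasSum {f : ℤ → ℂ} {a : ℂ} (h : HasSum f a) :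
    Tendsto (fun N : ℕ => ∑ m ∈ Finset.Icc (-(N : ℤ)) N, f m) atTop (𝓝 a) := by
  rw [HasSum, SummationFilter.unconditional_filter] at h
  refine h.comp (tendsto_atTop_finset_of_monotone (fun a b hab => ?_) fun m => ?_)
  · exact Finset.Icc_subset_Icc (by omega) (by omega)
  · exact ⟨m.natAbs, by rw [Finset.mem_Icc]; omega⟩

/-- In symmetric partial sums over rows the odd terms π cot(πmτ) cancel, and the rows of z/w² add up
to G₂ z, which `eisZeta` subtracts. -/
lemma tendsto_eisZeta {τ : ℍ} {z : ℂ} (hz : NotLattice τ z) :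
    Tendsto (fun N : ℕ => ∑ m ∈ Finset.Icc (-(N : ℤ)) N, piCot (z - m * τ)) atTop
      (𝓝 (eisZeta τ z)) := by
  have h1 : HasSum (fun m : ℤ => piCot (z - m * τ) + piCot (m * τ) + z * e2Summand m τ)
      (weierstrassZeta τ z) := by
    have := (finTwoArrowEquiv ℤ).symm.hasSum_iff.mpr (summable_zetaTerm τ z).hasSum
    refine this.prod_fiberwise fun m => ?_
    convert hasSum_zetaTerm_row hz m using 1
    ext n
    simp [latPt]
  have h2 : Tendsto (fun N : ℕ => ∑ m ∈ Finset.Icc (-(N : ℤ)) N, e2Summand m τ) atTop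
      (𝓝 (G2 τ)) := by
    have := (summable_e2Summand_symmetricIcc τ).hasSum
    rw [SummationFilter.hasSum_symmetricIcc_iff] at this
    exact this
  have h3 := (tendsto_sum_Icc_of_hasSum h1).sub (h2.mul_const z)
  refine h3.congr fun N => ?_
  rw [Finset.sum_add_distrib, Finset.sum_add_distrib, sum_Icc_odd (fun m : ℤ => piCot (m * τ))
    (fun m => by push_cast; rw [neg_mul, piCot_neg]), ← Finset.mul_sum]
  ring

lemma NotLattice.add {τ : ℍ} {z : ℂ} (hz : NotLattice τ z) (m n : ℤ) :
    NotLattice τ (z + (m * (τ : ℂ) + n)) := by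
  intro a b h
  refine hz (a - m) (b - n) ?_
  push_cast
  linear_combination h

lemma eisZeta_add_one {τ : ℍ} {z : ℂ} (hz : NotLattice τ z) : eisZeta τ (z + 1) = eisZeta τ z := by
  have h1 : NotLattice τ (z + 1) := by simpa using hz.add 0 1
  refine tendsto_nhds_unique ((tendsto_eisZeta h1).congr fun N => ?_) (tendsto_eisZeta hz)
  refine Finset.sum_congr rfl fun m _ => ?_
  rw [← piCot_add_one (z - m * τ)]
  congr 1
  ring

lemma norm_cexp_two_pi (w : ℂ) : ‖cexp (2 * π * I * w)‖ = Real.exp (-2 * π * w.im) := by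
  rw [Complex.norm_exp]
  congr 1
  simp

lemma tendsto_piCot_add (τ : ℍ) (z : ℂ) :
    Tendsto (fun N : ℕ => piCot (z + N * τ)) atTop (𝓝 (-(π * I))) := by
  have h1 : Tendsto (fun N : ℕ => cexp (2 * π * I * (z + N * τ))) atTop (𝓝 0) := by
    rw [tendsto_zero_iff_norm_tendsto_zero]
    simp_rw [norm_cexp_two_pi]
    refine Real.tendsto_exp_atBot.comp ?_
    have h2 : ∀ N : ℕ, -2 * π * (z + N * (τ : ℂ)).im = -2 * π * z.im - (2 * π * τ.im) * N := by
      intro N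
      simp
      ring
    simp_rw [h2]
    refine tendsto_atBot_add_const_left _ _ (tendsto_neg_atTop_atBot.comp ?_)
    exact tendsto_natCast_atTop_atTop.const_mul_atTop (by have := τ.im_pos; positivity)
  have h2 := ((h1.add_const 1).div ((h1.const_sub 1).const_mul I) (by simp)).const_mul (π : ℂ)
  simp_rw [piCot_eq]
  convert h2 using 2
  · rfl
  · rw [zero_add, sub_zero, mul_one, one_div, inv_I, mul_neg]

/-- Translation by τ shifts the window of rows by one. The row gained and the row lost lie at
opposite ends, where π cot(πw) tends to -πi and πi; the difference is -2πi. -/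
lemma eisZeta_add_tau {τ : ℍ} {z : ℂ} (hz : NotLattice τ z) :
    eisZeta τ (z + τ) = eisZeta τ z - 2 * π * I := by
  have h1 : NotLattice τ (z + τ) := by simpa using hz.add 1 0
  refine tendsto_nhds_unique (tendsto_eisZeta h1) ?_
  have h2 := ((tendsto_eisZeta hz).add (tendsto_piCot_add τ (z + τ))).add
    (tendsto_piCot_add τ (-z))
  have h3 : eisZeta τ z + -(π * I) + -(π * I) = eisZeta τ z - 2 * π * I := by ring
  rw [h3] at h2
  refine h2.congr fun N => ?_
  have h4 : ∀ N : ℕ, ∑ m ∈ Finset.Icc (-(N : ℤ)) N, piCot (z + τ - m * τ) =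
      ∑ m ∈ Finset.Icc (-(N : ℤ)) N, piCot (z - m * τ) + piCot (z + τ + N * τ) -
        piCot (z - N * τ) := by
    intro N
    induction N with
    | zero => simp
    | succ N ih =>
      have h5 : ∀ f : ℤ → ℂ, ∑ m ∈ Finset.Icc (-((N + 1 : ℕ) : ℤ)) ((N + 1 : ℕ) : ℤ), f m =
          ∑ m ∈ Finset.Icc (-(N : ℤ)) N, f m + f (N + 1) + f (-(N + 1)) := by
        intro f
        have : Finset.Icc (-((N + 1 : ℕ) : ℤ)) ((N + 1 : ℕ) : ℤ) =
            insert (-((N : ℤ) + 1)) (insert ((N : ℤ) + 1) (Finset.Icc (-(N : ℤ)) N)) := by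
          ext m
          simp only [Finset.mem_Icc, Finset.mem_insert]
          omega
        rw [this, Finset.sum_insert, Finset.sum_insert]
        · ring
        · simp
        · simp only [Finset.mem_insert, Finset.mem_Icc]
          omega
      rw [h5, h5, ih]
      push_cast
      rw [show z + (τ : ℂ) - (N + 1) * τ = z - N * τ by ring,
        show z + (τ : ℂ) - -(N + 1) * τ = z + τ + (N + 1) * τ by ring,
        show z - -((N : ℂ) + 1) * τ = z + τ + N * τ by ring]
      ring
  rw [h4, sub_eq_add_neg, ← piCot_neg]
  congr 2
  ring

lemma eisZeta_add_lattice {τ : ℍ} {z : ℂ} (hz : NotLattice τ z) (m n : ℤ) :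
    eisZeta τ (z + (m * τ + n)) = eisZeta τ z - 2 * π * I * m := by
  have h1 : ∀ {w : ℂ}, NotLattice τ w → ∀ k : ℕ, eisZeta τ (w + k) = eisZeta τ w := by
    intro w hw k
    induction k with
    | zero => simp
    | succ k ih =>
      rw [← ih, Nat.cast_succ, ← add_assoc, eisZeta_add_one]
      simpa using hw.add 0 k
  have h2 : ∀ {w : ℂ}, NotLattice τ w → ∀ k : ℕ,
      eisZeta τ (w + k * τ) = eisZeta τ w - 2 * π * I * k := by
    intro w hw k
    induction k with
    | zero => simp
    | succ k ih =>
      rw [Nat.cast_succ, show w + ((k : ℂ) + 1) * τ = w + k * τ + τ by ring, eisZeta_add_tau, ih]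
      · ring
      · simpa using hw.add k 0
  have h3 : ∀ {w : ℂ}, NotLattice τ w → ∀ k : ℤ, eisZeta τ (w + k) = eisZeta τ w := by
    intro w hw k
    obtain ⟨k, rfl | rfl⟩ := k.eq_nat_or_neg
    · exact_mod_cast h1 hw k
    · have h4 : NotLattice τ (w + ((-(k : ℤ) : ℤ) : ℂ)) := by simpa using hw.add 0 (-k)
      have := h1 h4 k
      rw [← this]
      congr 1
      push_cast
      ring
  have h4 : ∀ {w : ℂ}, NotLattice τ w → ∀ k : ℤ,
      eisZeta τ (w + k * τ) = eisZeta τ w - 2 * π * I * k := by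
    intro w hw k
    obtain ⟨k, rfl | rfl⟩ := k.eq_nat_or_neg
    · exact_mod_cast h2 hw k
    · have h5 : NotLattice τ (w + ((-(k : ℤ) : ℤ) : ℂ) * τ) := by simpa using hw.add (-k) 0
      have := h2 h5 k
      rw [show w + ((-(k : ℤ) : ℤ) : ℂ) * τ + k * τ = w by push_cast; ring] at this
      rw [this]
      push_cast
      ring
  have h5 : NotLattice τ (z + m * τ) := by simpa using hz.add m 0
  rw [← add_assoc, h3 h5, h4 hz]

/-- The Weierstrass zeta function is homogeneous of degree -1 and γ permutes the lattice, so the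
only defect comes from the quasi-modularity of G₂. -/
lemma eisZeta_smul (γ : SL(2, ℤ)) (τ : ℍ) (z : ℂ) :
    eisZeta (γ • τ) (z / denom γ τ) =
      denom γ τ * eisZeta τ z + 2 * π * I * (γ 1 0 : ℤ) * z := by
  have hj : denom γ τ ≠ 0 := denom_ne_zero γ τ
  have hG := congrFun (G2_slash_action γ) τ
  rw [ModularForm.SL_slash_apply, Pi.sub_apply, D2] at hG
  have hG' : G2 (γ • τ) = denom γ τ ^ 2 * G2 τ - 2 * π * I * (γ 1 0 : ℤ) * denom γ τ := by
    rw [zpow_neg, ← div_eq_mul_inv, div_eq_iff (zpow_ne_zero _ hj)] at hG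
    rw [hG]
    field_simp
  have hlat : ∀ v : Fin 2 → ℤ, latPt (γ • τ) v = latPt τ (Matrix.vecMul v γ.1) / denom γ τ := by
    intro v
    have := eisSummand_SL2_apply (-1) v γ τ
    simp only [eisSummand, neg_neg, zpow_one, zpow_neg_one] at this
    rw [latPt, this, latPt, inv_mul_eq_div]
  have hz : weierstrassZeta (γ • τ) (z / denom γ τ) = denom γ τ * weierstrassZeta τ z := by
    rw [weierstrassZeta, weierstrassZeta, ← tsum_mul_left]
    simp_rw [hlat, zetaTerm_div _ _ _ hj]
    let e : (Fin 2 → ℤ) ≃ (Fin 2 → ℤ) :=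
      { toFun := fun v => Matrix.vecMul v γ.1
        invFun := fun v => Matrix.vecMul v (γ⁻¹).1
        left_inv := fun v => by
          have : γ.1 * (γ⁻¹).1 = 1 := by
            rw [← Matrix.SpecialLinearGroup.coe_mul, mul_inv_cancel,
              Matrix.SpecialLinearGroup.coe_one]
          beta_reduce
          rw [Matrix.vecMul_vecMul, this, Matrix.vecMul_one]
        right_inv := fun v => by
          have : (γ⁻¹).1 * γ.1 = 1 := by
            rw [← Matrix.SpecialLinearGroup.coe_mul, inv_mul_cancel,
              Matrix.SpecialLinearGroup.coe_one]
          beta_reduce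
          rw [Matrix.vecMul_vecMul, this, Matrix.vecMul_one] }
    exact e.tsum_eq fun v => denom γ τ * zetaTerm z (latPt τ v)
  rw [eisZeta, eisZeta, hz, hG']
  field_simp
  ring

end CoreConv

/-! ### q-expansions and Eisenstein series of weight one. -/

namespace CoreConv

open UpperHalfPlane hiding I
open Complex Filter Topology Real PowerSeries
open scoped MatrixGroups

lemma NotLattice.cexp_ne_one {τ : ℍ} {z : ℂ} (hz : NotLattice τ z) (m : ℤ) :
    cexp (2 * π * I * (z + m * τ)) ≠ 1 := by
  intro h
  obtain ⟨n, hn⟩ := Complex.exp_eq_one_iff.mp h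
  refine hz (-m) n ?_
  have h1 : (2 * π * I : ℂ) ≠ 0 := Complex.two_pi_I_ne_zero
  have h2 : (2 * π * I : ℂ) * (z + m * τ) = 2 * π * I * n := by rw [hn]; ring
  have := mul_left_cancel₀ h1 h2
  push_cast
  linear_combination this

lemma piCot_eq_add {w : ℂ} (h : cexp (2 * π * I * w) ≠ 1) :
    piCot w = -(π * I) - 2 * π * I * (cexp (2 * π * I * w) / (1 - cexp (2 * π * I * w))) := by
  rw [piCot_eq]
  generalize cexp (2 * π * I * w) = E at *
  have h1 : 1 - E ≠ 0 := sub_ne_zero.mpr h.symm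
  rw [← div_div, div_I]
  field_simp
  ring

/-- The nome `e^{2πiτ}`. -/
noncomputable def nome (τ : ℍ) : ℂ := cexp (2 * π * I * τ)

lemma nome_ne_zero (τ : ℍ) : nome τ ≠ 0 := Complex.exp_ne_zero _

lemma norm_nome (τ : ℍ) : ‖nome τ‖ = Real.exp (-2 * π * τ.im) := norm_cexp_two_pi τ

lemma norm_nome_lt_one (τ : ℍ) : ‖nome τ‖ < 1 := by
  rw [norm_nome, Real.exp_lt_one_iff]
  have := τ.im_pos
  have := Real.pi_pos
  nlinarith

lemma piCot_sub_add_piCot_add {τ : ℍ} {z : ℂ} (hz : NotLattice τ z) (m : ℕ) :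
    piCot (z - m * τ) + piCot (z + m * τ) =
      2 * π * I * (cexp (2 * π * I * (-z)) * nome τ ^ m / (1 - cexp (2 * π * I * (-z)) * nome τ ^ m) -
        cexp (2 * π * I * z) * nome τ ^ m / (1 - cexp (2 * π * I * z) * nome τ ^ m)) := by
  have h1 : ∀ w : ℂ, cexp (2 * π * I * w) * nome τ ^ m = cexp (2 * π * I * (w + m * τ)) := by
    intro w
    rw [nome, ← Complex.exp_nat_mul, ← Complex.exp_add]
    congr 1
    ring
  have h2 := hz.cexp_ne_one m
  have h3 : cexp (2 * π * I * (-z + m * τ)) ≠ 1 := by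
    have := hz.cexp_ne_one (-m)
    intro h
    apply this
    rw [show 2 * π * I * (z + ((-(m : ℤ) : ℤ) : ℂ) * τ) = -(2 * π * I * (-z + m * τ)) by
      push_cast; ring, Complex.exp_neg, h, inv_one]
  rw [Int.cast_natCast] at h2
  rw [h1, h1]
  rw [show z - m * (τ : ℂ) = -(-z + m * τ) by ring, piCot_neg, piCot_eq_add h2, piCot_eq_add h3]
  ring

lemma sum_Icc_neg_self (f : ℤ → ℂ) (N : ℕ) : ∑ m ∈ Finset.Icc (-(N : ℤ)) N, f m =
    f 0 + ∑ m ∈ Finset.range N, (f (m + 1) + f (-(m + 1))) := by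
  induction N with
  | zero => simp
  | succ N ih =>
    have : Finset.Icc (-((N + 1 : ℕ) : ℤ)) ((N + 1 : ℕ) : ℤ) =
        insert (-((N : ℤ) + 1)) (insert ((N : ℤ) + 1) (Finset.Icc (-(N : ℤ)) N)) := by
      ext m
      simp only [Finset.mem_Icc, Finset.mem_insert]
      omega
    rw [this, Finset.sum_insert, Finset.sum_insert, ih, Finset.sum_range_succ]
    · ring
    · simp
    · simp only [Finset.mem_insert, Finset.mem_Icc]
      omega

/-- The contribution of the rows `±m` of the lattice to `eisZeta`. -/
noncomputable def rowPair (τ : ℍ) (z : ℂ) (m : ℕ) : ℂ :=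
  cexp (2 * π * I * (-z)) * nome τ ^ m / (1 - cexp (2 * π * I * (-z)) * nome τ ^ m) -
    cexp (2 * π * I * z) * nome τ ^ m / (1 - cexp (2 * π * I * z) * nome τ ^ m)

lemma tendsto_rowPair {τ : ℍ} {z : ℂ} (hz : NotLattice τ z) :
    Tendsto (fun N : ℕ => piCot z + ∑ m ∈ Finset.range N, 2 * π * I * rowPair τ z (m + 1)) atTop
      (𝓝 (eisZeta τ z)) := by
  refine (tendsto_eisZeta hz).congr fun N => ?_
  rw [sum_Icc_neg_self, Int.cast_zero, zero_mul, sub_zero]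
  congr 1
  refine Finset.sum_congr rfl fun m _ => ?_
  rw [rowPair, ← piCot_sub_add_piCot_add hz]
  push_cast
  congr 2
  ring

/-- The series `c + ∑_{n ≥ 1} (∑_{d ∣ n} h d) X ^ n`. -/
noncomputable def divisorSeries (c : ℂ) (h : ℕ → ℂ) : ℂ⟦X⟧ :=
  mk fun n => if n = 0 then c else ∑ d ∈ n.divisors, h d

lemma convDisc_divisorSeries (c : ℂ) {h : ℕ → ℂ} {B : ℝ} (hB : ∀ n, ‖h n‖ ≤ B) :
    ConvDisc (divisorSeries c h) := by
  intro q hq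
  have hB0 : 0 ≤ B := (norm_nonneg _).trans (hB 0)
  have h1 := (summable_pow_mul_geometric_of_norm_lt_one (R := ℝ) 1 (r := ‖q‖) (by simpa using hq)).mul_left B
  rw [← summable_nat_add_iff 1] at h1 ⊢
  refine h1.of_nonneg_of_le (fun _ => norm_nonneg _) fun n => ?_
  rw [divisorSeries, coeff_mk, if_neg n.succ_ne_zero, norm_mul, norm_pow, pow_one, ← mul_assoc]
  gcongr
  refine (norm_sum_le _ _).trans ((Finset.sum_le_card_nsmul _ _ B fun d _ => hB d).trans ?_)
  rw [nsmul_eq_mul, mul_comm]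
  gcongr
  exact Nat.card_divisors_le_self _

/-- This is the Lambert series rearrangement: the double sum of h(k) q^{mk} is grouped by the
product mk. The index m starts at 0, whence m + 1. -/
lemma hasSum_divisorSeries (c : ℂ) {h : ℕ → ℂ} {B : ℝ} (hB : ∀ n, ‖h n‖ ≤ B) {q : ℂ}
    (hq : ‖q‖ < 1) :
    HasSum (fun m : ℕ => ∑' k : ℕ+, h k * q ^ ((m + 1) * (k : ℕ)))
      (evalAt (divisorSeries c h) q - c) := by
  have hS : Summable fun x : ℕ+ × ℕ+ => h x.2 * q ^ ((x.1 : ℕ) * x.2) := by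
    have := (summable_prod_mul_pow 0 hq).norm.mul_left B
    refine Summable.of_norm_bounded this fun x => ?_
    simp only [pow_zero, one_mul, norm_mul]
    gcongr
    exact hB _
  have h1 := (sigmaAntidiagonalEquivProd.hasSum_iff.mpr hS.hasSum).sigma
    (g := fun n : ℕ+ => coeff n (divisorSeries c h) * q ^ (n : ℕ)) fun n => by
      have h2 := hasSum_fintype fun x : (n : ℕ).divisorsAntidiagonal =>
        h x.1.2 * q ^ (x.1.1 * x.1.2)
      rw [(n : ℕ).divisorsAntidiagonal.sum_coe_sort fun x : ℕ × ℕ => h x.2 * q ^ (x.1 * x.2),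
        Nat.sum_divisorsAntidiagonal' fun x y => h y * q ^ (x * y)] at h2
      rw [divisorSeries, coeff_mk, if_neg n.ne_zero, Finset.sum_mul]
      convert h2 using 1
      · rfl
      · exact Finset.sum_congr rfl fun i hi => by
          rw [Nat.div_mul_cancel (Nat.dvd_of_mem_divisors hi)]
  have h2 := (hasSum_nat_add_iff' 1).mpr ((convDisc_divisorSeries c hB).hasSum hq)
  rw [← Equiv.pnatEquivNat.symm.hasSum_iff] at h1
  have h3 := h1.unique h2
  simp only [Finset.range_one, Finset.sum_singleton, pow_zero, mul_one] at h3
  rw [divisorSeries, coeff_mk, if_pos rfl, ← divisorSeries] at h3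
  rw [← h3]
  have h4 := hS.hasSum.prod_fiberwise fun m => (hS.prod_factor m).hasSum
  rw [← Equiv.pnatEquivNat.symm.hasSum_iff] at h4
  exact h4

/-! ### Weight one forms attached to odd functions -/

section OddFunctions

variable {p : ℕ} [NeZero p]

/-- The inverse Fourier transform of `h`, divided by `4πi`. -/
noncomputable def fourierWeight (h : ZMod p → ℂ) (b : ZMod p) : ℂ :=
  (4 * π * I * p)⁻¹ * ∑ c, h c * ZMod.stdAddChar (c * b)

/-- The Eisenstein series of weight one attached to an odd function `h`. -/
noncomputable def weightOne (h : ZMod p → ℂ) (τ : ℍ) : ℂ :=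
  ∑ b : ZMod p, fourierWeight h b * eisZeta τ (b.val / p)

lemma fourierWeight_neg {h : ZMod p → ℂ} (hh : h.Odd) (b : ZMod p) :
    fourierWeight h (-b) = -fourierWeight h b := by
  rw [fourierWeight, fourierWeight, ← mul_neg, ← Finset.sum_neg_distrib]
  congr 1
  refine Fintype.sum_equiv (Equiv.neg _) _ _ fun c => ?_
  rw [Equiv.neg_apply, hh, mul_neg, neg_mul, neg_mul, neg_neg]

lemma fourierWeight_zero {h : ZMod p → ℂ} (hh : h.Odd) : fourierWeight h 0 = 0 := by
  have := fourierWeight_neg hh 0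
  rw [neg_zero] at this
  exact self_eq_neg.mp this

lemma sum_fourierWeight_mul (h : ZMod p → ℂ) (k : ZMod p) :
    ∑ b, fourierWeight h b * ZMod.stdAddChar (-(b * k)) = (4 * π * I)⁻¹ * h k := by
  have h1 : ∀ b, fourierWeight h b * ZMod.stdAddChar (-(b * k)) =
      (4 * π * I * p)⁻¹ * ∑ c, h c * ZMod.stdAddChar (b * (c - k)) := by
    intro b
    rw [fourierWeight, mul_assoc, Finset.sum_mul]
    congr 1
    refine Finset.sum_congr rfl fun c _ => ?_
    rw [mul_assoc, ← AddChar.map_add_eq_mul]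
    congr 2
    ring
  simp_rw [h1, ← Finset.mul_sum]
  rw [Finset.sum_comm]
  simp_rw [← Finset.mul_sum, AddChar.sum_mulShift _ (ZMod.isPrimitive_stdAddChar p), sub_eq_zero]
  have hp : (p : ℂ) ≠ 0 := NeZero.ne _
  simp only [ZMod.card, Nat.cast_ite, Nat.cast_zero, mul_ite, mul_zero, Finset.sum_ite_eq',
    Finset.mem_univ, if_true, mul_inv]
  field_simp

lemma cexp_val_div (b : ZMod p) : cexp (2 * π * I * (b.val / p)) = ZMod.stdAddChar b := by
  have := ZMod.stdAddChar_coe (N := p) b.val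
  rw [Int.cast_natCast, ZMod.natCast_zmod_val] at this
  rw [this]
  congr 1
  push_cast
  ring

lemma notLattice_val_div {b : ZMod p} (hb : b ≠ 0) (τ : ℍ) : NotLattice τ (b.val / p) := by
  intro m n h
  have hp : (p : ℝ) ≠ 0 := NeZero.ne _
  have hlt := ZMod.val_lt b
  have hb0 : b.val ≠ 0 := fun h => hb ((ZMod.val_eq_zero b).mp h)
  generalize b.val = v at *
  have him := congrArg Complex.im h
  have hre := congrArg Complex.re h
  rw [show ((v : ℂ) / p) = ((v / p : ℝ) : ℂ) by push_cast; rfl] at him hre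
  simp at him hre
  rcases him with rfl | h0
  · rw [Int.cast_zero, zero_mul, zero_add, div_eq_iff hp] at hre
    have h1 : (v : ℤ) = n * p := by exact_mod_cast hre
    have h2 : p ∣ v := by exact_mod_cast Dvd.intro_left n h1.symm
    exact hb0 (Nat.eq_zero_of_dvd_of_lt h2 hlt)
  · exact τ.im_ne_zero h0

lemma sum_range_mul_pow_mul_sub_one (ζ : ℂ) (n : ℕ) :
    (∑ c ∈ Finset.range n, (c : ℂ) * ζ ^ c) * (ζ - 1) =
      n * ζ ^ n - ζ * ∑ c ∈ Finset.range n, ζ ^ c := by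
  induction n with
  | zero => simp
  | succ n ih =>
    rw [Finset.sum_range_succ, add_mul, ih, Finset.sum_range_succ]
    push_cast
    ring

lemma sum_zmod_eq_sum_range (f : ZMod p → ℂ) : ∑ c, f c = ∑ c ∈ Finset.range p, f (c : ℕ) :=
  Finset.sum_nbij' ZMod.val (fun c => (c : ZMod p))
    (fun c _ => Finset.mem_range.mpr (ZMod.val_lt c)) (fun _ _ => Finset.mem_univ _)
    (fun c _ => ZMod.natCast_zmod_val c)
    (fun _ hc => ZMod.val_cast_of_lt (Finset.mem_range.mp hc))
    (fun c _ => by rw [ZMod.natCast_zmod_val])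

/-- The sawtooth function `1 / 2 - {c / p}`. -/
noncomputable def sawtooth (c : ZMod p) : ℂ := 1 / 2 - c.val / p

/-- With ζ ≠ 1 and ζ^p = 1, the constant 1/2 contributes nothing and ∑ c ζ^c is summed by parts.
Read backwards, this expands the cotangent at b/p in sawtooth values. -/
lemma sum_sawtooth_mul {b : ZMod p} (hb : b ≠ 0) :
    ∑ c, sawtooth c * ZMod.stdAddChar (b * c) = 1 / (1 - ZMod.stdAddChar b) := by
  have hp : (p : ℂ) ≠ 0 := NeZero.ne _
  set ζ := ZMod.stdAddChar b with hζ
  have h1 : 1 - ζ ≠ 0 := by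
    rw [sub_ne_zero, hζ, ← AddChar.map_zero_eq_one (ZMod.stdAddChar (N := p))]
    exact fun h => hb (ZMod.injective_stdAddChar h).symm
  have hpow : ∀ c : ℕ, ZMod.stdAddChar (b * (c : ZMod p)) = ζ ^ c := by
    intro c
    rw [← AddChar.map_nsmul_eq_pow, nsmul_eq_mul, mul_comm]
  have hζp : ζ ^ p = 1 := by rw [← hpow]; simp
  have h2 := sum_range_mul_pow_mul_sub_one ζ p
  have h3 : ∑ c ∈ Finset.range p, ζ ^ c = 0 := by
    have := geom_sum_mul_neg ζ p
    rw [hζp, sub_self] at this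
    exact (mul_eq_zero.mp this).resolve_right h1
  rw [h3, hζp, mul_zero, sub_zero, mul_one] at h2
  rw [sum_zmod_eq_sum_range]
  have h4 : ∀ c ∈ Finset.range p, sawtooth (c : ZMod p) * ZMod.stdAddChar (b * (c : ZMod p)) =
      1 / 2 * ζ ^ c - (p : ℂ)⁻¹ * (c * ζ ^ c) := by
    intro c hc
    rw [hpow, sawtooth, ZMod.val_cast_of_lt (Finset.mem_range.mp hc)]
    ring
  rw [Finset.sum_congr rfl h4, Finset.sum_sub_distrib, ← Finset.mul_sum, ← Finset.mul_sum, h3,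
    eq_div_iff h1]
  field_simp
  linear_combination 2 * h2

/-- For ζ = e(b/p) ≠ 1, π cot(πb/p) = πi - 2πi/(1 - ζ). Inserting `sum_sawtooth_mul` and applying
Fourier inversion gives the constant term of the q-expansion. -/
lemma sum_fourierWeight_mul_piCot {h : ZMod p → ℂ} (hh : h.Odd) :
    ∑ b : ZMod p, fourierWeight h b * piCot (b.val / p) = 1 / 2 * ∑ c, sawtooth c * h c := by
  have hp : (p : ℂ) ≠ 0 := NeZero.ne _
  have h1 : ∀ b : ZMod p, fourierWeight h b * piCot (b.val / p) =
      fourierWeight h b * (π * I) - 2 * π * I *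
        ∑ c, sawtooth c * (fourierWeight h b * ZMod.stdAddChar (b * c)) := by
    intro b
    rcases eq_or_ne b 0 with rfl | hb
    · simp [fourierWeight_zero hh]
    · have h2 : ∑ c, sawtooth c * (fourierWeight h b * ZMod.stdAddChar (b * c)) =
          fourierWeight h b * (1 / (1 - ZMod.stdAddChar b)) := by
        rw [← sum_sawtooth_mul hb, Finset.mul_sum]
        exact Finset.sum_congr rfl fun c _ => by ring
      have h3 : 1 - ZMod.stdAddChar b ≠ 0 := by
        rw [sub_ne_zero, ← AddChar.map_zero_eq_one (ZMod.stdAddChar (N := p))]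
        exact fun h => hb (ZMod.injective_stdAddChar h).symm
      rw [h2, piCot_eq_add, cexp_val_div]
      · field_simp
        ring
      · rw [cexp_val_div]
        exact (sub_ne_zero.mp h3).symm
  have h4 : ∑ b, fourierWeight h b = 0 := by
    have := sum_fourierWeight_mul h 0
    simpa [hh.map_zero] using this
  rw [Finset.sum_congr rfl fun b _ => h1 b, Finset.sum_sub_distrib, ← Finset.sum_mul, h4, zero_mul,
    zero_sub, ← Finset.mul_sum, Finset.sum_comm]
  have h5 : ∀ c, ∑ b, sawtooth c * (fourierWeight h b * ZMod.stdAddChar (b * c)) =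
      -((4 * π * I)⁻¹ * (sawtooth c * h c)) := by
    intro c
    have := sum_fourierWeight_mul h (-c)
    simp_rw [mul_neg, neg_neg] at this
    rw [← Finset.mul_sum, this, hh]
    ring
  simp_rw [h5, Finset.sum_neg_distrib, ← Finset.mul_sum]
  have : (π : ℂ) ≠ 0 := by exact_mod_cast Real.pi_ne_zero
  field_simp
  norm_num

lemma norm_stdAddChar (b : ZMod p) : ‖(ZMod.stdAddChar b : ℂ)‖ = 1 := by
  rw [ZMod.stdAddChar_apply, Circle.norm_coe]

lemma hasSum_mul_div_one_sub {x q : ℂ} (hx : ‖x‖ = 1) (hq : ‖q‖ < 1) :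
    HasSum (fun k : ℕ+ => x ^ (k : ℕ) * q ^ (k : ℕ)) (x * q / (1 - x * q)) := by
  have h1 : ‖x * q‖ < 1 := by rwa [norm_mul, hx, one_mul]
  rw [← Equiv.pnatEquivNat.symm.hasSum_iff, div_eq_mul_inv]
  convert! (hasSum_geometric_of_norm_lt_one h1).mul_left (x * q) using 2 with k
  simp only [Function.comp_apply, Equiv.pnatEquivNat_symm_apply, Nat.succPNat_coe,
    Nat.succ_eq_add_one]
  rw [← mul_pow, pow_succ']

/-- Both geometric series are expanded and Fourier inversion is applied termwise. Since h is odd,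
the rows m and -m contribute equally, which is why `fourierWeight` divides by 4πi. -/
lemma sum_fourierWeight_mul_rowPair {h : ZMod p → ℂ} (hh : h.Odd) (τ : ℍ) {m : ℕ} (hm : m ≠ 0) :
    ∑ b : ZMod p, fourierWeight h b * (2 * π * I * rowPair τ (b.val / p) m) =
      ∑' k : ℕ+, h (k : ℕ) * nome τ ^ (m * (k : ℕ)) := by
  have hq : ‖nome τ ^ m‖ < 1 := by
    rw [norm_pow]
    exact pow_lt_one₀ (norm_nonneg _) (norm_nome_lt_one τ) hm
  have h1 : HasSum (fun k : ℕ+ => ∑ b : ZMod p, fourierWeight h b * (2 * π * I *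
      (ZMod.stdAddChar (-b) ^ (k : ℕ) * (nome τ ^ m) ^ (k : ℕ) -
        ZMod.stdAddChar b ^ (k : ℕ) * (nome τ ^ m) ^ (k : ℕ))))
      (∑ b : ZMod p, fourierWeight h b * (2 * π * I * rowPair τ (b.val / p) m)) := by
    refine hasSum_sum fun b _ => ?_
    have h2 : cexp (2 * π * I * (-(b.val / p))) = ZMod.stdAddChar (-b) := by
      rw [mul_neg, Complex.exp_neg, cexp_val_div, AddChar.map_neg_eq_inv]
    rw [rowPair, h2, cexp_val_div]
    exact (((hasSum_mul_div_one_sub (norm_stdAddChar _) hq).sub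
      (hasSum_mul_div_one_sub (norm_stdAddChar _) hq)).mul_left _).mul_left _
  rw [← h1.tsum_eq]
  refine tsum_congr fun k => ?_
  have h3 := sum_fourierWeight_mul h (k : ℕ)
  have h4 := sum_fourierWeight_mul h (-(k : ℕ))
  rw [hh] at h4
  have h5 : ∀ b : ZMod p, fourierWeight h b * (2 * π * I *
      (ZMod.stdAddChar (-b) ^ (k : ℕ) * (nome τ ^ m) ^ (k : ℕ) -
        ZMod.stdAddChar b ^ (k : ℕ) * (nome τ ^ m) ^ (k : ℕ))) =
      2 * π * I * nome τ ^ (m * (k : ℕ)) * (fourierWeight h b * ZMod.stdAddChar (-(b * ((k : ℕ) : ZMod p))) -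
        fourierWeight h b * ZMod.stdAddChar (-(b * -((k : ℕ) : ZMod p)))) := by
    intro b
    rw [← AddChar.map_nsmul_eq_pow, ← AddChar.map_nsmul_eq_pow, nsmul_eq_mul, nsmul_eq_mul, pow_mul,
      show ((k : ℕ) : ZMod p) * -b = -(b * (k : ℕ)) by ring,
      show -(b * -((k : ℕ) : ZMod p)) = (k : ℕ) * b by ring]
    ring
  simp_rw [h5]
  rw [← Finset.mul_sum, Finset.sum_sub_distrib, h3, h4]
  have : (π : ℂ) ≠ 0 := by exact_mod_cast Real.pi_ne_zero
  field_simp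
  ring

/-- The `q`-expansion of `weightOne h`. -/
noncomputable def weightOneSeries (h : ZMod p → ℂ) : ℂ⟦X⟧ :=
  divisorSeries (1 / 2 * ∑ c, sawtooth c * h c) fun n => h n

lemma norm_le_sum_norm (h : ZMod p → ℂ) (n : ℕ) : ‖h n‖ ≤ ∑ c, ‖h c‖ :=
  Finset.single_le_sum (f := fun c => ‖h c‖) (fun _ _ => norm_nonneg _) (Finset.mem_univ _)

lemma convDisc_weightOneSeries (h : ZMod p → ℂ) : ConvDisc (weightOneSeries h) :=
  convDisc_divisorSeries _ (norm_le_sum_norm h)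

lemma weightOne_eq_evalAt {h : ZMod p → ℂ} (hh : h.Odd) (τ : ℍ) :
    weightOne h τ = evalAt (weightOneSeries h) (nome τ) := by
  have h1 : Tendsto (fun N : ℕ => ∑ b : ZMod p, fourierWeight h b *
      (piCot (b.val / p) + ∑ m ∈ Finset.range N, 2 * π * I * rowPair τ (b.val / p) (m + 1))) atTop
      (𝓝 (weightOne h τ)) := by
    refine tendsto_finsetSum _ fun b _ => ?_
    rcases eq_or_ne b 0 with rfl | hb
    · simp [fourierWeight_zero hh]
    · exact (tendsto_rowPair (notLattice_val_div hb τ)).const_mul _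
  refine tendsto_nhds_unique h1 ?_
  have h2 := (hasSum_divisorSeries (1 / 2 * ∑ c, sawtooth c * h c) (norm_le_sum_norm h)
    (norm_nome_lt_one τ)).tendsto_sum_nat.const_add (1 / 2 * ∑ c, sawtooth c * h c)
  rw [add_sub_cancel] at h2
  refine h2.congr fun N => ?_
  simp_rw [mul_add, Finset.mul_sum, Finset.sum_add_distrib, sum_fourierWeight_mul_piCot hh]
  rw [← Finset.mul_sum, Finset.sum_comm]
  congr 1
  refine Finset.sum_congr rfl fun m _ => ?_
  rw [sum_fourierWeight_mul_rowPair hh τ m.succ_ne_zero]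

end OddFunctions

end CoreConv

/-! ### Behaviour of the weight one series under Γ₀(p) and at the cusp 0. -/

namespace CoreConv

open UpperHalfPlane hiding I
open Complex Filter Topology Real PowerSeries
open scoped MatrixGroups

section OddFunctions

variable {p : ℕ} [NeZero p]

lemma intCast_div_eq (n : ℤ) (τ : ℍ) :
    (n : ℂ) / p = ((n : ZMod p).val : ℂ) / p + (((0 : ℤ) : ℂ) * τ + (n / p : ℤ)) := by
  have hp : (p : ℂ) ≠ 0 := NeZero.ne _
  have h1 : (n : ℂ) = ((n : ZMod p).val : ℂ) + p * (n / p : ℤ) := by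
    have h2 := ZMod.val_intCast (n := p) n
    have h3 := Int.emod_add_mul_ediv n p
    rw [← h2] at h3
    exact_mod_cast h3.symm
  rw [div_eq_iff hp, add_mul, div_mul_cancel₀ _ hp, Int.cast_zero, zero_mul, zero_add, mul_comm _ (p : ℂ)]
  exact h1

lemma notLattice_intCast_div {n : ℤ} (hn : (n : ZMod p) ≠ 0) (τ : ℍ) : NotLattice τ (n / p) := by
  rw [intCast_div_eq n τ]
  exact (notLattice_val_div hn τ).add _ _

lemma eisZeta_intCast_div {n : ℤ} (hn : (n : ZMod p) ≠ 0) (τ : ℍ) :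
    eisZeta τ (n / p) = eisZeta τ ((n : ZMod p).val / p) := by
  rw [intCast_div_eq n τ, eisZeta_add_lattice (notLattice_val_div hn τ)]
  simp

lemma fourierWeight_mul_unit (h : ZMod p → ℂ) (u : (ZMod p)ˣ) (b : ZMod p) :
    fourierWeight (fun c : ZMod p => h ((u : ZMod p) * c)) (b * (u : ZMod p)) = fourierWeight h b := by
  rw [fourierWeight, fourierWeight]
  congr 1
  refine Fintype.sum_equiv (Units.mulLeft u) _ _ fun c => ?_
  rw [Units.mulLeft_apply]
  congr 2
  ring

/-- Write pk and d for the lower row of γ. Then (b/p)(pkτ + d) = bd/p + bkτ, and the quasi-period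
-2πi bk cancels the linear term of `eisZeta_smul` exactly. What remains is the substitution b ↦ bd.
-/
lemma weightOne_smul {h : ZMod p → ℂ} (hh : h.Odd) {γ : SL(2, ℤ)} (hγ : ((γ 1 0 : ℤ) : ZMod p) = 0)
    {u : (ZMod p)ˣ} (hu : (u : ZMod p) = (γ 1 1 : ℤ)) (τ : ℍ) :
    weightOne h (γ • τ) = denom γ τ * weightOne (fun c : ZMod p => h ((u : ZMod p) * c)) τ := by
  have hp : (p : ℂ) ≠ 0 := NeZero.ne _
  obtain ⟨k, hk⟩ := (ZMod.intCast_zmod_eq_zero_iff_dvd _ p).mp hγ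
  have hden : denom γ τ = (γ 1 0 : ℤ) * (τ : ℂ) + (γ 1 1 : ℤ) := ModularGroup.denom_apply γ τ
  have hden0 : denom γ τ ≠ 0 := denom_ne_zero γ τ
  rw [weightOne, weightOne, Finset.mul_sum]
  refine Fintype.sum_equiv (Units.mulRight u) _ _ fun b => ?_
  rw [Units.mulRight_apply, fourierWeight_mul_unit]
  rcases eq_or_ne b 0 with rfl | hb
  · simp [fourierWeight_zero hh]
  have hbu : ((b.val * γ 1 1 : ℤ) : ZMod p) = b * u := by
    push_cast
    rw [ZMod.natCast_zmod_val, hu]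
  have hbu0 : ((b.val * γ 1 1 : ℤ) : ZMod p) ≠ 0 := by
    rw [hbu]
    exact fun h0 => hb ((Units.mul_left_eq_zero u).mp h0)
  have h1 : ((b.val : ℂ) / p) = ((b.val : ℂ) / p * denom γ τ) / denom γ τ := by field_simp
  have h2 : (b.val : ℂ) / p * denom γ τ =
      ((b.val * γ 1 1 : ℤ) : ℂ) / p + ((b.val * k : ℤ) * (τ : ℂ) + (0 : ℤ)) := by
    rw [hden, hk]
    push_cast
    field_simp
    ring
  rw [h1, eisZeta_smul, h2, eisZeta_add_lattice (notLattice_intCast_div hbu0 τ), eisZeta_intCast_div hbu0, hbu, ← h2, hk]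
  push_cast
  field_simp
  ring

lemma weightOne_S_smul (h : ZMod p → ℂ) (τ : ℍ) :
    weightOne h (ModularGroup.S • τ) = τ * ∑ b : ZMod p, fourierWeight h b *
      (eisZeta τ ((b.val / p : ℝ) * τ) + 2 * π * I * (b.val / p : ℝ)) := by
  have hτ : (τ : ℂ) ≠ 0 := τ.ne_zero
  rw [weightOne, Finset.mul_sum]
  refine Finset.sum_congr rfl fun b _ => ?_
  have h1 := eisZeta_smul ModularGroup.S τ ((b.val / p : ℝ) * τ)
  rw [ModularGroup.denom_S, mul_div_cancel_right₀ _ hτ,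
    show (ModularGroup.S 1 0 : ℤ) = 1 by simp [ModularGroup.S]] at h1
  push_cast at h1 ⊢
  rw [h1]
  ring

end OddFunctions

lemma norm_div_one_sub_le {u : ℂ} {ρ r : ℝ} (h1 : ‖u‖ ≤ ρ) (h2 : ρ ≤ r) (hr : r < 1) :
    ‖u / (1 - u)‖ ≤ ρ / (1 - r) := by
  have h3 : 1 - r ≤ ‖1 - u‖ := by
    have := norm_sub_norm_le 1 u
    rw [norm_one] at this
    linarith
  rw [norm_div]
  have := (norm_nonneg u).trans h1
  have : 0 < 1 - r := by linarith
  gcongr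

/-- Since 0 < x < 1, the point xτ stays strictly between two consecutive rows of the lattice. For Im
τ ≥ 1 the exponential in the row 0 is bounded by s < 1 and those in the rows ±m by r^m with r < 1.
-/
lemma exists_norm_eisZeta_mul_le {x : ℝ} (hx0 : 0 < x) (hx1 : x < 1) :
    ∃ B : ℝ, ∀ τ : ℍ, 1 ≤ τ.im → ‖eisZeta τ (x * τ)‖ ≤ B := by
  set r := Real.exp (-2 * π * (1 - x)) with hr
  set s := Real.exp (-2 * π * x) with hs
  have hπ := Real.pi_pos
  have hr0 : 0 < r := Real.exp_pos _
  have hr1 : r < 1 := by rw [hr, Real.exp_lt_one_iff]; nlinarith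
  have hs1 : s < 1 := by rw [hs, Real.exp_lt_one_iff]; nlinarith
  refine ⟨π + 2 * π * (s / (1 - s)) + 2 * π * (2 / (1 - r)) * (1 - r)⁻¹, fun τ hτ => ?_⟩
  have hnl : NotLattice τ (x * τ) := by
    intro m n h
    have him := congrArg Complex.im h
    rw [Complex.im_ofReal_mul] at him
    simp only [Complex.add_im, Complex.mul_im, intCast_re, intCast_im, zero_mul, add_zero] at him
    have hm : x = m := mul_right_cancel₀ τ.im_ne_zero him
    rw [hm] at hx0 hx1
    have h3 : 0 < m := by exact_mod_cast hx0
    have h4 : m < 1 := by exact_mod_cast hx1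
    omega
  refine le_of_tendsto (tendsto_rowPair hnl).norm (Eventually.of_forall fun N => ?_)
  have him : (x * (τ : ℂ)).im = x * τ.im := by simp
  have hE : cexp (2 * π * I * (x * τ)) ≠ 1 := by simpa using hnl.cexp_ne_one 0
  have hn1 : ‖cexp (2 * π * I * (x * τ))‖ ≤ s := by
    rw [norm_cexp_two_pi, him, hs, Real.exp_le_exp]
    nlinarith [mul_pos hπ hx0]
  have hcot : ‖piCot (x * τ)‖ ≤ π + 2 * π * (s / (1 - s)) := by
    rw [piCot_eq_add hE]
    refine (norm_sub_le _ _).trans ?_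
    have h2 := norm_div_one_sub_le hn1 le_rfl hs1
    have h3 : ‖(2 * π * I : ℂ)‖ = 2 * π := by simp [abs_of_pos hπ]
    rw [norm_neg, norm_mul, norm_mul (2 * π * I : ℂ), h3, norm_I, mul_one, Complex.norm_real,
      Real.norm_of_nonneg hπ.le]
    gcongr
  have hrow : ∀ m : ℕ, ‖2 * π * I * rowPair τ (x * τ) (m + 1)‖ ≤ 2 * π * (2 / (1 - r)) * r ^ m := by
    intro m
    have hrm : r ^ (m + 1) ≤ r := pow_le_of_le_one hr0.le hr1.le m.succ_ne_zero
    have hle : r ^ (m + 1) = Real.exp (-2 * π * (1 - x) * (m + 1)) := by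
      rw [hr, ← Real.exp_nat_mul]
      congr 1
      push_cast
      ring
    have hq : ‖nome τ ^ (m + 1)‖ = Real.exp (-2 * π * τ.im * (m + 1)) := by
      rw [norm_pow, norm_nome, ← Real.exp_nat_mul]
      congr 1
      push_cast
      ring
    have hm0 : (0 : ℝ) ≤ m := Nat.cast_nonneg m
    have ha : ‖cexp (2 * π * I * (-(x * τ))) * nome τ ^ (m + 1)‖ ≤ r ^ (m + 1) := by
      rw [norm_mul, hq, norm_cexp_two_pi, Complex.neg_im, him, ← Real.exp_add, hle,
        Real.exp_le_exp]
      have h1 : 0 ≤ π * ((τ.im - 1) * (m + 1 - x)) :=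
        mul_nonneg hπ.le (mul_nonneg (by linarith) (by linarith))
      have h2 : 0 ≤ π * (x * m) := by positivity
      nlinarith
    have hb : ‖cexp (2 * π * I * (x * τ)) * nome τ ^ (m + 1)‖ ≤ r ^ (m + 1) := by
      rw [norm_mul, hq, norm_cexp_two_pi, him, ← Real.exp_add, hle, Real.exp_le_exp]
      have h1 : 0 ≤ π * ((τ.im - 1) * (m + 1)) :=
        mul_nonneg hπ.le (mul_nonneg (by linarith) (by linarith))
      have h2 : 0 ≤ π * (x * (m + 1)) := by positivity
      have h3 : 0 ≤ π * (x * τ.im) := by have := τ.im_pos; positivity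
      nlinarith
    have h3 : ‖(2 * π * I : ℂ)‖ = 2 * π := by simp [abs_of_pos hπ]
    rw [norm_mul, h3, rowPair, mul_assoc (2 * π) (2 / (1 - r))]
    refine mul_le_mul_of_nonneg_left ?_ Real.two_pi_pos.le
    refine (norm_sub_le _ _).trans ((add_le_add (norm_div_one_sub_le ha hrm hr1)
      (norm_div_one_sub_le hb hrm hr1)).trans ?_)
    have h4 : 0 < 1 - r := by linarith
    rw [← add_div, div_mul_eq_mul_div, div_le_div_iff_of_pos_right h4, pow_succ]
    nlinarith [pow_pos hr0 m]
  refine (norm_add_le _ _).trans (add_le_add hcot ((norm_sum_le _ _).trans ?_))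
  refine (Finset.sum_le_sum fun m _ => hrow m).trans ?_
  rw [← Finset.mul_sum]
  have h4 : 0 < 1 - r := by linarith
  refine mul_le_mul_of_nonneg_left ?_ (by positivity : 0 ≤ 2 * π * (2 / (1 - r)))
  rw [← tsum_geometric_of_lt_one hr0.le hr1]
  exact (summable_geometric_of_lt_one hr0.le hr1).sum_le_tsum _ fun _ _ => by positivity

lemma exists_norm_weightOne_S_smul_le {p : ℕ} [NeZero p] {h : ZMod p → ℂ} (hh : h.Odd) :
    ∃ B : ℝ, ∀ τ : ℍ, 1 ≤ τ.im → ‖weightOne h (ModularGroup.S • τ)‖ ≤ B * ‖(τ : ℂ)‖ := by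
  have h1 : ∀ b : ZMod p, ∃ B : ℝ, ∀ τ : ℍ, 1 ≤ τ.im → ‖fourierWeight h b *
      (eisZeta τ ((b.val / p : ℝ) * τ) + 2 * π * I * (b.val / p : ℝ))‖ ≤ B := by
    intro b
    rcases eq_or_ne b 0 with rfl | hb
    · exact ⟨0, fun τ _ => by simp [fourierWeight_zero hh]⟩
    have hp : (0 : ℝ) < p := Nat.cast_pos.mpr (NeZero.pos p)
    have hb0 : (0 : ℝ) < b.val := Nat.cast_pos.mpr (Nat.pos_of_ne_zero fun h0 => hb
      ((ZMod.val_eq_zero b).mp h0))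
    obtain ⟨B, hB⟩ := exists_norm_eisZeta_mul_le (x := b.val / p) (by positivity)
      ((div_lt_one hp).mpr (Nat.cast_lt.mpr (ZMod.val_lt b)))
    refine ⟨‖fourierWeight h b‖ * (B + ‖2 * π * I * (b.val / p : ℝ)‖), fun τ hτ => ?_⟩
    rw [norm_mul]
    gcongr
    exact (norm_add_le _ _).trans (by gcongr; exact hB τ hτ)
  choose B hB using h1
  refine ⟨∑ b, B b, fun τ hτ => ?_⟩
  rw [weightOne_S_smul, norm_mul, mul_comm]
  gcongr
  exact (norm_sum_le _ _).trans (Finset.sum_le_sum fun b _ => hB b τ hτ)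

end CoreConv

/-! ### The product of Eisenstein series as an eta quotient. -/

namespace CoreConv

open UpperHalfPlane hiding I
open Complex Filter Topology Real PowerSeries
open scoped MatrixGroups Manifold

lemma eq_const_of_Gamma0_invariant {N : ℕ} [NeZero N] {f : ℍ → ℂ} (hol : MDiff f)
    (hinv : ∀ γ ∈ CongruenceSubgroup.Gamma0 N, ∀ τ, f (γ • τ) = f τ)
    (hbdd : ∀ γ : SL(2, ℤ), IsBoundedAtImInfty fun τ => f (γ • τ)) :
    ∃ c, f = Function.const ℍ c := by
  let F : ModularForm (CongruenceSubgroup.Gamma0 N) 0 :=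
    { toFun := f
      slash_action_eq' := by
        rintro _ ⟨γ, hγ, rfl⟩
        ext τ
        have h := ModularForm.SL_slash_apply (k := 0) f γ τ
        rw [neg_zero, zpow_zero, mul_one, hinv γ hγ] at h
        exact h
      holo' := hol
      bdd_at_cusps' := fun hc => by
        rw [Subgroup.IsArithmetic.isCusp_iff_isCusp_SL2Z] at hc
        rw [OnePoint.isBoundedAt_iff_forall_SL2Z hc]
        intro γ _
        convert! hbdd γ using 1
        ext τ
        rw [ModularForm.SL_slash_apply, neg_zero, zpow_zero, mul_one] }
  exact ModularForm.eq_const_of_weight_zero F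

/-- Multiplication of a point of the upper half plane by a positive real number. -/
noncomputable def dilate (r : ℝ) (hr : 0 < r) (τ : ℍ) : ℍ :=
  ⟨r * τ, by rw [Complex.im_ofReal_mul]; exact mul_pos hr τ.im_pos⟩

lemma coe_dilate (r : ℝ) (hr : 0 < r) (τ : ℍ) : (dilate r hr τ : ℂ) = r * τ := rfl

lemma discriminant_smul (γ : SL(2, ℤ)) (τ : ℍ) :
    ModularForm.discriminant (γ • τ) = denom γ τ ^ 12 * ModularForm.discriminant τ := by
  have hγ : Matrix.SpecialLinearGroup.mapGL ℝ γ ∈ 𝒮ℒ := ⟨γ, rfl⟩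
  have h := SlashInvariantForm.slash_action_eqn'' CuspForm.discriminant hγ τ
  exact_mod_cast h

lemma discriminant_eq_nome (τ : ℍ) :
    ModularForm.discriminant τ = nome τ * evalAt (pentagonalSeries ℂ) (nome τ) ^ 24 := by
  have h1 : Function.Periodic.qParam 1 τ = nome τ := by simp [Function.Periodic.qParam, nome]
  rw [ModularForm.discriminant_eq_q_prod, evalAt_pentagonalSeries (norm_nome_lt_one τ)]
  simp only [ModularForm.eta_q, h1]
  rw [(ModularForm.multipliable_one_sub_pow (norm_nome_lt_one τ)).tprod_pow]

lemma nome_dilate_natCast (n : ℕ) (hn : (0 : ℝ) < n) (τ : ℍ) :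
    nome (dilate n hn τ) = nome τ ^ n := by
  rw [nome, nome, ← Complex.exp_nat_mul, coe_dilate, ofReal_natCast]
  congr 1
  ring

lemma tendsto_nome : Tendsto nome atImInfty (𝓝 0) := by
  have := qParam_tendsto_atImInfty one_pos
  refine this.congr fun τ => ?_
  simp [Function.Periodic.qParam, nome]

lemma exists_nome_eq {q : ℂ} (hq0 : q ≠ 0) (hq : ‖q‖ < 1) : ∃ τ : ℍ, nome τ = q := by
  refine ⟨⟨_, Function.Periodic.im_invQParam_pos_of_norm_lt_one one_pos hq hq0⟩, ?_⟩
  refine Eq.trans ?_ (Function.Periodic.qParam_right_inv one_ne_zero hq0)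
  simp [Function.Periodic.qParam, nome]

section Quotient

variable {p : ℕ} [Fact p.Prime]

lemma natCast_prime_pos : (0 : ℝ) < p := Nat.cast_pos.mpr (Fact.out : p.Prime).pos

/-- Conjugation by diag(p, 1) carries Γ₀(p) into SL₂(ℤ), the lower left entry being divisible by p.
-/
lemma dilate_smul {γ : SL(2, ℤ)} (hγ : γ ∈ CongruenceSubgroup.Gamma0 p) (τ : ℍ) :
    ∃ γ' : SL(2, ℤ), dilate p natCast_prime_pos (γ • τ) = γ' • dilate p natCast_prime_pos τ ∧
      denom γ' (dilate p natCast_prime_pos τ) = denom γ τ := by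
  obtain ⟨k, hk⟩ := (ZMod.intCast_zmod_eq_zero_iff_dvd _ p).mp (CongruenceSubgroup.Gamma0_mem.mp hγ)
  have hdet := γ.2
  rw [Matrix.det_fin_two] at hdet
  have hk' : γ.1 1 0 = p * k := hk
  let γ' : SL(2, ℤ) := ⟨!![γ.1 0 0, p * γ.1 0 1; k, γ.1 1 1], by
    rw [Matrix.det_fin_two_of]
    rw [hk'] at hdet
    linear_combination hdet⟩
  have h00 : γ' 0 0 = γ 0 0 := rfl
  have h01 : γ' 0 1 = p * γ 0 1 := rfl
  have h10 : γ' 1 0 = k := rfl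
  have h11 : γ' 1 1 = γ 1 1 := rfl
  refine ⟨γ', ?_, ?_⟩
  · apply UpperHalfPlane.ext
    rw [coe_dilate, coe_specialLinearGroup_apply, coe_specialLinearGroup_apply, coe_dilate, h00,
      h01, h10, h11, hk, mul_div_assoc']
    congr 1
    · push_cast
      simp only [eq_intCast, ofReal_intCast]
      ring
    · simp only [eq_intCast, Int.cast_mul, Int.cast_natCast, ofReal_mul, ofReal_natCast,
        ofReal_intCast]
      ring
  · rw [ModularGroup.denom_apply, ModularGroup.denom_apply, coe_dilate, h10, h11, hk]
    push_cast
    ring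

/-- The product of the `weightOne` forms over all the dilations of `h`. -/
noncomputable def normForm (h : ZMod p → ℂ) (τ : ℍ) : ℂ :=
  ∏ u : (ZMod p)ˣ, weightOne (fun c => h ((u : ZMod p) * c)) τ

/-- The modular function whose constancy is to be shown. -/
noncomputable def quotForm (h : ZMod p → ℂ) (τ : ℍ) : ℂ :=
  normForm h τ ^ 12 * ModularForm.discriminant τ /
    ModularForm.discriminant (dilate p natCast_prime_pos τ) ^ p

lemma odd_dilation {h : ZMod p → ℂ} (hh : h.Odd) (u : ZMod p) :
    Function.Odd fun c => h (u * c) := fun c => by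
  beta_reduce
  rw [mul_neg, hh]

lemma card_units_add_one : Fintype.card (ZMod p)ˣ + 1 = p := by
  rw [ZMod.card_units_eq_totient, Nat.totient_prime Fact.out]
  exact Nat.succ_pred_prime Fact.out

/-- The lower right entry of γ is a unit mod p, and multiplication by it permutes the factors. -/
lemma normForm_smul {h : ZMod p → ℂ} (hh : h.Odd) {γ : SL(2, ℤ)}
    (hγ : γ ∈ CongruenceSubgroup.Gamma0 p) (τ : ℍ) :
    normForm h (γ • τ) = denom γ τ ^ Fintype.card (ZMod p)ˣ * normForm h τ := by
  have h0 : ((γ 1 0 : ℤ) : ZMod p) = 0 := CongruenceSubgroup.Gamma0_mem.mp hγ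
  have hdet : ((γ 0 0 : ℤ) : ZMod p) * (γ 1 1 : ℤ) = 1 := by
    have hdet := γ.2
    rw [Matrix.det_fin_two] at hdet
    have := congrArg (Int.cast : ℤ → ZMod p) hdet
    push_cast at this
    rw [h0, mul_zero, sub_zero] at this
    exact this
  let v : (ZMod p)ˣ := ⟨(γ 1 1 : ℤ), (γ 0 0 : ℤ), by rw [mul_comm]; exact hdet, hdet⟩
  rw [normForm, normForm]
  simp_rw [fun u : (ZMod p)ˣ => weightOne_smul (odd_dilation hh u) h0 (u := v) rfl τ]
  rw [Finset.prod_mul_distrib, Finset.prod_const, Finset.card_univ]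
  congr 1
  refine Fintype.prod_equiv (Equiv.mulRight v) _ _ fun u => ?_
  rw [Equiv.coe_mulRight, Units.val_mul]
  simp_rw [mul_assoc]

/-- The weights cancel: 12(p - 1) + 12 = 12p. -/
lemma quotForm_smul {h : ZMod p → ℂ} (hh : h.Odd) {γ : SL(2, ℤ)}
    (hγ : γ ∈ CongruenceSubgroup.Gamma0 p) (τ : ℍ) : quotForm h (γ • τ) = quotForm h τ := by
  obtain ⟨γ', h1, h2⟩ := dilate_smul hγ τ
  have hd : denom γ τ ≠ 0 := denom_ne_zero γ τ
  have hΔ := ModularForm.discriminant_ne_zero (dilate p natCast_prime_pos τ)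
  rw [quotForm, quotForm, h1, discriminant_smul γ, discriminant_smul γ', h2, normForm_smul hh hγ,
    div_eq_div_iff (pow_ne_zero _ (mul_ne_zero (pow_ne_zero _ hd) hΔ)) (pow_ne_zero _ hΔ)]
  have h3 : (denom γ τ ^ 12) ^ p = (denom γ τ ^ Fintype.card (ZMod p)ˣ) ^ 12 * denom γ τ ^ 12 := by
    rw [← pow_mul, ← pow_mul, ← pow_add, mul_comm _ 12, ← Nat.mul_succ, Nat.succ_eq_add_one,
      card_units_add_one]
  rw [mul_pow, mul_pow, h3]
  ring

lemma evalAt_zero (P : ℂ⟦X⟧) : evalAt P 0 = coeff 0 P := by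
  rw [evalAt, tsum_eq_single 0 fun n hn => by simp [hn]]
  simp

lemma coeff_zero_pentagonalSeries : coeff 0 (pentagonalSeries ℂ) = 1 := by
  rw [← evalAt_zero, evalAt_pentagonalSeries (by simp)]
  simp

/-- For every matrix outside `Γ₀(p)`, the value at `γ τ` is controlled by the cusp `0`. -/
lemma exists_eq_mul_S_mul_T_zpow {γ : SL(2, ℤ)} (hγ : γ ∉ CongruenceSubgroup.Gamma0 p) :
    ∃ γ₀ ∈ CongruenceSubgroup.Gamma0 p, ∃ j : ℤ, γ = γ₀ * (ModularGroup.S * ModularGroup.T ^ j) := by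
  have hc : ((γ 1 0 : ℤ) : ZMod p) ≠ 0 := fun h => hγ (CongruenceSubgroup.Gamma0_mem.mpr h)
  obtain ⟨j, hj⟩ := ZMod.intCast_surjective (((γ 1 0 : ℤ) : ZMod p)⁻¹ * ((γ 1 1 : ℤ) : ZMod p))
  refine ⟨γ * (ModularGroup.S * ModularGroup.T ^ j)⁻¹, ?_, j, by group⟩
  rw [CongruenceSubgroup.Gamma0_mem]
  have h1 : (γ * (ModularGroup.S * ModularGroup.T ^ j)⁻¹) 1 0 = γ 1 0 * j - γ 1 1 := by
    rw [mul_inv_rev, ← zpow_neg, ← mul_assoc]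
    simp only [Matrix.SpecialLinearGroup.coe_mul, ModularGroup.coe_T_zpow, ModularGroup.coe_S,
      Matrix.SpecialLinearGroup.coe_inv, Matrix.adjugate_fin_two_of]
    simp [Matrix.mul_apply, Fin.sum_univ_two]
    ring
  rw [h1]
  push_cast
  rw [hj, mul_inv_cancel_left₀ hc, sub_self]

lemma exists_norm_normForm_S_smul_le {h : ZMod p → ℂ} (hh : h.Odd) :
    ∃ B : ℝ, ∀ τ : ℍ, 1 ≤ τ.im → ‖normForm h (ModularGroup.S • τ)‖ ≤
      B * ‖(τ : ℂ)‖ ^ Fintype.card (ZMod p)ˣ := by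
  choose B hB using fun u : (ZMod p)ˣ =>
    exists_norm_weightOne_S_smul_le (odd_dilation hh (u : ZMod p))
  refine ⟨∏ u, B u, fun τ hτ => ?_⟩
  rw [normForm, norm_prod, ← Finset.card_univ, ← Finset.prod_const, ← Finset.prod_mul_distrib]
  exact Finset.prod_le_prod (fun _ _ => norm_nonneg _) fun u _ => hB u τ hτ

lemma dilate_S_smul (τ : ℍ) : dilate p natCast_prime_pos (ModularGroup.S • τ) =
    ModularGroup.S • dilate (p : ℝ)⁻¹ (inv_pos.mpr natCast_prime_pos) τ := by
  apply UpperHalfPlane.ext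
  rw [coe_dilate, modular_S_smul, modular_S_smul]
  simp only [coe_dilate]
  push_cast
  rw [← mul_neg, mul_inv, inv_inv]

/-- At Sτ the discriminants become Δ(τ)/Δ(τ/p)^p up to powers of τ and p. In w = e(τ/p) both have
leading power w^p, so the ratio tends to 1, and the powers of τ absorb the growth of `normForm`. -/
lemma quotForm_S_smul_bounded {h : ZMod p → ℂ} (hh : h.Odd) :
    ∃ M A : ℝ, ∀ τ : ℍ, A ≤ τ.im → ‖quotForm h (ModularGroup.S • τ)‖ ≤ M := by
  have hp0 : (p : ℂ) ≠ 0 := Nat.cast_ne_zero.mpr (Fact.out : p.Prime).ne_zero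
  obtain ⟨B, hB⟩ := exists_norm_normForm_S_smul_le hh
  set D := dilate (p : ℝ)⁻¹ (inv_pos.mpr natCast_prime_pos) with hD
  have hDD : ∀ τ, dilate p natCast_prime_pos (D τ) = τ := fun τ => by
    apply UpperHalfPlane.ext
    rw [coe_dilate, hD, coe_dilate]
    push_cast
    rw [mul_inv_cancel_left₀ hp0]
  set A := evalAt (pentagonalSeries ℂ) with hA
  have hlim : Tendsto (fun w => A (w ^ p) ^ 24 / (A w ^ 24) ^ p) (𝓝 0) (𝓝 1) := by
    have h1 : Tendsto A (𝓝 0) (𝓝 1) := by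
      have := tendsto_evalAt_zero convDisc_pentagonalSeries
      rwa [coeff_zero_pentagonalSeries] at this
    have h2 : Tendsto (fun w : ℂ => w ^ p) (𝓝 0) (𝓝 0) := by
      have := (continuous_pow (M := ℂ) p).tendsto 0
      rwa [zero_pow (Fact.out : p.Prime).ne_zero] at this
    have h3 := ((h1.comp h2).pow 24).div ((h1.pow 24).pow p) (by simp)
    rw [one_pow, one_pow, div_one] at h3
    exact h3
  have hev := (hlim.norm.eventually_le_const (u := 2) (by norm_num))
  have hnome : Tendsto (fun τ => nome (D τ)) atImInfty (𝓝 0) := by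
    refine tendsto_nome.comp (tendsto_comap_iff.mpr ?_)
    have : Tendsto (fun τ : ℍ => (p : ℝ)⁻¹ * τ.im) atImInfty atTop :=
      tendsto_comap.const_mul_atTop (inv_pos.mpr natCast_prime_pos)
    refine this.congr fun τ => ?_
    exact (Complex.im_ofReal_mul _ _).symm
  obtain ⟨A₀, hA₀⟩ := atImInfty_mem _ |>.mp (hnome.eventually hev)
  refine ⟨B ^ 12 * ((p : ℝ) ^ 12) ^ p * 2, max 1 A₀, fun τ hτ => ?_⟩
  have h1 := hB τ ((le_max_left _ _).trans hτ)
  have h2 : ‖A (nome (D τ) ^ p) ^ 24 / (A (nome (D τ)) ^ 24) ^ p‖ ≤ 2 :=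
    hA₀ τ ((le_max_right _ _).trans hτ)
  have hτ0 : (τ : ℂ) ≠ 0 := τ.ne_zero
  have hn : nome τ = nome (D τ) ^ p := by
    conv_lhs => rw [← hDD τ]
    exact nome_dilate_natCast p natCast_prime_pos _
  have hA0 : A (nome (D τ)) ≠ 0 := by
    have := ModularForm.discriminant_ne_zero (D τ)
    rw [discriminant_eq_nome] at this
    exact fun h => this (by rw [← hA, h]; simp)
  have hn0 := nome_ne_zero (D τ)
  have h3 : quotForm h (ModularGroup.S • τ) =
      (normForm h (ModularGroup.S • τ) / (τ : ℂ) ^ Fintype.card (ZMod p)ˣ) ^ 12 *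
        ((p : ℂ) ^ 12) ^ p * (A (nome (D τ) ^ p) ^ 24 / (A (nome (D τ)) ^ 24) ^ p) := by
    have h4 : ((τ : ℂ) ^ 12) ^ p =
        ((τ : ℂ) ^ Fintype.card (ZMod p)ˣ) ^ 12 * (τ : ℂ) ^ 12 := by
      rw [← pow_mul, ← pow_mul, ← pow_add, mul_comm _ 12, ← Nat.mul_succ, Nat.succ_eq_add_one,
        card_units_add_one]
    rw [quotForm, dilate_S_smul, discriminant_smul, discriminant_smul, ModularGroup.denom_S,
      ModularGroup.denom_S, ← hD, discriminant_eq_nome, discriminant_eq_nome, ← hA, hn]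
    rw [show ((D τ : ℍ) : ℂ) = (p : ℂ)⁻¹ * τ by rw [hD, coe_dilate]; push_cast; rfl]
    simp only [mul_pow, inv_pow, div_pow]
    rw [h4]
    field_simp
  rw [h3, norm_mul, norm_mul, norm_pow, norm_pow, norm_pow, Complex.norm_natCast]
  have h5 : ‖normForm h (ModularGroup.S • τ) / (τ : ℂ) ^ Fintype.card (ZMod p)ˣ‖ ≤ B := by
    rw [norm_div, norm_pow, div_le_iff₀ (by positivity)]
    exact h1
  gcongr

/-- If the product of the weight one Eisenstein series vanishes to the maximal order at the cusp
`∞`, then it is an eta quotient. -/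
theorem pow_mul_pow_pentagonalSeries_eq {h : ZMod p → ℂ} (hh : h.Odd) {m : ℕ} {V : ℂ⟦X⟧}
    (hV : ∏ u : (ZMod p)ˣ, weightOneSeries (fun c => h ((u : ZMod p) * c)) = X ^ m * V)
    (hm : 12 * m + 1 = p ^ 2) (hV0 : coeff 0 V ^ 12 = 1) :
    V ^ 12 * pentagonalSeries ℂ ^ 24 =
      (expand p (Fact.out : p.Prime).ne_zero (pentagonalSeries ℂ) ^ 24) ^ p := by
  have hp0 : p ≠ 0 := (Fact.out : p.Prime).ne_zero
  have hVc : ConvDisc V := by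
    refine ConvDisc.of_X_pow_mul (k := m) ?_
    rw [← hV]
    exact ConvDisc.prod _ fun _ _ => convDisc_weightOneSeries _
  have hAc := convDisc_pentagonalSeries
  set A := pentagonalSeries ℂ with hA
  have hL : ConvDisc (V ^ 12 * A ^ 24) := (hVc.pow 12).mul (hAc.pow 24)
  have hR : ConvDisc ((expand p hp0 A ^ 24) ^ p) := ((hAc.expand p hp0).pow 24).pow p
  have hquot : ∀ τ, quotForm h τ = evalAt (V ^ 12 * A ^ 24) (nome τ) /
      evalAt ((expand p hp0 A ^ 24) ^ p) (nome τ) := by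
    intro τ
    have hq := norm_nome_lt_one τ
    have hq0 := nome_ne_zero τ
    have hn : normForm h τ = nome τ ^ m * evalAt V (nome τ) := by
      rw [normForm, ← evalAt_X_pow, ← evalAt_mul (convDisc_X_pow m) hVc hq, ← hV,
        evalAt_prod _ (fun _ _ => convDisc_weightOneSeries _) hq]
      exact Finset.prod_congr rfl fun u _ => weightOne_eq_evalAt (odd_dilation hh _) τ
    rw [quotForm, hn, discriminant_eq_nome, discriminant_eq_nome, nome_dilate_natCast,
      evalAt_mul (hVc.pow 12) (hAc.pow 24) hq, evalAt_pow hVc _ hq, evalAt_pow hAc _ hq,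
      evalAt_pow ((hAc.expand p hp0).pow 24) _ hq, evalAt_pow (hAc.expand p hp0) _ hq,
      evalAt_expand, ← hA]
    -- Maximal vanishing enters here: 12m + 1 = p² makes the powers of q in numerator and
    -- denominator agree.
    have h1 : (nome τ ^ p) ^ p = (nome τ ^ m) ^ 12 * nome τ := by
      rw [← pow_mul, ← pow_mul, ← sq, ← hm, pow_succ, mul_comm m]
    rw [mul_pow (nome τ ^ p), h1, mul_pow]
    field_simp
  have hR0 : ∀ τ, evalAt ((expand p hp0 A ^ 24) ^ p) (nome τ) ≠ 0 := by
    intro τ h0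
    have hq := norm_nome_lt_one τ
    have := ModularForm.discriminant_ne_zero (dilate p natCast_prime_pos τ)
    rw [discriminant_eq_nome, nome_dilate_natCast] at this
    rw [evalAt_pow ((hAc.expand p hp0).pow 24) _ hq, evalAt_pow (hAc.expand p hp0) _ hq,
      evalAt_expand] at h0
    exact this (by rw [pow_eq_zero_iff hp0] at h0; rw [h0, mul_zero])
  have hlim : Tendsto (quotForm h) atImInfty (𝓝 1) := by
    have h1 : Tendsto (fun q => evalAt (V ^ 12 * A ^ 24) q / evalAt ((expand p hp0 A ^ 24) ^ p) q)
        (𝓝 0) (𝓝 1) := by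
      have hA1 : constantCoeff A = 1 := by
        rw [← coeff_zero_eq_constantCoeff_apply, coeff_zero_pentagonalSeries]
      have hV1 : constantCoeff V ^ 12 = 1 := by
        rw [← coeff_zero_eq_constantCoeff_apply, hV0]
      have h2 := tendsto_evalAt_zero hL
      have h3 := tendsto_evalAt_zero hR
      rw [coeff_zero_eq_constantCoeff_apply, map_mul, map_pow, map_pow, hA1, hV1, one_pow,
        mul_one] at h2
      rw [coeff_zero_eq_constantCoeff_apply, map_pow, map_pow, constantCoeff_expand, hA1, one_pow,
        one_pow] at h3
      have h4 := h2.div h3 one_ne_zero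
      rw [div_one] at h4
      exact h4
    exact (h1.comp tendsto_nome).congr fun τ => (hquot τ).symm
  have hol : MDiff (quotForm h) := by
    rw [UpperHalfPlane.mdifferentiable_iff]
    have h1 : ∀ P : ℂ⟦X⟧, ConvDisc P → DifferentiableOn ℂ
        (fun z : ℂ => evalAt P (cexp (2 * π * I * z))) {z | 0 < z.im} := by
      intro P hP
      refine (differentiableOn_evalAt hP).comp (by fun_prop) fun z hz => ?_
      rw [mem_ball_zero_iff]
      exact norm_nome_lt_one ⟨z, hz⟩
    refine ((h1 _ hL).div (h1 _ hR) fun z hz => hR0 ⟨z, hz⟩).congr fun z hz => ?_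
    rw [Function.comp_apply, hquot, ofComplex_apply_of_im_pos hz]
    rfl
  -- There are only two cusps. Matrices in Γ₀(p) leave the limit 1 at ∞; all others reduce to the
  -- bound at 0, the translation T^j leaving the imaginary part unchanged.
  obtain ⟨c, hc⟩ := eq_const_of_Gamma0_invariant (N := p) hol (fun γ hγ τ => quotForm_smul hh hγ τ)
    fun γ => by
      by_cases hγ : γ ∈ CongruenceSubgroup.Gamma0 p
      · have : (fun τ => quotForm h (γ • τ)) = quotForm h := funext fun τ => quotForm_smul hh hγ τ
        rw [this]
        exact hlim.isBigO_one ℝ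
      · obtain ⟨γ₀, hγ₀, j, rfl⟩ := exists_eq_mul_S_mul_T_zpow hγ
        obtain ⟨M, A, hMA⟩ := quotForm_S_smul_bounded hh
        refine isBoundedAtImInfty_iff.mpr ⟨M, A, fun τ hτ => ?_⟩
        rw [mul_smul, quotForm_smul hh hγ₀, mul_smul]
        refine hMA _ ?_
        rw [modular_T_zpow_smul, vadd_im]
        exact hτ
  have hc1 : c = 1 := by
    rw [hc] at hlim
    exact tendsto_nhds_unique tendsto_const_nhds hlim
  refine eq_of_evalAt_eq hL hR fun q hq0 hq => ?_
  obtain ⟨τ, rfl⟩ := exists_nome_eq hq0 hq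
  have h1 := hquot τ
  rw [hc, Function.const_apply, hc1, eq_comm, div_eq_one_iff_eq (hR0 τ)] at h1
  exact h1

end Quotient

end CoreConv

/-! ### The value at 0 of the L-function of an odd function. -/

namespace CoreConv

open Complex Filter Topology Real Asymptotics Set

section LValue

variable {p : ℕ} [NeZero p]

/-- The function `∑_{n ≥ 1} h(n) e^{-nt}`, in closed form. -/
noncomputable def expSeries (h : ZMod p → ℂ) (t : ℝ) : ℂ :=
  (∑ c : ZMod p, h c * (rexp (-c.val * t) : ℂ)) / ((1 - rexp (-p * t) : ℝ) : ℂ)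

lemma natCast_pos_of_neZero : (0 : ℝ) < p := Nat.cast_pos.mpr (NeZero.pos p)

lemma one_sub_exp_ne_zero {t : ℝ} (ht : 0 < t) : 1 - rexp (-p * t) ≠ 0 := by
  have : rexp (-p * t) < 1 := by
    rw [Real.exp_lt_one_iff, neg_mul, neg_lt_zero]
    exact mul_pos natCast_pos_of_neZero ht
  linarith

lemma hasSum_expSeries (h : ZMod p → ℂ) {t : ℝ} (ht : 0 < t) :
    HasSum (fun n : ℕ => h n * (rexp (-(n : ℝ) * t) : ℂ)) (expSeries h t) := by
  have hx : ∀ n : ℕ, (rexp (-(n : ℝ) * t) : ℂ) = (rexp (-t) : ℂ) ^ n := by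
    intro n
    rw [← ofReal_pow, ← Real.exp_nat_mul]
    congr 2
    ring
  have hx1 : ‖(rexp (-t) : ℂ)‖ < 1 := by
    rw [Complex.norm_real, Real.norm_of_nonneg (Real.exp_nonneg _), Real.exp_lt_one_iff]
    linarith
  have hs : Summable fun n : ℕ => h n * (rexp (-(n : ℝ) * t) : ℂ) := by
    simp_rw [hx]
    refine Summable.of_norm_bounded
      ((summable_geometric_of_lt_one (norm_nonneg _) hx1).mul_left (∑ c, ‖h c‖)) fun n => ?_
    rw [norm_mul, norm_pow]
    gcongr
    exact norm_le_sum_norm h n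
  have h1 := hs.sum_add_tsum_nat_add p
  have h2 : ∀ n : ℕ, h ((n + p : ℕ) : ZMod p) * (rexp (-((n + p : ℕ) : ℝ) * t) : ℂ) =
      (rexp (-p * t) : ℂ) * (h n * (rexp (-(n : ℝ) * t) : ℂ)) := by
    intro n
    rw [hx, hx, hx, pow_add]
    simp
    ring
  simp_rw [h2] at h1
  rw [tsum_mul_left] at h1
  have h3 : expSeries h t = ∑' n : ℕ, h n * (rexp (-(n : ℝ) * t) : ℂ) := by
    rw [expSeries, div_eq_iff (ofReal_ne_zero.mpr (one_sub_exp_ne_zero ht)),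
      sum_zmod_eq_sum_range (fun c : ZMod p => h c * (rexp (-c.val * t) : ℂ))]
    rw [Finset.sum_congr rfl fun c hc => by
      rw [ZMod.val_cast_of_lt (Finset.mem_range.mp hc)]]
    push_cast at h1 ⊢
    linear_combination h1
  rw [h3]
  exact hs.hasSum

/-- `expSeries h` with its value at `t = 0` subtracted. -/
noncomputable def expSeriesSub (h : ZMod p → ℂ) (t : ℝ) : ℂ :=
  expSeries h t - (∑ c, sawtooth c * h c) * (rexp (-t) : ℂ)

lemma sum_val_mul_eq {h : ZMod p → ℂ} (hh : h.Odd) :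
    ∑ c : ZMod p, (c.val : ℂ) * h c = -p * ∑ c, sawtooth c * h c := by
  have hp : (p : ℂ) ≠ 0 := NeZero.ne _
  have h1 : ∑ c, h c = 0 := hh.sum_eq_zero
  have h2 : ∀ c : ZMod p, sawtooth c * h c = 1 / 2 * h c - (p : ℂ)⁻¹ * (c.val * h c) := by
    intro c
    rw [sawtooth]
    ring
  simp_rw [h2]
  rw [Finset.sum_sub_distrib, ← Finset.mul_sum, ← Finset.mul_sum, h1]
  field_simp
  ring

lemma isBigO_exp_neg_mul_sub (c : ℝ) :
    (fun t : ℝ => ((rexp (-c * t) - 1 + c * t : ℝ) : ℂ)) =O[𝓝 0] fun t => t ^ 2 := by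
  have h1 := Real.exp_sub_sum_range_isBigO_pow 2
  have h2 : Tendsto (fun t : ℝ => -c * t) (𝓝 0) (𝓝 0) := by
    have := (continuous_const_mul (-c)).tendsto (0 : ℝ)
    rwa [mul_zero] at this
  have h3 := h1.comp_tendsto h2
  refine IsBigO.of_norm_left ?_
  simp_rw [Complex.norm_real]
  refine IsBigO.norm_left ?_
  refine (h3.congr_left fun t => ?_).trans ?_
  · simp [Finset.sum_range_succ]
    ring
  · refine IsBigO.of_bound (c ^ 2) (Eventually.of_forall fun t => ?_)
    simp [mul_pow]

/-- Over the common denominator 1 - e^{-pt}, which is at least t/2 for 0 < t ≤ 1, the numerator is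
O(t²): ∑ h(c) = 0 removes the constant term, and -∑ c h(c) = pG matches the linear term of G
e^{-t}(1 - e^{-pt}). -/
lemma isBigO_expSeriesSub_zero {h : ZMod p → ℂ} (hh : h.Odd) :
    expSeriesSub h =O[𝓝[>] 0] fun t : ℝ => t ^ (-(-1 : ℝ)) := by
  have hp := natCast_pos_of_neZero (p := p)
  have hp1 : (1 : ℝ) ≤ p := Nat.one_le_cast.mpr (NeZero.pos p)
  set G := ∑ c, sawtooth c * h c with hG
  have h1 : (fun t : ℝ => ∑ c : ZMod p, h c * ((rexp (-c.val * t) - 1 + c.val * t : ℝ) : ℂ) -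
      G * (((rexp (-1 * t) - 1 + 1 * t : ℝ) : ℂ) -
        ((rexp (-(p + 1) * t) - 1 + (p + 1) * t : ℝ) : ℂ))) =O[𝓝[>] 0] fun t : ℝ => t ^ 2 := by
    refine IsBigO.mono ?_ nhdsWithin_le_nhds
    exact (IsBigO.fun_sum fun c _ => (isBigO_exp_neg_mul_sub _).const_mul_left _).sub
      (((isBigO_exp_neg_mul_sub _).sub (isBigO_exp_neg_mul_sub _)).const_mul_left _)
  have h2 : (fun t : ℝ => (((1 - rexp (-p * t) : ℝ) : ℂ))⁻¹) =O[𝓝[>] 0] fun t : ℝ => t⁻¹ := by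
    refine IsBigO.of_bound 2 ?_
    filter_upwards [Ioc_mem_nhdsGT (zero_lt_one' ℝ)] with t ht
    have h3 : 0 < 1 + p * t := by have := ht.1; positivity
    have h4 : rexp (-p * t) ≤ (1 + p * t)⁻¹ := by
      rw [neg_mul, Real.exp_neg]
      gcongr
      linarith [Real.add_one_le_exp (p * t)]
    have h5 : t / 2 ≤ 1 - rexp (-p * t) := by
      refine le_trans ?_ (sub_le_sub_left h4 1)
      rw [← one_div, le_sub_iff_add_le, div_add_div _ _ two_ne_zero h3.ne',
        div_le_one (by positivity)]
      nlinarith [ht.1, ht.2, mul_pos hp ht.1, mul_le_mul_of_nonneg_left ht.2 (mul_pos hp ht.1).le]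
    have h6 : 0 < t / 2 := half_pos ht.1
    rw [norm_inv, Complex.norm_real, Real.norm_of_nonneg (h6.le.trans h5), norm_inv,
      Real.norm_of_nonneg ht.1.le, ← div_eq_mul_inv, inv_le_comm₀ (h6.trans_le h5) (by
        have := ht.1; positivity), inv_div]
    exact h5
  have h7 := h1.mul h2
  refine (h7.congr' ?_ ?_)
  · filter_upwards [self_mem_nhdsWithin] with t ht
    have h8 : ((1 - rexp (-p * t) : ℝ) : ℂ) ≠ 0 := ofReal_ne_zero.mpr (one_sub_exp_ne_zero ht)
    have h9 : ∑ c : ZMod p, h c * ((rexp (-c.val * t) - 1 + c.val * t : ℝ) : ℂ) =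
        ∑ c : ZMod p, h c * (rexp (-c.val * t) : ℂ) - p * G * t := by
      have h10 : ∀ c : ZMod p, h c * ((rexp (-c.val * t) - 1 + c.val * t : ℝ) : ℂ) =
          h c * (rexp (-c.val * t) : ℂ) - h c + (c.val * h c) * t := by
        intro c
        push_cast
        ring
      simp_rw [h10]
      rw [Finset.sum_add_distrib, Finset.sum_sub_distrib, ← Finset.sum_mul, sum_val_mul_eq hh,
        hh.sum_eq_zero]
      ring
    have h11 : rexp (-(p + 1) * t) = rexp (-p * t) * rexp (-t) := by
      rw [← Real.exp_add]
      congr 1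
      ring
    rw [h9, expSeriesSub, expSeries, ← hG, h11, neg_one_mul, ← div_eq_mul_inv, div_eq_iff h8,
      sub_mul, div_mul_cancel₀ _ h8]
    push_cast
    ring
  · filter_upwards [self_mem_nhdsWithin] with t ht
    rw [neg_neg, Real.rpow_one]
    have : t ≠ 0 := ne_of_gt ht
    field_simp

lemma isBigO_expSeriesSub_atTop {h : ZMod p → ℂ} (hh : h.Odd) :
    expSeriesSub h =O[atTop] fun t : ℝ => rexp (-1 * t) := by
  have hp := natCast_pos_of_neZero (p := p)
  have h1 : ∀ x : ℝ, 1 ≤ x → (fun t : ℝ => (rexp (-x * t) : ℂ)) =O[atTop]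
      fun t : ℝ => rexp (-1 * t) := by
    intro x hx
    refine IsBigO.of_bound 1 ?_
    filter_upwards [eventually_ge_atTop 0] with t ht
    rw [Complex.norm_real, Real.norm_of_nonneg (Real.exp_nonneg _),
      Real.norm_of_nonneg (Real.exp_nonneg _), one_mul, Real.exp_le_exp]
    nlinarith
  have h2 : (fun t : ℝ => ∑ c : ZMod p, h c * (rexp (-c.val * t) : ℂ)) =O[atTop]
      fun t : ℝ => rexp (-1 * t) := by
    refine IsBigO.fun_sum fun c _ => ?_
    rcases eq_or_ne c 0 with rfl | hc
    · simp only [hh.map_zero, zero_mul]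
      exact isBigO_zero _ _
    · exact (h1 _ (Nat.one_le_cast.mpr (Nat.pos_of_ne_zero fun h0 => hc
        ((ZMod.val_eq_zero c).mp h0)))).const_mul_left _
  have h3 : (fun t : ℝ => (((1 - rexp (-p * t) : ℝ) : ℂ))⁻¹) =O[atTop] fun _ : ℝ => (1 : ℝ) := by
    have h4 : Tendsto (fun t : ℝ => rexp (-p * t)) atTop (𝓝 0) := by
      refine Real.tendsto_exp_atBot.comp ?_
      exact tendsto_id.const_mul_atTop_of_neg (neg_lt_zero.mpr hp)
    have h5 : Tendsto (fun t : ℝ => ((1 - rexp (-p * t) : ℝ) : ℂ)) atTop (𝓝 ((1 - 0 : ℝ) : ℂ)) :=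
      (Complex.continuous_ofReal.tendsto _).comp (h4.const_sub 1)
    exact (h5.inv₀ (by simp)).isBigO_one ℝ
  have h6 := h2.mul h3
  simp_rw [mul_one, ← div_eq_mul_inv] at h6
  refine h6.sub ?_
  have h7 := (h1 1 le_rfl).const_mul_left (∑ c, sawtooth c * h c)
  simpa only [neg_one_mul] using h7

lemma continuousOn_expSeriesSub (h : ZMod p → ℂ) : ContinuousOn (expSeriesSub h) (Ioi 0) := by
  unfold expSeriesSub expSeries
  refine ContinuousOn.sub (ContinuousOn.div ?_ ?_ ?_) ?_
  · fun_prop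
  · fun_prop
  · exact fun t ht => ofReal_ne_zero.mpr (one_sub_exp_ne_zero ht)
  · fun_prop

/-- Subtracting G e^{-t} lowers the coefficient at n = 1 by G, so the associated Dirichlet series is
L(s, h) - G. -/
lemma mellin_expSeriesSub {h : ZMod p → ℂ} (hh : h.Odd) {s : ℂ} (hs : 1 < s.re) :
    mellin (expSeriesSub h) s = Complex.Gamma s * (ZMod.LFunction h s - ∑ c, sawtooth c * h c) := by
  set G := ∑ c, sawtooth c * h c with hG
  set a : ℕ → ℂ := fun n => h n - if n = 1 then G else 0 with ha
  have ha0 : a 0 = 0 := by simp [ha, hh.map_zero]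
  have hs0 : 0 < s.re := by linarith
  have h1 : ∀ t ∈ Ioi (0 : ℝ), HasSum (fun n : ℕ => a n * (rexp (-(n : ℝ) * t) : ℂ))
      (expSeriesSub h t) := by
    intro t ht
    have h2 : HasSum (fun n : ℕ => (if n = 1 then G else 0) * (rexp (-(n : ℝ) * t) : ℂ))
        (G * (rexp (-t) : ℂ)) := by
      convert hasSum_single 1 fun n hn => ?_ using 1
      · simp
      · simp [hn]
    convert! (hasSum_expSeries h ht).sub h2 using 2 with n
    rw [ha]
    ring
  have h2 : ∀ n : ℕ, ‖a n‖ ≤ ∑ c, ‖h c‖ + ‖G‖ := by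
    intro n
    refine (norm_sub_le _ _).trans (add_le_add (norm_le_sum_norm h n) ?_)
    split_ifs <;> simp
  have h3 : Summable fun n : ℕ => ‖a n‖ / (n : ℝ) ^ s.re := by
    refine ((Real.summable_one_div_nat_rpow.mpr hs).mul_left (∑ c, ‖h c‖ + ‖G‖)).of_nonneg_of_le
      (fun n => by positivity) fun n => ?_
    rw [mul_one_div]
    gcongr
    exact h2 n
  have h4 := hasSum_mellin (fun n => ?_) hs0 h1 h3
  · have h5 := (ZMod.LSeriesSummable_of_one_lt_re h hs).hasSum
    have h6 : HasSum (fun n : ℕ => if n = 1 then G else 0) G := hasSum_ite_eq 1 G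
    have h7 := (h5.sub h6).mul_left (Complex.Gamma s)
    rw [ZMod.LFunction_eq_LSeries h hs]
    refine h4.unique ?_
    convert! h7 using 2 with n
    rcases eq_or_ne n 0 with rfl | hn
    · simp [ha0]
    · rw [LSeries.term_of_ne_zero hn, ha, mul_div_assoc]
      beta_reduce
      congr 1
      rw [sub_div, ofReal_natCast]
      congr 1
      split_ifs with h1
      · simp [h1]
      · simp
  · rcases eq_or_ne n 0 with rfl | hn
    · exact .inl ha0
    · exact .inr (Nat.cast_pos.mpr (Nat.pos_of_ne_zero hn))

/-- The value at `s = 0` of the `L`-function of an odd function. -/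
theorem LFunction_zero_of_odd {h : ZMod p → ℂ} (hh : h.Odd) :
    ZMod.LFunction h 0 = ∑ c, sawtooth c * h c := by
  set G := ∑ c, sawtooth c * h c with hG
  -- The decay O(t) at 0 makes the Mellin transform holomorphic for Re s > -1, a half plane that
  -- contains 0.
  set U : Set ℂ := {s | -1 < s.re} with hU
  have hUo : IsOpen U := isOpen_lt continuous_const Complex.continuous_re
  have h1 : DifferentiableOn ℂ (fun s => ZMod.LFunction h s - G) U :=
    ((ZMod.differentiable_LFunction_of_sum_zero hh.sum_eq_zero).sub_const G).differentiableOn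
  have h2 : DifferentiableOn ℂ (fun s => (Complex.Gamma s)⁻¹ * mellin (expSeriesSub h) s) U := by
    refine differentiable_one_div_Gamma.differentiableOn.mul fun s hs => ?_
    exact (mellin_differentiableAt_of_isBigO_rpow_exp one_pos
      ((continuousOn_expSeriesSub h).locallyIntegrableOn measurableSet_Ioi)
      (isBigO_expSeriesSub_atTop hh) (isBigO_expSeriesSub_zero hh) hs).differentiableWithinAt
  have h3 := (h1.analyticOnNhd hUo).eqOn_of_preconnected_of_eventuallyEq
    (h2.analyticOnNhd hUo) (convex_halfSpace_re_gt (-1)).isPreconnected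
    (z₀ := 2) (by simp [hU]; norm_num) ?_
  · have h4 := h3 (show (0 : ℂ) ∈ U by simp [hU])
    -- The convention Γ(0) = 0 gives the inverse the value 0, which is also the value of the entire
    -- function 1/Γ there.
    simp only [Complex.Gamma_zero, inv_zero, zero_mul] at h4
    exact sub_eq_zero.mp h4
  · have h5 : {s : ℂ | 1 < s.re} ∈ 𝓝 (2 : ℂ) :=
      (isOpen_lt continuous_const Complex.continuous_re).mem_nhds (by simp)
    filter_upwards [h5] with s hs
    have hs0 : Complex.Gamma s ≠ 0 := Complex.Gamma_ne_zero_of_re_pos (by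
      have : 1 < s.re := hs
      linarith)
    rw [mellin_expSeriesSub hh hs, inv_mul_cancel_left₀ hs0]

end LValue

end CoreConv

/-! ### Inversion of the L-values and the explicit weights. -/

namespace CoreConv

open PowerSeries

section Ell

variable {p : ℕ} [Fact p.Prime]

lemma isPrimitive_of_odd {χ : DirichletCharacter ℂ p} (hχ : χ.Odd) : χ.IsPrimitive := by
  have h1 : χ ≠ 1 := by
    rintro rfl
    have h2 : (1 : DirichletCharacter ℂ p) (-1) = -1 := hχ
    rw [MulChar.one_apply isUnit_one.neg] at h2
    norm_num at h2
  rw [ne_eq, χ.eq_one_iff_conductor_eq_one] at h1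
  exact ((Nat.dvd_prime Fact.out).mp χ.conductor_dvd_level).resolve_left h1

/-- The hypothesis says that v inverts the sawtooth up to odd symmetrization, and summation against
χ turns the convolution into a product. In particular L(0, χ) ≠ 0. -/
lemma LFunction_char_mul_sum {v : ZMod p → ℂ} (hv0 : v 0 = 0)
    (hv : ∀ d, ∑ c, sawtooth c * v (c * d) =
      ((p : ℂ) - 1) * ((if d = 1 then 1 else 0) - if d = -1 then 1 else 0))
    {χ : DirichletCharacter ℂ p} (hχ : χ.Odd) :
    χ.LFunction 0 * ∑ a, v a * χ a⁻¹ = 2 * ((p : ℂ) - 1) := by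
  have hχ1 : χ (-1) = -1 := hχ
  have hodd : Function.Odd (χ : ZMod p → ℂ) := fun c => by
    rw [← neg_one_mul, map_mul, hχ1, neg_one_mul]
  rw [DirichletCharacter.LFunction, LFunction_zero_of_odd hodd, Finset.sum_mul]
  have h1 : ∀ c : ZMod p, sawtooth c * χ c * ∑ a, v a * χ a⁻¹ =
      ∑ d, χ d⁻¹ * (sawtooth c * v (c * d)) := by
    intro c
    rcases eq_or_ne c 0 with rfl | hc
    · simp [hv0, hodd.map_zero]
    · rw [Finset.mul_sum]
      refine (Fintype.sum_equiv (Equiv.mulLeft₀ c hc) _ _ fun d => ?_).symm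
      change _ * (sawtooth c * v (c * d)) = sawtooth c * χ c * (v (c * d) * χ (c * d)⁻¹)
      rw [mul_inv, map_mul]
      have h2 : χ c * χ c⁻¹ = 1 := by rw [← map_mul, mul_inv_cancel₀ hc, map_one]
      linear_combination (-(sawtooth c * v (c * d) * χ d⁻¹)) * h2
  simp_rw [h1]
  rw [Finset.sum_comm]
  simp_rw [← Finset.mul_sum, hv]
  simp only [mul_sub, mul_ite, mul_one, mul_zero, Finset.sum_sub_distrib, Finset.sum_ite_eq',
    Finset.mem_univ, if_true, inv_one, inv_neg, map_one, hχ1]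
  ring

lemma sum_mul_char_inv_of_even {v : ZMod p → ℂ} (hv : v.Odd) {χ : DirichletCharacter ℂ p}
    (hχ : χ.Even) : ∑ a, v a * χ a⁻¹ = 0 := by
  have h1 : Function.Odd fun a => v a * χ a⁻¹ := fun a => by
    have h2 : χ (-1) = 1 := hχ
    beta_reduce
    rw [hv, inv_neg, ← neg_one_mul a⁻¹, map_mul, h2, one_mul, neg_mul]
  exact h1.sum_eq_zero

/-- For odd χ, 2/L(0, χ) is (p - 1)⁻¹ ∑ v(a) χ(a⁻¹), while for even χ that sum vanishes. Thus ℓ_p is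
a sum over all characters, which orthogonality evaluates. -/
lemma ell_eq {v : ZMod p → ℂ} (hodd : v.Odd)
    (hv : ∀ d, ∑ c, sawtooth c * v (c * d) =
      ((p : ℂ) - 1) * ((if d = 1 then 1 else 0) - if d = -1 then 1 else 0)) (d : ℤ) :
    ell p d = v d := by
  classical
  have hp1 : (p : ℂ) - 1 ≠ 0 := sub_ne_zero.mpr (Nat.cast_ne_one.mpr (Fact.out : p.Prime).ne_one)
  have h0 := hodd.map_zero
  have htot : (p.totient : ℂ) = p - 1 := by
    rw [Nat.totient_prime Fact.out, Nat.cast_sub (Fact.out : p.Prime).one_le, Nat.cast_one]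
  have h1 : ∑ χ : DirichletCharacter ℂ p, (∑ a, v a * χ a⁻¹) * χ (d : ZMod p) =
      ((p : ℂ) - 1) * v d := by
    simp_rw [Finset.sum_mul, mul_assoc]
    rw [Finset.sum_comm]
    simp_rw [← Finset.mul_sum]
    have h2 : ∀ a : ZMod p, v a * ∑ χ : DirichletCharacter ℂ p, χ a⁻¹ * χ (d : ZMod p) =
        if a = d then ((p : ℂ) - 1) * v a else 0 := by
      intro a
      rcases eq_or_ne a 0 with rfl | ha
      · simp [h0]
      · rw [DirichletCharacter.sum_char_inv_mul_char_eq ℂ (isUnit_iff_ne_zero.mpr ha), htot]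
        split_ifs <;> ring
    simp_rw [h2]
    rw [Finset.sum_ite_eq', if_pos (Finset.mem_univ _)]
  have h3 : ell p d * (p - 1) = ((p : ℂ) - 1) * v d := by
    rw [← h1, ell, Finset.sum_filter, Finset.mul_sum, Finset.sum_mul]
    refine Finset.sum_congr rfl fun χ _ => ?_
    rcases χ.even_or_odd with hχ | hχ
    · have h4 : ¬ χ.Odd := fun h => by
        have h5 : χ (-1) = 1 := hχ
        have h6 : χ (-1) = -1 := h
        rw [h5] at h6
        norm_num at h6
      rw [if_neg fun h => h4 h.1, sum_mul_char_inv_of_even hodd hχ]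
      ring
    · rw [if_pos ⟨hχ, isPrimitive_of_odd hχ⟩]
      have h4 := LFunction_char_mul_sum h0 hv hχ
      have h5 : χ.LFunction 0 ≠ 0 := by
        intro h
        rw [h, zero_mul] at h4
        exact mul_ne_zero two_ne_zero hp1 h4.symm
      generalize ∑ a, v a * χ a⁻¹ = S at *
      field_simp
      linear_combination (-χ (d : ZMod p)) * h4
  rw [mul_comm] at h3
  exact mul_left_cancel₀ hp1 h3

end Ell

/-! ### Coefficients of products -/

lemma mem_compositions {m n : ℕ} {r : ℕ → ℕ} : r ∈ compositions m n ↔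
    r ∈ (Finset.Icc 1 m).piAntidiag n ∧ ∀ k ∈ Finset.Icc 1 m, 1 ≤ r k := by
  simp [compositions]

/-- Tuples with some part 0 drop out because the constant terms vanish. -/
lemma sum_compositions_eq_coeff {P : ℕ → ℂ⟦X⟧} (m n : ℕ)
    (hP : ∀ k ∈ Finset.Icc 1 m, coeff 0 (P k) = 0) :
    ∑ r ∈ compositions m n, ∏ k ∈ Finset.Icc 1 m, coeff (r k) (P k) =
      coeff n (∏ k ∈ Finset.Icc 1 m, P k) := by
  rw [coeff_prod, Finset.finsuppAntidiag, Finset.sum_map]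
  refine (Finset.sum_subset (fun r hr => (mem_compositions.mp hr).1) fun r hr hr' => ?_).trans ?_
  · have h1 : ∃ k ∈ Finset.Icc 1 m, r k = 0 := by
      by_contra! h
      exact hr' (mem_compositions.mpr ⟨hr, fun k hk => Nat.one_le_iff_ne_zero.mpr (h k hk)⟩)
    obtain ⟨k, hk, h0⟩ := h1
    exact Finset.prod_eq_zero hk (by rw [h0, hP k hk])
  · rw [← Finset.sum_attach]
    rfl

/-! ### Explicit weights -/

/-- The values of `2 ℓ_p / (p - 1)`. -/
def weightList : ℕ → List ℤ
  | 5 => [0, 3, 1, -1, -3]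
  | 7 => [0, 2, 1, 1, -1, -1, -2]
  | 11 => [0, 1, 1, 1, 0, 1, -1, 0, -1, -1, -1]
  | 13 => [0, 1, 0, 1, 1, 1, 0, 0, -1, -1, -1, 0, -1]
  | 17 => [0, 0, 1, 1, 0, 1, 0, 1, 0, 0, -1, 0, -1, 0, -1, -1, 0]
  | 19 => [0, 0, 0, 1, 1, 1, 0, 1, 0, 0, 0, 0, -1, 0, -1, -1, -1, 0, 0]
  | _ => []

/-- The value of `2 ℓ_p / (p - 1)` at a residue. -/
def weightAt (p c : ℕ) : ℤ := (weightList p).getD c 0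

/-- The entry `a_{k,p}` as a natural number. -/
def repNat (p k : ℕ) : ℕ := (repList p).getD (k - 1) 0

/-- The order of vanishing at the cusp `∞` of the series attached to `a_{k,p}`. -/
def orderList : ℕ → List ℕ
  | 5 => [0, 1]
  | 7 => [0, 1, 1]
  | 11 => [0, 1, 1, 1, 2]
  | 13 => [0, 2, 1, 1, 1, 2]
  | 17 => [0, 1, 1, 1, 1, 3, 2, 3]
  | 19 => [0, 2, 1, 1, 1, 1, 5, 2, 2]
  | _ => []

/-- The order of vanishing attached to `a_{k,p}`. -/
def orderAt (p k : ℕ) : ℕ := (orderList p).getD (k - 1) 0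

/-- The `n`-th coefficient of the series attached to the residue `a`. -/
def seriesCoeff (p a n : ℕ) : ℤ :=
  if n = 0 then (if a = 1 then 1 else 0) - (if a = p - 1 then 1 else 0)
  else ∑ d ∈ n.divisors, weightAt p (a * d % p)

/-- The finitely many numerical facts about the weights that are used. -/
structure WeightSpec (p : ℕ) : Prop where
  odd : ∀ c ∈ Finset.range p, weightAt p ((p - c) % p) = -weightAt p c
  -- The sawtooth at c is (p - 2c)/(2p); this is the convolution identity cleared of denominators.
  sum : ∀ d ∈ Finset.range p, ∑ c ∈ Finset.range p, ((p : ℤ) - 2 * c) * weightAt p (c * d % p) =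
    4 * p * ((if d = 1 then 1 else 0) - (if d = p - 1 then 1 else 0))
  -- The a_k form a half system: with their negatives they run once through the nonzero residues.
  rep : (Finset.Icc 1 ((p - 1) / 2)).val.map (repNat p) +
    (Finset.Icc 1 ((p - 1) / 2)).val.map (fun k => p - repNat p k) = (Finset.Icc 1 (p - 1)).val
  low : ∀ k ∈ Finset.Icc 1 ((p - 1) / 2), ∀ n ∈ Finset.range (orderAt p k),
    seriesCoeff p (repNat p k) n = 0
  lead : ∀ k ∈ Finset.Icc 1 ((p - 1) / 2), seriesCoeff p (repNat p k) (orderAt p k) = 1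
  order : ∑ k ∈ Finset.Icc 1 ((p - 1) / 2), orderAt p k = delta p
  delta_eq : 24 * delta p + 1 = p ^ 2
  first : repNat p 1 = 1
  other : ∀ k ∈ Finset.Icc 2 ((p - 1) / 2), 0 < orderAt p k

lemma weightSpec {p : ℕ} (hp : p.Prime) (h5 : 5 ≤ p) (h19 : p ≤ 19) : WeightSpec p := by
  interval_cases p
  all_goals first
    | (exfalso; revert hp; norm_num; done)
    | exact ⟨by decide +kernel, by decide +kernel, by decide +kernel, by decide +kernel,
        by decide +kernel, by decide +kernel, by decide +kernel, by decide +kernel,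
        by decide +kernel⟩

end CoreConv

/-! ### Products of the Eisenstein series and the core generating function. -/

namespace CoreConv

open PowerSeries

lemma repNat_mem {p : ℕ} (hS : WeightSpec p) {k : ℕ} (hk : k ∈ Finset.Icc 1 ((p - 1) / 2)) :
    repNat p k ∈ Finset.Icc 1 (p - 1) := by
  rw [← Finset.mem_val, ← hS.rep]
  exact Multiset.mem_add.mpr (.inl (Multiset.mem_map_of_mem _ hk))

lemma repNat_lt {p : ℕ} (hS : WeightSpec p) {k : ℕ} (hk : k ∈ Finset.Icc 1 ((p - 1) / 2)) :
    repNat p k < p := by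
  have := Finset.mem_Icc.mp (repNat_mem hS hk)
  omega

section Weights

variable {p : ℕ} [Fact p.Prime]

/-- The function `2 ℓ_p / (p - 1)` on residues. -/
noncomputable def weightFun (p : ℕ) (c : ZMod p) : ℂ := weightAt p c.val

lemma weightFun_odd (hS : WeightSpec p) : (weightFun p).Odd := by
  intro c
  rw [weightFun, weightFun, ZMod.neg_val', hS.odd _ (Finset.mem_range.mpr (ZMod.val_lt c))]
  push_cast
  rfl

lemma eq_one_iff_val (d : ZMod p) : d = 1 ↔ d.val = 1 := by
  have : Fact (1 < p) := ⟨(Fact.out : p.Prime).one_lt⟩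
  rw [← ZMod.val_one p, (ZMod.val_injective p).eq_iff]

lemma eq_neg_one_iff_val (d : ZMod p) : d = -1 ↔ d.val = p - 1 := by
  have : Fact (1 < p) := ⟨(Fact.out : p.Prime).one_lt⟩
  have h1 : (-1 : ZMod p).val = p - 1 := by
    rw [ZMod.neg_val', ZMod.val_one p]
    exact Nat.mod_eq_of_lt (Nat.sub_lt (Fact.out : p.Prime).pos one_pos)
  rw [← h1, (ZMod.val_injective p).eq_iff]

lemma sum_sawtooth_mul_weightFun (hS : WeightSpec p) (d : ZMod p) :
    ∑ c, sawtooth c * weightFun p (c * d) =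
      2 * ((if d = 1 then 1 else 0) - if d = -1 then 1 else 0) := by
  have hp : (p : ℂ) ≠ 0 := Nat.cast_ne_zero.mpr (Fact.out : p.Prime).ne_zero
  have h1 := congrArg (Int.cast : ℤ → ℂ) (hS.sum d.val (Finset.mem_range.mpr (ZMod.val_lt d)))
  push_cast at h1
  simp_rw [eq_one_iff_val d, eq_neg_one_iff_val d]
  rw [sum_zmod_eq_sum_range]
  have h2 : ∀ c ∈ Finset.range p, sawtooth (c : ZMod p) * weightFun p ((c : ZMod p) * d) =
      (2 * p : ℂ)⁻¹ * (((p : ℂ) - 2 * c) * weightAt p (c * d.val % p)) := by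
    intro c hc
    rw [sawtooth, weightFun, ZMod.val_mul, ZMod.val_cast_of_lt (Finset.mem_range.mp hc)]
    field_simp
  rw [Finset.sum_congr rfl h2, ← Finset.mul_sum, h1]
  field_simp
  ring

lemma ell_eq_weightFun (hS : WeightSpec p) (d : ℤ) : ell p d = (p - 1) / 2 * weightFun p d := by
  refine ell_eq (v := fun c => ((p : ℂ) - 1) / 2 * weightFun p c) (fun c => ?_) (fun d => ?_) d
  · beta_reduce
    rw [weightFun_odd hS, mul_neg]
  · refine (Finset.sum_congr rfl fun c _ => mul_left_comm _ _ _).trans ?_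
    rw [← Finset.mul_sum, sum_sawtooth_mul_weightFun hS]
    ring

/-- The weight one Eisenstein series attached to the residue `a`. -/
noncomputable def eisSeries (p : ℕ) [Fact p.Prime] (a : ZMod p) : ℂ⟦X⟧ :=
  weightOneSeries fun c => weightFun p (a * c)

lemma eisSeries_neg (hS : WeightSpec p) (a : ZMod p) : eisSeries p (-a) = -eisSeries p a := by
  ext n
  simp only [eisSeries, weightOneSeries, divisorSeries, map_neg, coeff_mk, neg_mul,
    weightFun_odd hS _, mul_neg, Finset.sum_neg_distrib]
  split_ifs <;> rfl

lemma coeff_eisSeries (hS : WeightSpec p) {a : ℕ} (ha : a < p) (n : ℕ) :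
    coeff n (eisSeries p a) = seriesCoeff p a n := by
  rw [eisSeries, weightOneSeries, divisorSeries, coeff_mk, seriesCoeff]
  rcases eq_or_ne n 0 with h0 | h0
  · rw [if_pos h0, if_pos h0]
    simp_rw [mul_comm (a : ZMod p)]
    rw [sum_sawtooth_mul_weightFun hS]
    simp_rw [eq_one_iff_val, eq_neg_one_iff_val, ZMod.val_cast_of_lt ha]
    push_cast
    ring
  · rw [if_neg h0, if_neg h0]
    push_cast
    refine Finset.sum_congr rfl fun d _ => ?_
    rw [weightFun, ← Nat.cast_mul, ZMod.val_natCast]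

lemma coeff_eisSeries_of_ne_zero (hS : WeightSpec p) (k : ℕ) {n : ℕ} (hn : n ≠ 0) :
    coeff n (eisSeries p (repNat p k)) = 2 / (p - 1) * ∑ d ∈ n.divisors, ell p (rep p k * (d : ℤ)) := by
  have hp1 : (p : ℂ) - 1 ≠ 0 := sub_ne_zero.mpr (Nat.cast_ne_one.mpr (Fact.out : p.Prime).ne_one)
  rw [eisSeries, weightOneSeries, divisorSeries, coeff_mk, if_neg hn, Finset.mul_sum]
  refine Finset.sum_congr rfl fun d _ => ?_
  rw [ell_eq_weightFun hS, show rep p k = (repNat p k : ℤ) from rfl]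
  push_cast
  field_simp

lemma prod_units_eq {M : Type*} [CommMonoid M] (f : ZMod p → M) :
    ∏ u : (ZMod p)ˣ, f u = ∏ c ∈ Finset.Icc 1 (p - 1), f (c : ℕ) := by
  refine Finset.prod_bij (fun u _ => (u : ZMod p).val) ?_ ?_ ?_ ?_
  · intro u _
    have h1 := ZMod.val_lt (u : ZMod p)
    have h2 : (u : ZMod p).val ≠ 0 := fun h => u.ne_zero ((ZMod.val_eq_zero _).mp h)
    rw [Finset.mem_Icc]
    omega
  · exact fun u _ v _ h => Units.ext (ZMod.val_injective p h)
  · intro c hc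
    rw [Finset.mem_Icc] at hc
    have hlt : c < p := by omega
    have h0 : (c : ZMod p) ≠ 0 := fun h => by
      have := ZMod.val_cast_of_lt hlt
      rw [h, ZMod.val_zero] at this
      omega
    exact ⟨Units.mk0 _ h0, Finset.mem_univ _, ZMod.val_cast_of_lt hlt⟩
  · intro u _
    rw [ZMod.natCast_zmod_val]

lemma prod_units_eq_prod_rep (hS : WeightSpec p) {M : Type*} [CommMonoid M] (f : ZMod p → M) :
    ∏ u : (ZMod p)ˣ, f u =
      ∏ k ∈ Finset.Icc 1 ((p - 1) / 2), f (repNat p k) * f (-(repNat p k : ℕ)) := by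
  rw [prod_units_eq, Finset.prod_mul_distrib]
  have h1 := congrArg (fun s : Multiset ℕ => (s.map fun n : ℕ => f (n : ZMod p)).prod) hS.rep
  beta_reduce at h1
  rw [Multiset.map_add, Multiset.prod_add, Multiset.map_map, Multiset.map_map] at h1
  refine h1.symm.trans ?_
  congr 1
  refine Finset.prod_congr rfl fun k hk => ?_
  rw [Function.comp_apply, Nat.cast_sub (repNat_lt hS hk).le, ZMod.natCast_self, zero_sub]

lemma exists_eisSeries_eq (hS : WeightSpec p) {k : ℕ} (hk : k ∈ Finset.Icc 1 ((p - 1) / 2)) :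
    ∃ U : ℂ⟦X⟧, eisSeries p (repNat p k) = X ^ orderAt p k * U ∧ coeff 0 U = 1 := by
  have h1 := coeff_eisSeries hS (repNat_lt hS hk)
  obtain ⟨U, hU⟩ : X ^ orderAt p k ∣ eisSeries p (repNat p k) := by
    rw [X_pow_dvd_iff]
    intro n hn
    rw [h1, hS.low k hk n (Finset.mem_range.mpr hn), Int.cast_zero]
  refine ⟨U, hU, ?_⟩
  have h2 := h1 (orderAt p k)
  rw [hS.lead k hk, Int.cast_one, hU, coeff_X_pow_mul', if_pos le_rfl, Nat.sub_self] at h2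
  exact h2

end Weights

/-- The cofactor of x - y in x^n - y^n has constant term n ≠ 0, so it is not zero. -/
lemma eq_of_pow_eq_pow {x y : ℂ⟦X⟧} {n : ℕ} (hn : n ≠ 0) (h : x ^ n = y ^ n)
    (hx : constantCoeff x = 1) (hy : constantCoeff y = 1) : x = y := by
  have h1 := (Commute.all x y).geom_sum₂_mul n
  rw [h, sub_self] at h1
  refine sub_eq_zero.mp ((mul_eq_zero.mp h1).resolve_left fun h0 => ?_)
  have h2 := congrArg constantCoeff h0
  simp only [map_sum, map_mul, map_pow, hx, hy, one_pow, mul_one, Finset.sum_const,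
    Finset.card_range, nsmul_eq_mul, map_zero] at h2
  exact hn (by exact_mod_cast h2)

/-- The product of the weight one Eisenstein series is the generating function of `p`-cores. -/
theorem prod_eisSeries_eq {p : ℕ} [Fact p.Prime] (hS : WeightSpec p) :
    ∏ k ∈ Finset.Icc 1 ((p - 1) / 2), eisSeries p (repNat p k) =
      X ^ delta p * mk fun n => (coreCount p n : ℂ) := by
  have hp0 : p ≠ 0 := (Fact.out : p.Prime).ne_zero
  choose! U hU hU1 using fun k hk => exists_eisSeries_eq hS (k := k) hk
  set s := Finset.Icc 1 ((p - 1) / 2) with hs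
  set W := ∏ k ∈ s, U k with hW
  have hprod : ∏ k ∈ s, eisSeries p (repNat p k) = X ^ delta p * W := by
    rw [Finset.prod_congr rfl hU, Finset.prod_mul_distrib, Finset.prod_pow_eq_pow_sum, hS.order]
  have hW1 : constantCoeff W = 1 := by
    rw [hW, map_prod]
    exact Finset.prod_eq_one fun k hk => by
      rw [← coeff_zero_eq_constantCoeff_apply, hU1 k hk]
  set A := pentagonalSeries ℂ with hA
  have hA1 : constantCoeff A = 1 := by
    rw [← coeff_zero_eq_constantCoeff_apply, coeff_zero_pentagonalSeries]
  -- The factors for a and -a multiply to -E_a², so the product over all units is the square of the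
  -- half product up to sign and vanishes to order 2δ. The sign disappears in the 12th power.
  have hV : ∏ u : (ZMod p)ˣ, weightOneSeries (fun c => weightFun p ((u : ZMod p) * c)) =
      X ^ (2 * delta p) * ((-1) ^ s.card * W ^ 2) := by
    have h1 := prod_units_eq_prod_rep hS (eisSeries p)
    simp_rw [eisSeries_neg hS] at h1
    refine h1.trans ?_
    have h2 : ∀ k ∈ s, eisSeries p (repNat p k) * -eisSeries p (repNat p k) =
        -1 * eisSeries p (repNat p k) ^ 2 := fun k _ => by ring
    rw [Finset.prod_congr rfl h2, Finset.prod_mul_distrib, Finset.prod_const, Finset.prod_pow,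
      hprod]
    ring
  have h1 := pow_mul_pow_pentagonalSeries_eq (weightFun_odd hS) hV
    (by rw [← hS.delta_eq]; ring) (by
      rw [coeff_zero_eq_constantCoeff_apply, map_mul, map_pow, map_pow, hW1, map_neg, map_one,
        one_pow, mul_one, ← pow_mul, mul_comm, pow_mul]
      norm_num)
  have h2 : ((-1) ^ s.card * W ^ 2) ^ 12 * A ^ 24 = (W * A) ^ 24 := by
    have h3 : ((-1 : ℂ⟦X⟧) ^ s.card) ^ 12 = 1 := by
      rw [← pow_mul, mul_comm, pow_mul]
      norm_num
    rw [mul_pow, h3]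
    ring
  rw [h2, ← pow_mul, mul_comm 24, pow_mul] at h1
  have h3 : W * A = expand p hp0 A ^ p := by
    refine eq_of_pow_eq_pow (by norm_num) h1 ?_ ?_
    · rw [map_mul, hW1, hA1, one_mul]
    · rw [map_pow, constantCoeff_expand, hA1, one_pow]
  have hA0 : A ≠ 0 := fun h => by rw [h, map_zero] at hA1; exact zero_ne_one hA1
  rw [hprod, mul_right_cancel₀ hA0 (h3.trans (mk_coreCount_mul_pentagonalSeries p hp0).symm)]

lemma pow_mul_sum_compositions {P : ℕ → ℂ⟦X⟧} {g : ℕ → ℕ → ℂ} {c : ℂ} (m n : ℕ)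
    (hP : ∀ k ∈ Finset.Icc 1 m, coeff 0 (P k) = 0)
    (hg : ∀ k ∈ Finset.Icc 1 m, ∀ r ≠ 0, coeff r (P k) = c * g k r) :
    c ^ m * ∑ r ∈ compositions m n, ∏ k ∈ Finset.Icc 1 m, g k (r k) =
      coeff n (∏ k ∈ Finset.Icc 1 m, P k) := by
  rw [← sum_compositions_eq_coeff m n hP, Finset.mul_sum]
  refine Finset.sum_congr rfl fun r hr => ?_
  have h1 := (mem_compositions.mp hr).2
  rw [Finset.prod_congr rfl fun k hk => hg k hk (r k) (Nat.one_le_iff_ne_zero.mp (h1 k hk)),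
    Finset.prod_mul_distrib, Finset.prod_const, Nat.card_Icc, Nat.add_sub_cancel]

lemma prod_Icc_one_succ {M : Type*} [CommMonoid M] (f : ℕ → M) (m : ℕ) :
    ∏ k ∈ Finset.Icc 1 (m + 1), f k = f 1 * ∏ k ∈ Finset.Icc 1 m, f (k + 1) := by
  induction m with
  | zero => simp
  | succ m ih =>
    rw [Finset.prod_Icc_succ_top (by omega), ih, Finset.prod_Icc_succ_top (by omega), mul_assoc]

end CoreConv

open PowerSeries CoreConv in
theorem mainTheorem9 (p : ℕ) [Fact p.Prime] (hp5 : 5 ≤ p) (hp19 : p ≤ 19)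
    (n : ℕ) (hn : CoreConv.delta p ≤ n) :
    (CoreConv.coreCount p (n - CoreConv.delta p) : ℂ) =
      (2 / ((p : ℂ) - 1)) ^ ((p - 3) / 2) *
          ∑ r ∈ CoreConv.compositions ((p - 3) / 2) n,
            ∏ k ∈ Finset.Icc 1 ((p - 3) / 2),
              ∑ d ∈ (r k).divisors, CoreConv.ell p (CoreConv.rep p (k + 1) * (d : ℤ)) +
        (2 / ((p : ℂ) - 1)) ^ ((p - 1) / 2) *
          ∑ r ∈ CoreConv.compositions ((p - 1) / 2) n,
            ∏ k ∈ Finset.Icc 1 ((p - 1) / 2),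
              ∑ d ∈ (r k).divisors, CoreConv.ell p (CoreConv.rep p k * (d : ℤ)) := by
  have hS := weightSpec Fact.out hp5 hp19
  obtain ⟨m, hm1, hm2⟩ : ∃ m, (p - 1) / 2 = m + 1 ∧ (p - 3) / 2 = m := ⟨(p - 3) / 2, by omega, rfl⟩
  have h1 : coeff 0 (eisSeries p (repNat p 1)) = 1 := by
    rw [coeff_eisSeries hS (repNat_lt hS (Finset.mem_Icc.mpr (by omega))), hS.first, seriesCoeff,
      if_pos rfl, if_pos rfl, if_neg (by omega)]
    norm_num
  have h2 : ∀ k ∈ Finset.Icc 1 m, coeff 0 (eisSeries p (repNat p (k + 1))) = 0 := by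
    intro k hk
    rw [Finset.mem_Icc] at hk
    have hk' : k + 1 ∈ Finset.Icc 1 ((p - 1) / 2) := Finset.mem_Icc.mpr (by omega)
    rw [coeff_eisSeries hS (repNat_lt hS hk'), hS.low _ hk' 0 (Finset.mem_range.mpr
      (hS.other _ (Finset.mem_Icc.mpr (by omega)))), Int.cast_zero]
  -- Subtracting 1 removes the only nonzero constant term, so that sums over parts r_k ≥ 1 are
  -- exactly coefficients of products. The two sums then add up through Q + (E_1 - 1) Q = E_1 Q,
  -- where Q is the product of the remaining factors.
  let P : ℕ → ℂ⟦X⟧ := fun k => if k = 1 then eisSeries p (repNat p 1) - 1 else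
    eisSeries p (repNat p k)
  have hP0 : ∀ k ∈ Finset.Icc 1 (m + 1), coeff 0 (P k) = 0 := by
    intro k hk
    rw [Finset.mem_Icc] at hk
    rcases eq_or_ne k 1 with rfl | hk1
    · rw [show P 1 = _ - 1 from if_pos rfl, map_sub, h1, coeff_zero_eq_constantCoeff_apply,
        map_one, sub_self]
    · obtain ⟨j, rfl⟩ : ∃ j, k = j + 1 := ⟨k - 1, by omega⟩
      simp only [P, if_neg hk1]
      exact h2 j (Finset.mem_Icc.mpr (by omega))
  have hPr : ∀ k ∈ Finset.Icc 1 (m + 1), ∀ r ≠ 0, coeff r (P k) =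
      2 / ((p : ℂ) - 1) * ∑ d ∈ r.divisors, ell p (rep p k * (d : ℤ)) := by
    intro k _ r hr
    rw [← coeff_eisSeries_of_ne_zero hS k hr]
    rcases eq_or_ne k 1 with rfl | hk1
    · simp [P, coeff_one, hr]
    · simp [P, hk1]
  rw [hm1, hm2, pow_mul_sum_compositions (g := fun k r => ∑ d ∈ r.divisors,
      ell p (rep p (k + 1) * (d : ℤ))) m n h2 fun k _ r hr => coeff_eisSeries_of_ne_zero hS _ hr,
    pow_mul_sum_compositions (g := fun k r => ∑ d ∈ r.divisors, ell p (rep p k * (d : ℤ)))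
      (m + 1) n hP0 hPr, prod_Icc_one_succ P, ← map_add]
  have h3 : ∀ k ∈ Finset.Icc 1 m, P (k + 1) = eisSeries p (repNat p (k + 1)) := by
    intro k hk
    rw [Finset.mem_Icc] at hk
    exact if_neg (by omega)
  have h4 := prod_eisSeries_eq hS
  rw [hm1, prod_Icc_one_succ] at h4
  have h5 : P 1 = eisSeries p (repNat p 1) - 1 := if_pos rfl
  rw [Finset.prod_congr rfl h3, h5, sub_mul, one_mul, add_sub_cancel, h4, coeff_X_pow_mul',
    if_pos hn, coeff_mk]
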